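/- **Setting.** Let $V\hookrightarrow H\simeq H'\hookrightarrow V'$ be a Gelfand triple of real separable Hilbert spaces (dense embedding), $I=(0,T)$ with $0<T<\infty$, and let $a(t;\cdot,\cdot)$, $t\in I$, be bilinear forms on $V$ that are measurable in $t$ and, uniformly for a.e. $t$, bounded, coercive and symmetric. Let $Y=L_2(I;V)$, $X=L_2(I;V)\cap H^1(I;V')$, $(Aw)(v)=\int_I a(t;w(t),v(t))\,dt$, $(Bw)(v)=\int_I\langle\partial_t w(t),v(t)\rangle+a(t;w(t),v(t))\,dt$, let $\gamma_t w=w(t)\in H$ for $t\in[0,T]$, and use the energy norms $\|v\|_Y^2=(Av)(v)$ and $\|w\|_X^2=\|w\|_Y^2+\|\partial_t w\|_{Y'}^2+\|\gamma_T w\|_H^2$. Given $g\in Y'$ and $u_0\in H$, let $u\in X$ be the solution of $Bu=g$, $\gamma_0u=u_0$. For $\delta$ in an index set $\Delta$ let $X^\delta\subseteq X$ and $Y^\delta\subseteq Y$ be closed subspaces with $X^\delta\subseteq Y^\delta$, put $\delta\preceq\tilde\delta:\Leftrightarrow X^\delta\subseteq X^{\tilde\delta}$, and assume $$\gamma_\Delta:=\inf_{\delta}\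 \inf_{w\in X^\delta,\ \partial_tw\ne0}\ \sup_{0\ne v\in Y^\delta}\frac{(\partial_tw)(v)}{\|\partial_tw\|_{Y'}\|v\|_Y}>0$$ (with $\gamma_\Delta:=1$ if there is no such $w$). Let $\delta\mapsto\underline\delta\succeq\delta$ be a map $\Delta\to\Delta$. Let $K_Y^\delta:(Y^\delta)'\to Y^\delta$ and $K_X^\delta:(X^\delta)'\to X^\delta$ be self-adjoint and boundedly invertible with $$\kappa_\Delta^{-1}(Av)(v)\le((K_Y^\delta)^{-1}v)(v)\le\kappa_\Delta(Av)(v)\ (v\in Y^\delta),\qquad k_1\|z\|_X^2\le((K_X^\delta)^{-1}z)(z)\le k_2\|z\|_X^2\ (z\in X^\delta)$$ for all $\delta$, where $\kappa_\Delta\ge1$ and $0<k_1\le k_2$. * *Stable complement:* there are finite collections $\Theta_\delta=\{\theta_\lambda:\lambda\in J_\delta\}$ with $X^\delta+\operatorname{span}\Theta_\delta=X^{\underline\delta}$ and constants $0<m\le M$ such that $m^2\|z+{\bf c}^\top\Theta_\delta\|_X^2\le\|z\|_X^2+\|{\bf c}\|^2\le M^2\|z+{\bf c}^\top\Theta_\delta\|_X^2$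 for all $\delta$, $z\in X^\delta$, ${\bf c}\in\mathbb R^{J_\delta}$. * *Saturation:* there are subspaces $G^\delta\times U_0^\delta\subseteq Y'\times H$ and a constant $\zeta<1$ such that, for every $\delta$, if $w\in X$ satisfies $(Bw,\gamma_0w)\in G^\delta\times U_0^\delta$, then $\inf_{z\in X^{\underline\delta}}\|w-z\|_X\le\zeta\inf_{z\in X^\delta}\|w-z\|_X$. * *Data:* there are $(g^\delta,u_0^\delta)\in G^\delta\times U_0^\delta$ and $\eta:\Delta\to\mathbb R$ with $\|g-g^\delta\|_{Y'}+\|u_0-u_0^\delta\|_H\le\eta(\delta)$, with $\eta(\tilde\delta)\le\eta(\delta)$ whenever $\tilde\delta\succeq\delta$, and with $\inf_\delta\eta(\delta)\le0$. For $w\in X^\delta$ let $\rho^\delta(w)\in X'$ be given by $$\rho^\delta(w)(z)=(Bz)\big(K_Y^{\underline\delta}\,(g^\delta-Bw)|_{Y^{\underline\delta}}\big)+\langle u_0^\delta-\gamma_0w,\gamma_0z\rangle_H .$$ For an approximation $\tilde u^\delta\in X^\delta$ put ${\bf\tilde r}^\delta=(\rho^\delta(\tilde u^\delta)(\theta_\lambda))_{\lambda\in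 J_\delta}$ and $\tilde t_\delta=\big(\rho(K_X^\delta\rho)\big)^{1/2}$ with $\rho=\rho^\delta(\tilde u^\delta)|_{X^\delta}$. **Algorithm**, with parameters $\omega>0$, $\vartheta\in(0,1]$, $\xi\in(0,1)$, $\varepsilon>0$. Start with any $\delta\in\Delta$ and any $t_\delta\ge0$ (for instance $t_\delta\eqsim\|g\|_{Y'}+\|u_0\|_H$). Repeat: 1. (inner loop) do: compute some $\tilde u^\delta\in X^\delta$ with $\tilde t_\delta\le t_\delta/2$ and set $t_\delta:=\tilde t_\delta$; if $e_\delta:=\|{\bf\tilde r}^\delta\|+\eta(\delta)+t_\delta\le\varepsilon$ then stop; until $t_\delta\le\xi e_\delta$. 2. If $\eta(\delta)>\omega\|{\bf\tilde r}^\delta\|$, select some $\tilde\delta\succeq\delta$ with $\eta(\tilde\delta)\le\eta(\delta)/2$; otherwise select some $\delta\preceq\tilde\delta\preceq\underline\delta$ such that $X^{\tilde\delta}$ contains $\{\theta_\lambda:\lambda\in J\}$ for a $J\subseteq J_\delta$ with $\|{\bf\tilde r}^\delta|_J\|\ge\vartheta\|{\bf\tilde r}^\delta\|$. 3. Set $t_{\tilde\delta}:=e_\delta$,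 $\delta:=\tilde\delta$. **Theorem 4.8.** For given $\zeta,m,M,k_1,k_2$ there are $\vartheta_0,s,C>0$ and a function $h:(0,\infty)\to(0,\infty)$ such that the following holds for all $\vartheta\in(0,1]$, $\omega>0$, $\xi\in(0,1)$ with $$\vartheta\le\vartheta_0,\quad \tfrac{\omega}{\vartheta}\le s,\quad \tfrac{\xi}{\vartheta}\le s,\quad \tfrac{\xi}{\omega}\le s,\quad \omega\le h(\vartheta).$$ There is a constant $\breve\rho\in[0,1)$ such that for all problems and discretizations as above with $$\Big(\tfrac{\kappa_\Delta}{\gamma_\Delta}-1\Big)/\omega\le s,\qquad \tfrac{\kappa_\Delta}{\gamma_\Delta}-1\le h(\vartheta),$$ all data $g,u_0$, all $\varepsilon>0$, all starting values, and all choices made in the algorithm: * Between any two successive passings of the until-clause, the value of $\vartheta\|u-\tilde u^\delta\|_X+\eta(\delta)$ decreases by at least the factor $\breve\rho$. * Hence the convergence is r-linear: if $\tilde u^{\delta}$, $\tilde u^{\delta'}$ are the approximations at a passing and at the $k$-th passing after it, then $\|u-\tilde u^{\delta'}\|_X+\eta(\delta')\le\vartheta^{-1}\breve\rho^{\,k}\,(\|u-\tilde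 u^{\delta}\|_X+\eta(\delta))$. * The algorithm terminates: there is no infinite execution and, provided that for every $\delta$ with $\eta(\delta)>0$ there is a $\tilde\delta\succeq\delta$ with $\eta(\tilde\delta)\le\eta(\delta)/2$, every execution that has not stopped can be continued. * At termination, $\|u-\tilde u^\delta\|_X+\eta(\delta)\le C\varepsilon$. -/

import Mathlib

open MeasureTheory Set

universe u v w

namespace SpaceTime

noncomputable section

/-- Lebesgue measure on the time interval `I = (0, T)`. -/
abbrev timeMeasure (T : ℝ) : Measure ℝ := volume.restrict (Ioo 0 T)

/-- The Bochner space `L₂(I; E)`. -/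
abbrev L2 (T : ℝ) (E : Type*) [NormedAddCommGroup E] := Lp E 2 (timeMeasure T)

/-- The bounded functional with the values `f`; it is only used for functions `f` that are
linear and bounded (and is set to `0` for any other `f`). -/
def boundedFunctional {E : Type*} [NormedAddCommGroup E] [NormedSpace ℝ E] (f : E → ℝ) :
    StrongDual ℝ E :=
  open Classical in if h : ∃ F : StrongDual ℝ E, ∀ x, F x = f x then h.choose else 0

/-- A self-adjoint boundedly invertible map `E' → E`. -/
structure Preconditioner (E : Type*) [NormedAddCommGroup E] [NormedSpace ℝ E] where
  toEquiv : StrongDual ℝ E ≃L[ℝ] E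
  symm : ∀ f₁ f₂ : StrongDual ℝ E, f₁ (toEquiv f₂) = f₂ (toEquiv f₁)

/-- The form `(K⁻¹ y)(z)`. -/
def Preconditioner.invForm {E : Type*} [NormedAddCommGroup E] [NormedSpace ℝ E]
    (K : Preconditioner E) (y z : E) : ℝ := K.toEquiv.symm y z

/-- The value `ρ (K ρ)` for the bounded functional `ρ` with the values `f`. -/
def Preconditioner.quad {E : Type*} [NormedAddCommGroup E] [NormedSpace ℝ E]
    (K : Preconditioner E) (f : E → ℝ) : ℝ :=
  boundedFunctional f (K.toEquiv (boundedFunctional f))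

/-- The data of the parabolic problem: a Gelfand triple `V ↪ H ≃ H' ↪ V'`, an end time `T`, and
bilinear forms `a(t; ·, ·)` on `V`, `t ∈ (0, T)`, that are measurable in `t` and, uniformly for
a.e. `t`, bounded, coercive and symmetric. -/
structure ParabolicProblem (V : Type u) (H : Type v)
    [NormedAddCommGroup V] [InnerProductSpace ℝ V]
    [NormedAddCommGroup H] [InnerProductSpace ℝ H] where
  T : ℝ
  T_pos : 0 < T
  ι : V →L[ℝ] H
  ι_injective : Function.Injective ι
  ι_dense : DenseRange ι
  a : ℝ → V →L[ℝ] V →L[ℝ] ℝ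
  a_measurable : ∀ η ζ : V, AEMeasurable (fun t => a t η ζ) (timeMeasure T)
  a_bounded : ∃ C : ℝ, ∀ᵐ t ∂(timeMeasure T), ∀ η ζ : V, |a t η ζ| ≤ C * ‖η‖ * ‖ζ‖
  a_coercive : ∃ α : ℝ, 0 < α ∧ ∀ᵐ t ∂(timeMeasure T), ∀ η : V, α * ‖η‖ ^ 2 ≤ a t η η
  a_symm : ∀ᵐ t ∂(timeMeasure T), ∀ η ζ : V, a t η ζ = a t ζ η

namespace ParabolicProblem

variable {V : Type u} {H : Type v} [NormedAddCommGroup V] [InnerProductSpace ℝ V]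
  [NormedAddCommGroup H] [InnerProductSpace ℝ H] (P : ParabolicProblem V H)

/-- `Y = L₂(I; V)`. -/
abbrev Y := L2 P.T V

/-- `w'` is the weak time derivative in `L₂(I; V')` of `w ∈ L₂(I; V)`, where `z ∈ V` is
identified with the functional `⟨ι z, ι ·⟩_H ∈ V'`. -/
def IsWeakDeriv (w : P.Y) (w' : L2 P.T (StrongDual ℝ V)) : Prop :=
  ∀ φ : ℝ → ℝ, ContDiff ℝ (⊤ : ℕ∞) φ → HasCompactSupport φ → tsupport φ ⊆ Ioo 0 P.T → ∀ v : V,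
    ∫ t, deriv φ t * inner ℝ (P.ι (w t)) (P.ι v) ∂(timeMeasure P.T)
      = -∫ t, φ t * w' t v ∂(timeMeasure P.T)

theorem integrable_bdd_mul (ψ : ℝ → ℝ) (hψ : Continuous ψ) (hc : HasCompactSupport ψ)
    {f : ℝ → ℝ} (hf : Integrable f (timeMeasure P.T)) :
    Integrable (fun t => ψ t * f t) (timeMeasure P.T) := by
  obtain ⟨C, hC⟩ := hc.exists_bound_of_continuous hψ
  exact hf.bdd_mul hψ.aestronglyMeasurable (c := C) (Filter.Eventually.of_forall hC)

theorem integrable_left (w : P.Y) (v : V) :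
    Integrable (fun t => inner ℝ (P.ι (w t)) (P.ι v)) (timeMeasure P.T) := by
  have h : Integrable w (timeMeasure P.T) := (Lp.memLp w).integrable one_le_two
  have := ((innerSL ℝ (P.ι v)).comp P.ι).integrable_comp h
  refine this.congr (Filter.Eventually.of_forall fun t => ?_)
  simp [real_inner_comm]

theorem integrable_right (w' : L2 P.T (StrongDual ℝ V)) (v : V) :
    Integrable (fun t => w' t v) (timeMeasure P.T) := by
  have h : Integrable w' (timeMeasure P.T) := (Lp.memLp w').integrable one_le_two
  exact (ContinuousLinearMap.apply ℝ ℝ v).integrable_comp h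

/-- `X = L₂(I; V) ∩ H¹(I; V')`, realised as the space of pairs `(w, ∂ₜ w)`; as a subspace of the
Hilbert sum `L₂(I; V) ⊕ L₂(I; V')` it carries the canonical norm of `X`. -/
def XSpace : Submodule ℝ (WithLp 2 (P.Y × L2 P.T (StrongDual ℝ V))) where
  carrier := {p | P.IsWeakDeriv p.fst p.snd}
  zero_mem' := by
    intro φ _ _ _ v
    have h1 := Lp.coeFn_zero V 2 (timeMeasure P.T)
    have h2 := Lp.coeFn_zero (StrongDual ℝ V) 2 (timeMeasure P.T)
    have e1 : ∫ t, deriv φ t * inner ℝ (P.ι ((0 : WithLp 2 (P.Y × L2 P.T (StrongDual ℝ V))).fst t))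
        (P.ι v) ∂(timeMeasure P.T) = ∫ _t, (0 : ℝ) ∂(timeMeasure P.T) := integral_congr_ae ?_
    have e2 : ∫ t, φ t * (0 : WithLp 2 (P.Y × L2 P.T (StrongDual ℝ V))).snd t v
        ∂(timeMeasure P.T) = ∫ _t, (0 : ℝ) ∂(timeMeasure P.T) := integral_congr_ae ?_
    rw [e1, e2]
    · simp only [integral_zero, neg_zero]
    · filter_upwards [h2] with t ht
      change φ t * (0 : L2 P.T (StrongDual ℝ V)) t v = 0
      rw [ht, Pi.zero_apply, zero_apply, mul_zero]
    · filter_upwards [h1] with t ht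
      change deriv φ t * inner ℝ (P.ι ((0 : P.Y) t)) (P.ι v) = 0
      rw [ht, Pi.zero_apply, map_zero, inner_zero_left, mul_zero]
  add_mem' := by
    intro p q hp hq φ hφ hc hs v
    have hφ' : Continuous (deriv φ) := hφ.continuous_deriv (by simp)
    have h1 := Lp.coeFn_add p.fst q.fst
    have h2 := Lp.coeFn_add p.snd q.snd
    have e1 : ∫ t, deriv φ t * inner ℝ (P.ι ((p + q).fst t)) (P.ι v) ∂(timeMeasure P.T)
        = ∫ t, (deriv φ t * inner ℝ (P.ι (p.fst t)) (P.ι v)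
          + deriv φ t * inner ℝ (P.ι (q.fst t)) (P.ι v)) ∂(timeMeasure P.T) := by
      refine integral_congr_ae ?_
      filter_upwards [h1] with t ht
      change deriv φ t * inner ℝ (P.ι ((p.fst + q.fst : P.Y) t)) (P.ι v) = _
      rw [ht]
      simp [inner_add_left, mul_add]
    have e2 : ∫ t, φ t * (p + q).snd t v ∂(timeMeasure P.T)
        = ∫ t, (φ t * p.snd t v + φ t * q.snd t v) ∂(timeMeasure P.T) := by
      refine integral_congr_ae ?_
      filter_upwards [h2] with t ht
      change φ t * (p.snd + q.snd : L2 P.T (StrongDual ℝ V)) t v = _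
      rw [ht]
      simp [mul_add]
    rw [e1, e2, integral_add, integral_add, hp φ hφ hc hs v, hq φ hφ hc hs v]
    · ring
    · exact P.integrable_bdd_mul _ hφ.continuous hc (P.integrable_right _ v)
    · exact P.integrable_bdd_mul _ hφ.continuous hc (P.integrable_right _ v)
    · exact P.integrable_bdd_mul _ hφ' hc.deriv (P.integrable_left _ v)
    · exact P.integrable_bdd_mul _ hφ' hc.deriv (P.integrable_left _ v)
  smul_mem' := by
    intro r p hp φ hφ hc hs v
    have h1 := Lp.coeFn_smul r p.fst
    have h2 := Lp.coeFn_smul r p.snd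
    have e1 : ∫ t, deriv φ t * inner ℝ (P.ι ((r • p).fst t)) (P.ι v) ∂(timeMeasure P.T)
        = ∫ t, r * (deriv φ t * inner ℝ (P.ι (p.fst t)) (P.ι v)) ∂(timeMeasure P.T) := by
      refine integral_congr_ae ?_
      filter_upwards [h1] with t ht
      change deriv φ t * inner ℝ (P.ι ((r • p.fst : P.Y) t)) (P.ι v) = _
      rw [ht]
      simp only [Pi.smul_apply, map_smul, real_inner_smul_left]
      ring
    have e2 : ∫ t, φ t * (r • p).snd t v ∂(timeMeasure P.T)
        = ∫ t, r * (φ t * p.snd t v) ∂(timeMeasure P.T) := by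
      refine integral_congr_ae ?_
      filter_upwards [h2] with t ht
      change φ t * (r • p.snd : L2 P.T (StrongDual ℝ V)) t v = _
      rw [ht]
      simp only [Pi.smul_apply, smul_apply, smul_eq_mul]
      ring
    rw [e1, e2, integral_const_mul, integral_const_mul, hp φ hφ hc hs v]
    ring

/-- The space `X`. -/
abbrev X := P.XSpace

/-- An element of `X` as an element of `Y`. -/
def toY (w : P.X) : P.Y := w.1.fst

/-- `∂ₜ w ∈ Y'`, i.e. `(∂ₜ w)(v) = ∫_I ⟨∂ₜ w(t), v(t)⟩ dt`. -/
def dt (w : P.X) : StrongDual ℝ P.Y :=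
  (ContinuousLinearMap.id ℝ (StrongDual ℝ V)).lpPairing (timeMeasure P.T) 2 2 w.1.snd

theorem dt_apply (w : P.X) (v : P.Y) :
    P.dt w v = ∫ t, w.1.snd t (v t) ∂(timeMeasure P.T) := by
  simp [dt, ContinuousLinearMap.lpPairing_eq_integral]

theorem aestronglyMeasurable_form {w v : ℝ → V} (hw : AEStronglyMeasurable w (timeMeasure P.T))
    (hv : AEStronglyMeasurable v (timeMeasure P.T)) :
    AEStronglyMeasurable (fun t => P.a t (w t) (v t)) (timeMeasure P.T) := by
  have step (f : ℝ → V →L[ℝ] ℝ) (hf : ∀ z, AEStronglyMeasurable (fun t => f t z)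
      (timeMeasure P.T)) {y : ℝ → V} (hy : AEStronglyMeasurable y (timeMeasure P.T)) :
      AEStronglyMeasurable (fun t => f t (y t)) (timeMeasure P.T) := by
    have hs := hy.stronglyMeasurable_mk
    refine aestronglyMeasurable_of_tendsto_ae Filter.atTop
      (f := fun n t => f t (hs.approx n t)) (fun n => ?_) ?_
    · have : (fun t => f t (hs.approx n t)) = fun t => ∑ z ∈ (hs.approx n).range,
          ((hs.approx n) ⁻¹' {z}).indicator (fun t => f t z) t := by
        classical
        funext t
        rw [Finset.sum_eq_single (hs.approx n t)]
        · simp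
        · intro z _ hz
          simp [Ne.symm hz]
        · intro h
          exact absurd (SimpleFunc.mem_range_self _ t) h
      rw [this]
      exact Finset.aestronglyMeasurable_fun_sum _ fun z _ =>
        (hf z).indicator ((hs.approx n).measurableSet_preimage _)
    · filter_upwards [hy.ae_eq_mk] with t ht
      rw [ht]
      exact ((f t).continuous.tendsto _).comp (hs.tendsto_approx t)
  refine step (fun t => P.a t (w t)) (fun z => ?_) hv
  exact step (fun t => (P.a t).flip z)
    (fun y => (P.a_measurable y z).aestronglyMeasurable) hw

theorem integrable_norm_mul (w v : P.Y) :
    Integrable (fun t => ‖w t‖ * ‖v t‖) (timeMeasure P.T) :=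
  (Lp.memLp w).norm.integrable_mul (Lp.memLp v).norm

theorem integrable_form (w v : P.Y) :
    Integrable (fun t => P.a t (w t) (v t)) (timeMeasure P.T) := by
  obtain ⟨C, hC⟩ := P.a_bounded
  refine ((P.integrable_norm_mul w v).const_mul C).mono'
    (P.aestronglyMeasurable_form (Lp.aestronglyMeasurable w) (Lp.aestronglyMeasurable v)) ?_
  filter_upwards [hC] with t ht
  simpa [mul_assoc] using ht (w t) (v t)

theorem integral_norm_mul_le (w v : P.Y) :
    ∫ t, ‖w t‖ * ‖v t‖ ∂(timeMeasure P.T) ≤ ‖w‖ * ‖v‖ := by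
  have hw := (Lp.memLp w).norm
  have hv := (Lp.memLp v).norm
  have h := real_inner_le_norm (hw.toLp (fun t => ‖w t‖)) (hv.toLp (fun t => ‖v t‖))
  rw [L2.inner_def, Lp.norm_toLp, Lp.norm_toLp, eLpNorm_norm, eLpNorm_norm] at h
  refine le_trans (le_of_eq (integral_congr_ae ?_)) h
  filter_upwards [hw.coeFn_toLp, hv.coeFn_toLp] with t h1 h2
  rw [h1, h2]
  simp [mul_comm]

/-- The operator `A : Y → Y'`, `(A w)(v) = ∫_I a(t; w(t), v(t)) dt`. -/
def A : P.Y →L[ℝ] StrongDual ℝ P.Y :=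
  LinearMap.mkContinuousOfExistsBound₂
    (LinearMap.mk₂ ℝ (fun w v : P.Y => ∫ t, P.a t (w t) (v t) ∂(timeMeasure P.T))
      (by
        intro w₁ w₂ v
        rw [← integral_add (P.integrable_form _ _) (P.integrable_form _ _)]
        refine integral_congr_ae ?_
        filter_upwards [Lp.coeFn_add w₁ w₂] with t ht
        rw [ht]
        simp)
      (by
        intro r w v
        rw [smul_eq_mul, ← integral_const_mul]
        refine integral_congr_ae ?_
        filter_upwards [Lp.coeFn_smul r w] with t ht
        rw [ht]
        simp)
      (by
        intro w v₁ v₂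
        rw [← integral_add (P.integrable_form _ _) (P.integrable_form _ _)]
        refine integral_congr_ae ?_
        filter_upwards [Lp.coeFn_add v₁ v₂] with t ht
        rw [ht]
        simp)
      (by
        intro r w v
        rw [smul_eq_mul, ← integral_const_mul]
        refine integral_congr_ae ?_
        filter_upwards [Lp.coeFn_smul r v] with t ht
        rw [ht]
        simp))
    (by
      obtain ⟨C, hC⟩ := P.a_bounded
      refine ⟨|C|, fun w v => ?_⟩
      rw [LinearMap.mk₂_apply]
      calc ‖∫ t, P.a t (w t) (v t) ∂(timeMeasure P.T)‖
          ≤ ∫ t, |C| * (‖w t‖ * ‖v t‖) ∂(timeMeasure P.T) := by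
            refine norm_integral_le_of_norm_le ((P.integrable_norm_mul w v).const_mul _) ?_
            filter_upwards [hC] with t ht
            refine (ht (w t) (v t)).trans ?_
            rw [mul_assoc]
            exact mul_le_mul_of_nonneg_right (le_abs_self C) (by positivity)
        _ ≤ |C| * ‖w‖ * ‖v‖ := by
            rw [integral_const_mul, mul_assoc]
            exact mul_le_mul_of_nonneg_left (P.integral_norm_mul_le w v) (abs_nonneg C))

theorem A_apply (w v : P.Y) : P.A w v = ∫ t, P.a t (w t) (v t) ∂(timeMeasure P.T) := rfl

/-- `B : X → Y'`, `(B w)(v) = ∫_I ⟨∂ₜ w(t), v(t)⟩ + a(t; w(t), v(t)) dt`. -/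
def B (w : P.X) : StrongDual ℝ P.Y := P.dt w + P.A (P.toY w)

/-- The trace `γ_t w ∈ H`, for `t ∈ [0, T]`: the value at `t` of the representative of
`w ∈ X` in `C([0, T]; H)`. (Such a representative exists, and it is unique.) -/
def trace (t : ℝ) (w : P.X) : H :=
  open Classical in
  if h : ∃ c : ℝ → H, ContinuousOn c (Icc 0 P.T) ∧
      (fun s => P.ι (P.toY w s)) =ᵐ[timeMeasure P.T] c
  then h.choose t else 0

/-- `u ∈ X` solves `B u = g`, `γ₀ u = u₀`. -/
def IsSolution (g : StrongDual ℝ P.Y) (u₀ : H) (u : P.X) : Prop :=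
  P.B u = g ∧ P.trace 0 u = u₀

/-- The energy norm on `Y`. -/
def normY (y : P.Y) : ℝ := Real.sqrt (P.A y y)

/-- The dual norm `sup_{0 ≠ v ∈ Z} f(v) / ‖v‖_Y` of the restriction of `f ∈ Y'` to a subspace
`Z ⊆ Y` with the energy norm (`v = 0` contributes the value `0`). -/
def dualNorm (Z : Submodule ℝ P.Y) (f : StrongDual ℝ P.Y) : ℝ :=
  sSup ((fun v : P.Y => f v / P.normY v) '' (Z : Set P.Y))

/-- The norm on `Y'` dual to the energy norm on `Y`. -/
def normYDual (f : StrongDual ℝ P.Y) : ℝ := P.dualNorm ⊤ f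

/-- The energy norm `‖w‖_X² = ‖w‖_Y² + ‖∂ₜ w‖_{Y'}² + ‖γ_T w‖_H²` on `X`. -/
def normX (w : P.X) : ℝ :=
  Real.sqrt (P.normY (P.toY w) ^ 2 + P.normYDual (P.dt w) ^ 2 + ‖P.trace P.T w‖ ^ 2)

/-- The error `inf_{w ∈ Z} ‖u - w‖_X` of best approximation from a subspace `Z` of `X`; for closed
`Z` this is the error of the Galerkin (that is, best) approximation of `u` from `Z`. -/
def bestError (Z : Submodule ℝ P.X) (u : P.X) : ℝ := ⨅ w : Z, P.normX (u - w)

/-- The families of trial and test spaces with everything attached to them: closed subspaces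
`X^δ ⊆ X`, `Y^δ ⊆ Y` with `X^δ ⊆ Y^δ`, the enlargement map `δ ↦ enl δ` (written `δ` with a bar
below in the literature), the finite collections `Θ_δ` with `X^δ + span Θ_δ = X^{enl δ}`, the
self-adjoint isomorphisms `K_Y^δ`, `K_X^δ` and the data spaces `G^δ ⊆ Y'`, `U₀^δ ⊆ H`.
The index set `Δ` is ordered by inclusion of the spaces `X^δ`. -/
structure Discretization where
  Δ : Type w
  X : Δ → Submodule ℝ P.X
  X_closed : ∀ δ, IsClosed (X δ : Set P.X)
  Y : Δ → Submodule ℝ P.Y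
  Y_closed : ∀ δ, IsClosed (Y δ : Set P.Y)
  X_le_Y : ∀ δ, ∀ z ∈ X δ, P.toY z ∈ Y δ
  enl : Δ → Δ
  le_enl : ∀ δ, X δ ≤ X (enl δ)
  J : Δ → Type w
  J_fintype : ∀ δ, Fintype (J δ)
  θ : ∀ δ, J δ → P.X
  span_θ : ∀ δ, X δ ⊔ Submodule.span ℝ (range (θ δ)) = X (enl δ)
  KY : ∀ δ, Preconditioner (Y δ)
  KX : ∀ δ, Preconditioner (X δ)
  G : Δ → Submodule ℝ (StrongDual ℝ P.Y)
  U₀ : Δ → Submodule ℝ H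

namespace Discretization

variable {P} (D : P.Discretization)

instance (δ : D.Δ) : Fintype (D.J δ) := D.J_fintype δ

/-- The inf-sup constant
`γ_Δ = inf_δ inf_{w ∈ X^δ} sup_{v ∈ Y^δ} (∂ₜ w)(v) / (‖∂ₜ w‖_{Y'} ‖v‖_Y)`, where `w` runs over the
elements with `∂ₜ w ≠ 0`. All the quotients are at most `1`, and inserting the value `1` only
matters when there is no such `w`. -/
def infSup : ℝ :=
  sInf (insert 1 {r | ∃ δ, ∃ z ∈ D.X δ, P.dt z ≠ 0 ∧
    r = P.dualNorm (D.Y δ) (P.dt z) / P.normYDual (P.dt z)})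

/-- `((K_Y^δ)⁻¹ v)(v) / (A v)(v) ∈ [κ⁻¹, κ]` for all `δ` and `0 ≠ v ∈ Y^δ`. -/
def KYBound (κ : ℝ) : Prop :=
  ∀ δ, ∀ v : D.Y δ, κ⁻¹ * P.A v v ≤ (D.KY δ).invForm v v ∧ (D.KY δ).invForm v v ≤ κ * P.A v v

/-- `((K_X^δ)⁻¹ z)(z)` lies between `k₁ ‖z‖_X²` and `k₂ ‖z‖_X²` for all `δ` and `z ∈ X^δ`. -/
def KXBound (k₁ k₂ : ℝ) : Prop :=
  ∀ δ, ∀ z : D.X δ, k₁ * P.normX z ^ 2 ≤ (D.KX δ).invForm z z ∧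
    (D.KX δ).invForm z z ≤ k₂ * P.normX z ^ 2

/-- `m² ‖z + cᵀ Θ_δ‖_X² ≤ ‖z‖_X² + ‖c‖² ≤ M² ‖z + cᵀ Θ_δ‖_X²` for all `δ`, `z ∈ X^δ` and `c`. -/
def StableComplement (m M : ℝ) : Prop :=
  ∀ δ, ∀ z ∈ D.X δ, ∀ c : D.J δ → ℝ,
    m ^ 2 * P.normX (z + ∑ i, c i • D.θ δ i) ^ 2 ≤ P.normX z ^ 2 + ∑ i, c i ^ 2 ∧
    P.normX z ^ 2 + ∑ i, c i ^ 2 ≤ M ^ 2 * P.normX (z + ∑ i, c i • D.θ δ i) ^ 2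

/-- Saturation with constant `ζ`: if the data of the solution `u` lie in `G^δ × U₀^δ`, the error
of best approximation from `X^{enl δ}` is at most `ζ` times that from `X^δ`. -/
def Saturation (ζ : ℝ) : Prop :=
  ∀ δ, ∀ g ∈ D.G δ, ∀ u₀ ∈ D.U₀ δ, ∀ u, P.IsSolution g u₀ u →
    P.bestError (D.X (D.enl δ)) u ≤ ζ * P.bestError (D.X δ) u

/-- The form `(S w)(z)` of the discrete Schur complement `S = B' E K E' B + γ₀' γ₀`,
where `K = K_Y^δ` and `E` is the embedding of `Y^δ` into `Y`. -/
def S (δ : D.Δ) (w z : P.X) : ℝ :=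
  P.B z ((D.KY δ).toEquiv ((P.B w).comp (D.Y δ).subtypeL)) + inner ℝ (P.trace 0 w) (P.trace 0 z)

/-- The functional `f = B' E K E' g + γ₀' u₀`. -/
def load (δ : D.Δ) (g : StrongDual ℝ P.Y) (u₀ : H) (z : P.X) : ℝ :=
  P.B z ((D.KY δ).toEquiv (g.comp (D.Y δ).subtypeL)) + inner ℝ u₀ (P.trace 0 z)

/-- The residual functional `B' E K E' (g - B w) + γ₀' (u₀ - γ₀ w)`. -/
def residual (δ : D.Δ) (g : StrongDual ℝ P.Y) (u₀ : H) (w z : P.X) : ℝ :=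
  P.B z ((D.KY δ).toEquiv ((g - P.B w).comp (D.Y δ).subtypeL)) + inner ℝ (u₀ - P.trace 0 w) (P.trace 0 z)

/-- Approximations `(g^δ, u₀^δ) ∈ G^δ × U₀^δ` of the data `(g, u₀)` with an upper bound `η` for
the data oscillation. -/
structure DataApprox (g : StrongDual ℝ P.Y) (u₀ : H) where
  gd : D.Δ → StrongDual ℝ P.Y
  gd_mem : ∀ δ, gd δ ∈ D.G δ
  u₀d : D.Δ → H
  u₀d_mem : ∀ δ, u₀d δ ∈ D.U₀ δ
  η : D.Δ → ℝ
  osc_le : ∀ δ, P.normYDual (g - gd δ) + ‖u₀ - u₀d δ‖ ≤ η δ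
  η_anti : ∀ δ δ', D.X δ ≤ D.X δ' → η δ' ≤ η δ
  η_small : ∀ ε : ℝ, 0 < ε → ∃ δ, η δ ≤ ε

/-- The parameters of the adaptive algorithm: `omega`, `theta` (bulk chasing), `xi` (inexact
solves) and the tolerance `eps`. -/
structure Params where
  omega : ℝ
  theta : ℝ
  xi : ℝ
  eps : ℝ

/-- The variables of the algorithm just after an approximation `ũ^δ` has been computed: the index
`δ`, the approximation `ũ^δ`, and the algebraic error estimate `t_δ`. -/
structure Config where
  δ : D.Δ
  u : P.X
  t : ℝ

namespace DataApprox

variable {D} {g : StrongDual ℝ P.Y} {u₀ : H} (R : D.DataApprox g u₀)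

/-- `t̃_δ = √(ρ (K_X^δ ρ))` with `ρ = f^δ - S^{enl δ, δ} ũ ∈ (X^δ)'`. -/
def algError (δ : D.Δ) (ut : P.X) : ℝ :=
  Real.sqrt ((D.KX δ).quad fun z : D.X δ =>
    D.load (D.enl δ) (R.gd δ) (R.u₀d δ) z - D.S (D.enl δ) ut z)

/-- The entries of the residual vector `r̃^δ` of `ũ`. -/
def resVec (δ : D.Δ) (ut : P.X) (i : D.J δ) : ℝ :=
  D.residual (D.enl δ) (R.gd δ) (R.u₀d δ) ut (D.θ δ i)

/-- The Euclidean norm of the restriction of the residual vector to a subset of the indices. -/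
def resNorm (δ : D.Δ) (ut : P.X) (s : Finset (D.J δ)) : ℝ :=
  Real.sqrt (∑ i ∈ s, R.resVec δ ut i ^ 2)

/-- `e_δ = ‖r̃^δ‖ + η(δ) + t_δ`. -/
def estimator (c : D.Config) : ℝ :=
  R.resNorm c.δ c.u Finset.univ + R.η c.δ + c.t

/-- `c` results from computing an approximation `ũ^δ ∈ X^δ` with `t̃_δ ≤ t / 2`, and setting
`t_δ := t̃_δ`. -/
def Computed (δ : D.Δ) (t : ℝ) (c : D.Config) : Prop :=
  c.δ = δ ∧ c.u ∈ D.X δ ∧ c.t = R.algError δ c.u ∧ c.t ≤ t / 2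

variable (p : Params)

/-- The stopping test `e_δ ≤ ε` succeeds. -/
def Stops (c : D.Config) : Prop := R.estimator c ≤ p.eps

/-- The algorithm has not stopped, and the until-clause `t_δ ≤ ξ e_δ` is passed. -/
def Passes (c : D.Config) : Prop := ¬ R.Stops p c ∧ c.t ≤ p.xi * R.estimator c

/-- `δ'` is an admissible choice for the new index after passing the until-clause: if data
oscillation dominates, `X^δ' ⊇ X^δ` with `η(δ') ≤ η(δ)/2`, and otherwise `δ ⪯ δ' ⪯ enl δ` such that
`X^δ'` contains the functions `θ_i`, `i ∈ s`, for a set `s` that satisfies the bulk criterion. -/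
def Refines (c : D.Config) (δ' : D.Δ) : Prop :=
  (p.omega * R.resNorm c.δ c.u Finset.univ < R.η c.δ ∧
    D.X c.δ ≤ D.X δ' ∧ R.η δ' ≤ R.η c.δ / 2) ∨
  (R.η c.δ ≤ p.omega * R.resNorm c.δ c.u Finset.univ ∧
    D.X c.δ ≤ D.X δ' ∧ D.X δ' ≤ D.X (D.enl c.δ) ∧
    ∃ s : Finset (D.J c.δ),
      p.theta * R.resNorm c.δ c.u Finset.univ ≤ R.resNorm c.δ c.u s ∧ ∀ i ∈ s, D.θ c.δ i ∈ D.X δ')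

/-- One step of the algorithm, from one computed approximation to the next: either the inner loop
is repeated, or the until-clause is passed, `δ'` is selected, and the inner loop is entered
with `t_{δ'} := e_δ`. -/
def Step (c c' : D.Config) : Prop :=
  ¬ R.Stops p c ∧
    ((¬ R.Passes p c ∧ R.Computed c.δ c.t c') ∨
      (R.Passes p c ∧ ∃ δ', R.Refines p c δ' ∧ R.Computed δ' (R.estimator c) c'))

/-- `c 0, …, c N` is an initial part of an execution of the algorithm that starts with the index
`δ₀` and the value `t₀`. -/
def IsRun (δ₀ : D.Δ) (t₀ : ℝ) (c : ℕ → D.Config) (N : ℕ) : Prop :=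
  R.Computed δ₀ t₀ (c 0) ∧ ∀ n < N, R.Step p (c n) (c (n + 1))

end DataApprox

end Discretization

end ParabolicProblem

end

end SpaceTime

namespace SpaceTime

/-! The space-time problem is a symmetric coercive one in disguise. In the energy norms `‖B w‖² =
‖w‖² + ‖∂ₜ w‖² + 2 (∂ₜ w)(w)`, and integration by parts turns the cross term into `‖γ_T w‖² - ‖γ₀
w‖²`. So `w ↦ (B w, γ₀ w)` is an isometry from `X` into `Y' × H` (`norm_operatorMap`). It is onto,
because an element orthogonal to its range solves a homogeneous backward problem with final value
zero (`eq_zero_of_forall_B_add`). The analytic groundwork, namely traces and integration by parts,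
comes from smoothing in space with symmetric approximate inverses of `ι* ι`
(`exists_regularization`, `inner_trace_sub_inner_trace`).

In this Hilbert space model (`exists_hilbert_model`) the computable form `S^δ` equals the inner
product up to a relative error `σ = 4 √q`, where `q = κ/γ - 1` (`norm_discrete_riesz_sub_le`). The
deviation of a Galerkin solution from the best approximation is orthogonal to the best approximation
error. It therefore enters squared, and the quasi-optimality constant is `1 + 2σ² = 1 + 32 q`
(`norm_sub_galerkin_le`). This gain of one order is what makes a bound on `q / ω`, rather than on
`√q / ω`, sufficient.

Let `uh` be the exact solution for the data `(g^δ, u₀^δ)`; it differs from `u` by at most `η(δ)`.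
The computed residuals are values of `S (uh - ũ, ·)`. Saturation and the stability of the splitting
make `‖r̃‖ + t` an upper bound for the error `‖uh - ũ‖` (`norm_sub_le_estimator`), and `‖r̃‖` a
lower bound (`resNorm_le`), up to constants.

Two cases arise after a passing of the until-clause. If oscillation dominates, `η` is halved and the
error is at most a multiple of `η / ω`; the relative excess `ξ + q ≲ ω` of quasi-optimality then
costs only a small multiple of `η`, and a small weight `ϑ` on the error makes the remaining increase
harmless (`reduction_of_oscillation`). Otherwise bulk chasing moves the best approximation by at
least a multiple of `ϑ` times the error. Pythagoras then yields a relative reduction of order `ϑ²`,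
and oscillation is negligible because `ω ≲ ϑ²` (`reduction_of_bulk`).

Between passings `t` is halved while staying above `ξ ε`, so inner loops are finite. Geometric decay
at the passings pushes the estimator below `ε`. -/

theorem absolutelyContinuousOnInterval_of_dist_le {F : Type*} [PseudoMetricSpace F] {Φ : ℝ → F} {Ψ : ℝ → ℝ}
    {a b : ℝ} (C : ℝ) (hΨ : AbsolutelyContinuousOnInterval Ψ a b)
    (h : ∀ x ∈ uIcc a b, ∀ y ∈ uIcc a b, dist (Φ x) (Φ y) ≤ C * dist (Ψ x) (Ψ y)) :
    AbsolutelyContinuousOnInterval Φ a b := by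
  rw [absolutelyContinuousOnInterval_iff] at hΨ ⊢
  intro ε hε
  obtain ⟨δ, hδ, H⟩ := hΨ (ε / (|C| + 1)) (by positivity)
  refine ⟨δ, hδ, fun E hE hsum => ?_⟩
  have h1 := H E hE hsum
  have h2 : ∑ i ∈ Finset.range E.1, dist (Φ (E.2 i).1) (Φ (E.2 i).2)
      ≤ (|C| + 1) * ∑ i ∈ Finset.range E.1, dist (Ψ (E.2 i).1) (Ψ (E.2 i).2) := by
    rw [Finset.mul_sum]
    refine Finset.sum_le_sum fun i hi => ?_
    have hm := hE.1 i hi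
    refine (h _ hm.1 _ hm.2).trans ?_
    exact mul_le_mul_of_nonneg_right ((le_abs_self C).trans (by linarith)) dist_nonneg
  calc _ ≤ _ := h2
    _ < (|C| + 1) * (ε / (|C| + 1)) := by gcongr
    _ = ε := by field_simp

/-! ### Primitives of Hilbert space valued functions -/

section Primitive

variable {E : Type*} [NormedAddCommGroup E] [InnerProductSpace ℝ E] [CompleteSpace E]

omit [CompleteSpace E] in
theorem norm_primitive_sub_le {f : ℝ → E} {a b : ℝ} (hf : IntervalIntegrable f volume a b) (ξ : E)
    {x y : ℝ} (hx : x ∈ uIcc a b) (hy : y ∈ uIcc a b) :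
    ‖(ξ + ∫ s in a..x, f s) - (ξ + ∫ s in a..y, f s)‖ ≤ |∫ s in y..x, ‖f s‖| := by
  have hax : IntervalIntegrable f volume a x := hf.mono_set (uIcc_subset_uIcc_left hx)
  have hay : IntervalIntegrable f volume a y := hf.mono_set (uIcc_subset_uIcc_left hy)
  rw [add_sub_add_left_eq_sub, intervalIntegral.integral_interval_sub_left hax hay]
  exact intervalIntegral.norm_integral_le_abs_integral_norm

/-- The fundamental theorem of calculus for the inner product of two primitives. -/
theorem integral_inner_primitive {f g : ℝ → E} {a b : ℝ}
    (hf : IntervalIntegrable f volume a b) (hg : IntervalIntegrable g volume a b) (ξ χ : E) :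
    ∫ t in a..b, (inner ℝ (f t) (χ + ∫ s in a..t, g s) + inner ℝ (ξ + ∫ s in a..t, f s) (g t))
      = inner ℝ (ξ + ∫ s in a..b, f s) (χ + ∫ s in a..b, g s) - inner ℝ ξ χ := by
  set F : ℝ → E := fun t => ξ + ∫ s in a..t, f s with hF
  set G : ℝ → E := fun t => χ + ∫ s in a..t, g s with hG
  have hFb : ∀ x ∈ uIcc a b, ‖F x‖ ≤ ‖ξ‖ + |∫ s in a..b, ‖f s‖| := by
    intro x hx
    refine (norm_add_le _ _).trans (add_le_add le_rfl ?_)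
    refine intervalIntegral.norm_integral_le_abs_integral_norm.trans ?_
    refine intervalIntegral.abs_integral_mono_interval (uIoc_subset_uIoc_of_uIcc_subset_uIcc (uIcc_subset_uIcc_left hx))
      (Filter.Eventually.of_forall fun _ => norm_nonneg _) hf.norm
  have hGb : ∀ x ∈ uIcc a b, ‖G x‖ ≤ ‖χ‖ + |∫ s in a..b, ‖g s‖| := by
    intro x hx
    refine (norm_add_le _ _).trans (add_le_add le_rfl ?_)
    refine intervalIntegral.norm_integral_le_abs_integral_norm.trans ?_
    refine intervalIntegral.abs_integral_mono_interval (uIoc_subset_uIoc_of_uIcc_subset_uIcc (uIcc_subset_uIcc_left hx))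
      (Filter.Eventually.of_forall fun _ => norm_nonneg _) hg.norm
  set CF := ‖ξ‖ + |∫ s in a..b, ‖f s‖|
  set CG := ‖χ‖ + |∫ s in a..b, ‖g s‖|
  have hCF : 0 ≤ CF := by positivity
  have hCG : 0 ≤ CG := by positivity
  have hint : IntervalIntegrable (fun s => ‖f s‖ + ‖g s‖) volume a b := hf.norm.add hg.norm
  -- Both primitives are bounded, so their inner product varies at most `CF + CG` times as much as
  -- the scalar primitive of `‖f‖ + ‖g‖`. This gives absolute continuity of a real function. Its
  -- derivative is identified almost everywhere by Lebesgue differentiation of the two primitives.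
  have hac : AbsolutelyContinuousOnInterval (fun t => inner ℝ (F t) (G t)) a b := by
    refine absolutelyContinuousOnInterval_of_dist_le (CF + CG)
      (hint.absolutelyContinuousOnInterval_intervalIntegral (c := a) left_mem_uIcc) ?_
    intro x hx y hy
    have hax := hint.mono_set (uIcc_subset_uIcc_left hx)
    have hay := hint.mono_set (uIcc_subset_uIcc_left hy)
    have hyx : IntervalIntegrable (fun s => ‖f s‖ + ‖g s‖) volume y x :=
      hay.symm.trans hax
    have hfyx : IntervalIntegrable f volume y x :=
      (hf.mono_set (uIcc_subset_uIcc_left hy)).symm.trans (hf.mono_set (uIcc_subset_uIcc_left hx))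
    have hgyx : IntervalIntegrable g volume y x :=
      (hg.mono_set (uIcc_subset_uIcc_left hy)).symm.trans (hg.mono_set (uIcc_subset_uIcc_left hx))
    rw [Real.dist_eq, Real.dist_eq, intervalIntegral.integral_interval_sub_left hax hay]
    have e : inner ℝ (F x) (G x) - inner ℝ (F y) (G y)
        = inner ℝ (F x - F y) (G x) + inner ℝ (F y) (G x - G y) := by
      rw [inner_sub_left, inner_sub_right]; ring
    rw [e]
    have h1 : ‖F x - F y‖ ≤ |∫ s in y..x, (‖f s‖ + ‖g s‖)| := by
      refine (norm_primitive_sub_le hf ξ hx hy).trans ?_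
      rw [intervalIntegral.abs_integral_eq_abs_integral_uIoc,
        intervalIntegral.abs_integral_eq_abs_integral_uIoc (fun s => ‖f s‖ + ‖g s‖)]
      refine abs_le_abs_of_nonneg (integral_nonneg fun _ => norm_nonneg _) ?_
      refine setIntegral_mono (intervalIntegrable_iff.1 hfyx).norm (intervalIntegrable_iff.1 hyx) ?_
      intro s
      exact le_add_of_nonneg_right (norm_nonneg _)
    have h2 : ‖G x - G y‖ ≤ |∫ s in y..x, (‖f s‖ + ‖g s‖)| := by
      refine (norm_primitive_sub_le hg χ hx hy).trans ?_
      rw [intervalIntegral.abs_integral_eq_abs_integral_uIoc,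
        intervalIntegral.abs_integral_eq_abs_integral_uIoc (fun s => ‖f s‖ + ‖g s‖)]
      refine abs_le_abs_of_nonneg (integral_nonneg fun _ => norm_nonneg _) ?_
      refine setIntegral_mono (intervalIntegrable_iff.1 hgyx).norm (intervalIntegrable_iff.1 hyx) ?_
      intro s
      exact le_add_of_nonneg_left (norm_nonneg _)
    calc |inner ℝ (F x - F y) (G x) + inner ℝ (F y) (G x - G y)|
        ≤ ‖F x - F y‖ * ‖G x‖ + ‖F y‖ * ‖G x - G y‖ :=
          (abs_add_le _ _).trans (add_le_add (abs_real_inner_le_norm _ _) (abs_real_inner_le_norm _ _))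
      _ ≤ |∫ s in y..x, (‖f s‖ + ‖g s‖)| * CG + CF * |∫ s in y..x, (‖f s‖ + ‖g s‖)| := by
          gcongr
          · exact hGb x hx
          · exact hFb y hy
      _ = _ := by ring
  have hend : inner ℝ (F a) (G a) = inner ℝ ξ χ := by simp [hF, hG]
  change _ = inner ℝ (F b) (G b) - _
  rw [← hend, ← hac.integral_deriv_eq_sub]
  refine intervalIntegral.integral_congr_ae ?_
  filter_upwards [hf.ae_hasDerivAt_integral, hg.ae_hasDerivAt_integral] with t h1 h2 ht
  have ht' := uIoc_subset_uIcc ht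
  have d1 : HasDerivAt F (f t) t := (h1 ht' a left_mem_uIcc).const_add ξ
  have d2 : HasDerivAt G (g t) t := (h2 ht' a left_mem_uIcc).const_add χ
  rw [(d1.inner ℝ d2).deriv]
  ring

omit [CompleteSpace E] in
theorem continuousOn_primitive_const_add {f : ℝ → E} {a b : ℝ}
    (hf : IntervalIntegrable f volume a b) (ξ : E) :
    ContinuousOn (fun t => ξ + ∫ s in a..t, f s) (uIcc a b) :=
  continuousOn_const.add
    (intervalIntegral.continuousOn_primitive_interval' hf left_mem_uIcc)

end Primitive

/-! ### Weak derivatives on an interval -/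

section WeakDerivative

variable {E : Type*} [NormedAddCommGroup E] [InnerProductSpace ℝ E] [CompleteSpace E]

/-- A smooth function with compact support in `(0, T)` and vanishing integral has a smooth
primitive with compact support in `(0, T)`. -/
theorem exists_smooth_primitive {T : ℝ} {χ : ℝ → ℝ} (hχ : ContDiff ℝ (⊤ : ℕ∞) χ)
    (hc : HasCompactSupport χ) (hs : tsupport χ ⊆ Ioo 0 T) (h0 : ∫ t in (0 : ℝ)..T, χ t = 0) :
    ∃ φ : ℝ → ℝ, ContDiff ℝ (⊤ : ℕ∞) φ ∧ HasCompactSupport φ ∧ tsupport φ ⊆ Ioo 0 T ∧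
      deriv φ = χ := by
  have hd : ∀ t, HasDerivAt (fun t => ∫ s in (0 : ℝ)..t, χ s) (χ t) t := fun t =>
    intervalIntegral.integral_hasDerivAt_right (hχ.continuous.intervalIntegrable _ _)
      (hχ.continuous.stronglyMeasurableAtFilter _ _) hχ.continuous.continuousAt
  have hderiv : deriv (fun t => ∫ s in (0 : ℝ)..t, χ s) = χ := funext fun t => (hd t).deriv
  rcases (tsupport χ).eq_empty_or_nonempty with he | hne
  · have : χ = 0 := tsupport_eq_empty_iff.1 he
    refine ⟨0, contDiff_const, HasCompactSupport.zero, by simp, ?_⟩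
    rw [this]; simp
  have hK : IsCompact (tsupport χ) := hc
  obtain ⟨a, haK, ha⟩ := hK.exists_isLeast hne
  obtain ⟨b, hbK, hb⟩ := hK.exists_isGreatest hne
  have hzero : ∀ t, t ∉ Icc a b → χ t = 0 := fun t ht =>
    image_eq_zero_of_notMem_tsupport fun h => ht ⟨ha h, hb h⟩
  -- To the left of the support the integrand vanishes on the whole path. To the right, the part up
  -- to `T` is the full integral, which is zero by assumption.
  have hsupp : ∀ t, t ∉ Icc a b → ∫ s in (0 : ℝ)..t, χ s = 0 := by
    intro t ht
    rw [mem_Icc, not_and_or, not_le, not_le] at ht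
    rcases ht with ht | ht
    · refine intervalIntegral.integral_zero_ae (Filter.Eventually.of_forall fun s hs' => ?_)
      refine hzero s fun h => ?_
      have h1 := (hs haK).1
      rw [mem_uIoc] at hs'
      rcases hs' with h' | h'
      · linarith [h.1, h'.2]
      · linarith [h.1, h'.2]
    · have hi := fun x y => hχ.continuous.intervalIntegrable (μ := volume) x y
      have e := intervalIntegral.integral_add_adjacent_intervals (hi 0 T) (hi T t)
      rw [← e, h0, zero_add]
      refine intervalIntegral.integral_zero_ae (Filter.Eventually.of_forall fun s hs' => ?_)
      refine hzero s fun h => ?_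
      have h1 := (hs hbK).2
      rw [mem_uIoc] at hs'
      rcases hs' with h' | h'
      · linarith [h.2, h'.1]
      · linarith [h.2, h'.1]
  have hts : tsupport (fun t => ∫ s in (0 : ℝ)..t, χ s) ⊆ Icc a b := by
    refine closure_minimal (fun t ht => ?_) isClosed_Icc
    by_contra h
    exact ht (hsupp t h)
  refine ⟨_, ?_, ?_, ?_, hderiv⟩
  · exact contDiff_infty_iff_deriv.2 ⟨fun t => (hd t).differentiableAt, by rw [hderiv]; exact hχ⟩
  · exact HasCompactSupport.of_support_subset_isCompact isCompact_Icc
      ((subset_tsupport _).trans hts)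
  · exact hts.trans fun t ht => ⟨(hs haK).1.trans_le ht.1, ht.2.trans_lt (hs hbK).2⟩

theorem exists_smooth_integral_one {T : ℝ} (hT : 0 < T) :
    ∃ φ : ℝ → ℝ, ContDiff ℝ (⊤ : ℕ∞) φ ∧ HasCompactSupport φ ∧ tsupport φ ⊆ Ioo 0 T ∧
      ∫ t in (0 : ℝ)..T, φ t = 1 := by
  let f : ContDiffBump (T / 2) := ⟨T / 8, T / 4, by positivity, by linarith⟩
  have hts : tsupport (f.normed volume) ⊆ Ioo 0 T := by
    rw [f.tsupport_normed_eq, Real.closedBall_eq_Icc]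
    intro t ht
    have h1 : T / 2 - T / 4 ≤ t := ht.1
    have h2 : t ≤ T / 2 + T / 4 := ht.2
    constructor <;> linarith
  refine ⟨f.normed volume, f.contDiff_normed, f.hasCompactSupport_normed, hts, ?_⟩
  rw [intervalIntegral.integral_of_le hT.le, ← f.integral_normed (μ := volume),
    setIntegral_eq_integral_of_forall_compl_eq_zero]
  intro t ht
  exact image_eq_zero_of_notMem_tsupport fun h => ht ⟨(hts h).1, (hts h).2.le⟩

/-- A function with an integrable weak derivative is, up to a constant, the primitive of it. -/
theorem exists_ae_eq_const_add_primitive {T : ℝ} (hT : 0 < T) {f r : ℝ → E}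
    (hf : Integrable f (timeMeasure T)) (hr : Integrable r (timeMeasure T))
    (h : ∀ φ : ℝ → ℝ, ContDiff ℝ (⊤ : ℕ∞) φ → HasCompactSupport φ → tsupport φ ⊆ Ioo 0 T →
      ∫ t, deriv φ t • f t ∂(timeMeasure T) = -∫ t, φ t • r t ∂(timeMeasure T)) :
    ∃ ξ : E, ∀ᵐ t ∂(timeMeasure T), f t = ξ + ∫ s in (0 : ℝ)..t, r s := by
  have hint : ∀ g : ℝ → E, ∫ t in (0 : ℝ)..T, g t = ∫ t, g t ∂(timeMeasure T) := fun g => by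
    rw [intervalIntegral.integral_of_le hT.le, integral_Ioc_eq_integral_Ioo]
  have hr' : IntervalIntegrable r volume 0 T := by
    rw [intervalIntegrable_iff_integrableOn_Ioo_of_le hT.le]; exact hr
  set R : ℝ → E := fun t => ∫ s in (0 : ℝ)..t, r s with hR
  have hRc : ContinuousOn R (Icc 0 T) := by
    have := continuousOn_primitive_const_add hr' (0 : E)
    rw [uIcc_of_le hT.le] at this
    simpa using this
  have hRi : Integrable R (timeMeasure T) :=
    (hRc.integrableOn_compact isCompact_Icc).mono_set Ioo_subset_Icc_self
  have hbdd : ∀ {ψ : ℝ → ℝ}, Continuous ψ → HasCompactSupport ψ → ∀ {g : ℝ → E},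
      Integrable g (timeMeasure T) → Integrable (fun t => ψ t • g t) (timeMeasure T) := by
    intro ψ hψ hc g hg
    obtain ⟨C, hC⟩ := hc.exists_bound_of_continuous hψ
    exact hg.bdd_smul C hψ.aestronglyMeasurable (Filter.Eventually.of_forall hC)
  -- Paired with a fixed vector `v`, this is the product rule for the primitives of `φ' v` and `r`;
  -- the boundary terms vanish with `φ`.
  have hRweak : ∀ φ : ℝ → ℝ, ContDiff ℝ (⊤ : ℕ∞) φ → HasCompactSupport φ → tsupport φ ⊆ Ioo 0 T →
      ∫ t, deriv φ t • R t ∂(timeMeasure T) = -∫ t, φ t • r t ∂(timeMeasure T) := by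
    intro φ hφ hc hs
    have hφ0 : φ 0 = 0 := image_eq_zero_of_notMem_tsupport fun h => lt_irrefl _ (hs h).1
    have hφT : φ T = 0 := image_eq_zero_of_notMem_tsupport fun h => lt_irrefl _ (hs h).2
    have hφ' : Continuous (deriv φ) := hφ.continuous_deriv (by simp)
    rw [← add_eq_zero_iff_eq_neg, ← integral_add (hbdd hφ' hc.deriv hRi) (hbdd hφ.continuous hc hr)]
    refine ext_inner_left ℝ fun v => ?_
    rw [inner_zero_right, ← integral_inner]
    · have key := integral_inner_primitive (f := fun t => deriv φ t • v) (g := r)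
        ((hφ'.smul continuous_const).intervalIntegrable _ _) hr' 0 0
      have hprim : ∀ t, (0 : E) + ∫ s in (0 : ℝ)..t, deriv φ s • v = φ t • v := by
        intro t
        rw [zero_add, intervalIntegral.integral_smul_const, intervalIntegral.integral_deriv_eq_sub
          (fun x _ => (hφ.differentiable (by simp)).differentiableAt)
          (hφ'.intervalIntegrable _ _), hφ0, sub_zero]
      simp only [hprim, hφT, zero_smul, inner_zero_left, zero_add, sub_zero] at key
      rw [intervalIntegral.integral_of_le hT.le, integral_Ioc_eq_integral_Ioo] at key
      rw [← key]
      refine integral_congr_ae (Filter.Eventually.of_forall fun t => ?_)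
      simp only [inner_add_right, real_inner_smul_left, real_inner_smul_right, hR]
    · exact (hbdd hφ' hc.deriv hRi).add (hbdd hφ.continuous hc hr)
  obtain ⟨φ₀, hφ₀, hc₀, hs₀, hi₀⟩ := exists_smooth_integral_one hT
  set D : ℝ → E := fun t => f t - R t with hD
  have hDi : Integrable D (timeMeasure T) := hf.sub hRi
  set ξ : E := ∫ t, φ₀ t • D t ∂(timeMeasure T) with hξ
  refine ⟨ξ, ?_⟩
  -- The du Bois-Reymond argument: `D` has weak derivative zero, and `ψ - (∫ ψ) φ₀` has integral
  -- zero, hence is the derivative of a test function. Therefore `∫ ψ D = (∫ ψ) ∫ φ₀ D` for every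
  -- test function `ψ`, which identifies `D` with the constant `ξ`.
  have hmain : ∀ᵐ t ∂volume, t ∈ Ioo 0 T → D t - ξ = 0 := by
    refine isOpen_Ioo.ae_eq_zero_of_integral_contDiff_smul_eq_zero ?_ ?_
    · have h1 : IntegrableOn (fun t => D t - ξ) (Ioo 0 T) volume := hDi.sub (integrable_const ξ)
      exact h1.locallyIntegrableOn
    · intro ψ hψ hc hs
      set κ : ℝ := ∫ t in (0 : ℝ)..T, ψ t with hκ
      have hχs : tsupport (fun t => ψ t - κ * φ₀ t) ⊆ Ioo 0 T := by
        have hsub : tsupport (fun t => ψ t - κ * φ₀ t) ⊆ tsupport ψ ∪ tsupport φ₀ := by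
          refine closure_minimal (fun t ht => ?_)
            ((isClosed_tsupport _).union (isClosed_tsupport _))
          by_contra h
          rw [mem_union, not_or] at h
          exact ht (by
            simp [image_eq_zero_of_notMem_tsupport h.1, image_eq_zero_of_notMem_tsupport h.2])
        exact hsub.trans (union_subset hs hs₀)
      have hχc : HasCompactSupport (fun t => ψ t - κ * φ₀ t) :=
        HasCompactSupport.of_support_subset_isCompact (isCompact_Icc (a := (0 : ℝ)) (b := T))
          ((subset_tsupport _).trans (hχs.trans Ioo_subset_Icc_self))
      obtain ⟨φ, hφ, hφc, hφs, hφd⟩ := exists_smooth_primitive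
        (χ := fun t => ψ t - κ * φ₀ t) (hψ.sub (contDiff_const.mul hφ₀)) hχc hχs (by
          rw [intervalIntegral.integral_sub (hψ.continuous.intervalIntegrable _ _)
            ((hφ₀.continuous.intervalIntegrable _ _).const_mul κ),
            intervalIntegral.integral_const_mul, hi₀, mul_one, ← hκ, sub_self])
      have hφ' : Continuous (deriv φ) := hφ.continuous_deriv (by simp)
      have e1 : ∫ t, deriv φ t • D t ∂(timeMeasure T) = 0 := by
        simp only [hD, smul_sub]
        rw [integral_sub (hbdd hφ' hφc.deriv hf) (hbdd hφ' hφc.deriv hRi), h φ hφ hφc hφs,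
          hRweak φ hφ hφc hφs, sub_self]
      have e2 : ∫ t, ψ t • D t ∂(timeMeasure T) = κ • ξ := by
        have i1 := hbdd hψ.continuous hc hDi
        have i2 := hbdd hφ₀.continuous hc₀ hDi
        rw [hφd] at e1
        simp only [sub_smul, mul_smul] at e1
        rw [integral_sub i1 (i2.fun_smul κ), integral_smul, sub_eq_zero] at e1
        exact e1
      have e3 : ∫ t, ψ t • (D t - ξ) ∂volume = ∫ t, ψ t • (D t - ξ) ∂(timeMeasure T) := by
        rw [setIntegral_eq_integral_of_forall_compl_eq_zero]
        intro t ht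
        rw [image_eq_zero_of_notMem_tsupport fun h => ht (hs h), zero_smul]
      rw [e3]
      simp only [smul_sub]
      rw [integral_sub (hbdd hψ.continuous hc hDi) (hbdd hψ.continuous hc (integrable_const ξ)), e2,
        integral_smul_const, sub_eq_zero, hκ, intervalIntegral.integral_of_le hT.le,
        integral_Ioc_eq_integral_Ioo]
  rw [ae_restrict_iff' measurableSet_Ioo]
  filter_upwards [hmain] with t ht htI
  have := ht htI
  rw [sub_eq_zero, hD, sub_eq_iff_eq_add] at this
  exact this

end WeakDerivative

end SpaceTime

namespace SpaceTime

/-! ### Smoothing in space by the resolvent of the Gram operator -/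

section Regularization

variable {V : Type u} {H : Type v} [NormedAddCommGroup V] [InnerProductSpace ℝ V] [CompleteSpace V]
  [NormedAddCommGroup H] [InnerProductSpace ℝ H] [CompleteSpace H]

/-- The operator `ι* ι` on `V`. -/
noncomputable def gram (ι : V →L[ℝ] H) : V →L[ℝ] V := (ContinuousLinearMap.adjoint ι).comp ι

theorem inner_gram (ι : V →L[ℝ] H) (x y : V) : inner ℝ (gram ι x) y = inner ℝ (ι x) (ι y) := by
  simp [gram, ContinuousLinearMap.adjoint_inner_left]

theorem inner_gram_right (ι : V →L[ℝ] H) (x y : V) :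
    inner ℝ x (gram ι y) = inner ℝ (ι x) (ι y) := by
  rw [real_inner_comm, inner_gram, real_inner_comm]

/-- A vector `y` orthogonal to the range is orthogonal to `gram ι y` in particular, so `‖ι y‖² = 0`.
-/
theorem dense_range_gram {ι : V →L[ℝ] H} (hι : Function.Injective ι) : DenseRange (gram ι) := by
  have h : ((gram ι).range)ᗮ = ⊥ := by
    rw [Submodule.eq_bot_iff]
    intro y hy
    have := (Submodule.mem_orthogonal _ _).1 hy (gram ι y) ⟨y, rfl⟩
    rw [inner_gram, inner_self_eq_zero] at this
    exact (map_eq_zero_iff ι hι).1 this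
  have h2 := Submodule.topologicalClosure_eq_top_iff.2 h
  have h3 := Submodule.dense_iff_topologicalClosure_eq_top.2 h2
  exact h3

/-- For `ε > 0`, a symmetric inverse of `ι* ι + ε`. -/
theorem exists_resolvent (ι : V →L[ℝ] H) {ε : ℝ} (hε : 0 < ε) :
    ∃ R : V →L[ℝ] V, (∀ x, gram ι (R x) + ε • R x = x) ∧
      (∀ x y, inner ℝ (R x) y = inner ℝ x (R y)) ∧ ∀ x, ε * ‖R x‖ ≤ ‖x‖ := by
  -- The Gram operator is positive semidefinite, so the shifted form is coercive with constant `ε`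
  -- and Lax–Milgram provides the inverse.
  let b : V →L[ℝ] V →L[ℝ] ℝ := (innerSL ℝ).comp (gram ι + ε • ContinuousLinearMap.id ℝ V)
  have hb : ∀ x y, b x y = inner ℝ (gram ι x + ε • x) y := fun x y => rfl
  have hco : IsCoercive b := by
    refine ⟨ε, hε, fun x => ?_⟩
    rw [hb, inner_add_left, inner_gram, real_inner_smul_left, real_inner_self_eq_norm_mul_norm x]
    have := real_inner_self_nonneg (x := ι x)
    linarith
  let e := hco.continuousLinearEquivOfBilin
  have he : ∀ x, e x = gram ι x + ε • x := fun x =>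
    (hco.unique_continuousLinearEquivOfBilin fun y => rfl).symm
  have hinv : ∀ x, gram ι (e.symm x) + ε • e.symm x = x := fun x => by
    rw [← he, e.apply_symm_apply]
  refine ⟨(e.symm : V →L[ℝ] V), hinv, fun x y => ?_, fun x => ?_⟩
  · change inner ℝ (e.symm x) y = inner ℝ x (e.symm y)
    conv_lhs => rw [← hinv y]
    conv_rhs => rw [← hinv x]
    rw [inner_add_right, inner_add_left, inner_gram, inner_gram_right, real_inner_smul_left,
      real_inner_smul_right]
  · change ε * ‖e.symm x‖ ≤ ‖x‖
    rcases eq_or_ne (‖e.symm x‖) 0 with h0 | h0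
    · rw [h0, mul_zero]; exact norm_nonneg _
    have hpos : 0 < ‖e.symm x‖ := lt_of_le_of_ne (norm_nonneg _) (Ne.symm h0)
    have h1 : ε * ‖e.symm x‖ ^ 2 ≤ inner ℝ x (e.symm x) := by
      have h2 : inner ℝ (gram ι (e.symm x) + ε • e.symm x) (e.symm x) = inner ℝ x (e.symm x) := by
        rw [hinv x]
      rw [inner_add_left, inner_gram, real_inner_smul_left, real_inner_self_eq_norm_sq (e.symm x)] at h2
      have := real_inner_self_nonneg (x := ι (e.symm x))
      linarith
    have h3 := h1.trans (real_inner_le_norm x (e.symm x))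
    refine le_of_mul_le_mul_right ?_ hpos
    linarith [sq (‖e.symm x‖)]

/-- Symmetric operators `R n` that approximate the inverse of `ι* ι`. -/
theorem exists_regularization {ι : V →L[ℝ] H} (hι : Function.Injective ι) :
    ∃ R : ℕ → V →L[ℝ] V, (∀ n x y, inner ℝ (R n x) y = inner ℝ x (R n y)) ∧
      (∀ n z, ‖R n (gram ι z)‖ ≤ 2 * ‖z‖) ∧
      ∀ z, Filter.Tendsto (fun n => R n (gram ι z)) Filter.atTop (nhds z) := by
  have hε : ∀ n : ℕ, (0 : ℝ) < 1 / ((n : ℝ) + 1) := fun n => Nat.one_div_pos_of_nat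
  choose R h1 h2 h3 using fun n => exists_resolvent ι (hε n)
  -- The resolvent identity gives this with the factors in the other order. Symmetry of both
  -- operators transposes it.
  have hcomm : ∀ n z, R n (gram ι z) = z - (1 / ((n : ℝ) + 1)) • R n z := by
    intro n z
    refine ext_inner_left ℝ fun y => ?_
    rw [← h2, inner_gram_right, ← inner_gram, eq_sub_of_add_eq (h1 n y), inner_sub_left,
      inner_sub_right, real_inner_smul_left, real_inner_smul_right, h2]
  have hbd : ∀ (n : ℕ) z, ‖(1 / ((n : ℝ) + 1)) • R n z‖ ≤ ‖z‖ := by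
    intro n z
    rw [norm_smul, Real.norm_of_nonneg (hε n).le]
    exact h3 n z
  have hbd2 : ∀ n z, ‖R n (gram ι z)‖ ≤ 2 * ‖z‖ := by
    intro n z
    rw [hcomm, two_mul]
    exact (norm_sub_le _ _).trans (add_le_add le_rfl (hbd n z))
  refine ⟨R, h2, hbd2, fun z => ?_⟩
  rw [Metric.tendsto_atTop]
  intro δ hδ
  -- It remains to show that the scaled resolvent `ε R` tends to zero strongly. It is a contraction,
  -- and on the dense range of the Gram operator it is of size `2 ε ‖y‖`, so `z` is split into an
  -- element of that range and a remainder below `δ / 2`.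
  obtain ⟨y, hy⟩ := Metric.denseRange_iff.1 (dense_range_gram hι) z (δ / 2) (by positivity)
  rw [dist_eq_norm] at hy
  obtain ⟨N, hN⟩ := exists_nat_gt (4 * ‖y‖ / δ)
  refine ⟨N, fun n hn => ?_⟩
  have hn' : (N : ℝ) ≤ n := by exact_mod_cast hn
  rw [dist_eq_norm, hcomm, sub_sub_cancel_left, norm_neg]
  have e : (1 / ((n : ℝ) + 1)) • R n z
      = (1 / ((n : ℝ) + 1)) • R n (z - gram ι y) + (1 / ((n : ℝ) + 1)) • R n (gram ι y) := by
    rw [map_sub, smul_sub, sub_add_cancel]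
  rw [e]
  have i1 := hbd n (z - gram ι y)
  have i2 : ‖(1 / ((n : ℝ) + 1)) • R n (gram ι y)‖ ≤ δ / 2 := by
    rw [norm_smul, Real.norm_of_nonneg (hε n).le]
    have := hbd2 n y
    have hN' : 4 * ‖y‖ < δ * ((n : ℝ) + 1) := by
      have := (div_lt_iff₀ hδ).1 hN
      nlinarith
    rw [div_mul_eq_mul_div, one_mul, div_le_iff₀ (by positivity)]
    linarith
  exact (norm_add_le _ _).trans_lt (by linarith)

end Regularization

namespace ParabolicProblem

variable {V : Type u} {H : Type v} [NormedAddCommGroup V] [InnerProductSpace ℝ V] [CompleteSpace V]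
  [NormedAddCommGroup H] [InnerProductSpace ℝ H] [CompleteSpace H] (P : ParabolicProblem V H)

/-- The Riesz representative in `V` of `∂ₜ w (t)`. -/
noncomputable def rieszDeriv (w : P.X) (t : ℝ) : V := (InnerProductSpace.toDual ℝ V).symm (w.1.snd t)

omit [CompleteSpace H] in
theorem inner_rieszDeriv (w : P.X) (t : ℝ) (v : V) : inner ℝ (P.rieszDeriv w t) v = w.1.snd t v :=
  InnerProductSpace.toDual_symm_apply

omit [CompleteSpace H] in
theorem norm_rieszDeriv (w : P.X) (t : ℝ) : ‖P.rieszDeriv w t‖ = ‖w.1.snd t‖ :=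
  (InnerProductSpace.toDual ℝ V).symm.norm_map _

omit [CompleteSpace H] in
theorem memLp_rieszDeriv (w : P.X) : MemLp (P.rieszDeriv w) 2 (timeMeasure P.T) :=
  (Lp.memLp w.1.snd).of_le
    ((InnerProductSpace.toDual ℝ V).symm.continuous.comp_aestronglyMeasurable
      (Lp.aestronglyMeasurable _))
    (Filter.Eventually.of_forall fun t => (P.norm_rieszDeriv w t).le)

omit [CompleteSpace H] in
theorem intervalIntegrable_rieszDeriv (w : P.X) :
    IntervalIntegrable (P.rieszDeriv w) volume 0 P.T := by
  rw [intervalIntegrable_iff_integrableOn_Ioo_of_le P.T_pos.le]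
  exact (P.memLp_rieszDeriv w).integrable one_le_two

/-- The derivative of `w` takes values in `V'` and `w` in `V`. Composing `w` with the Gram operator
brings both into the single Hilbert space `V`: the defining identity of `X` says that the weak
derivative of `gram w` is the Riesz representative of `∂ₜ w`. -/
theorem exists_gram_eq_primitive (w : P.X) :
    ∃ ξ : V, ∀ᵐ t ∂(timeMeasure P.T),
      gram P.ι (P.toY w t) = ξ + ∫ s in (0 : ℝ)..t, P.rieszDeriv w s := by
  have hi : Integrable (fun t => gram P.ι (P.toY w t)) (timeMeasure P.T) :=
    (gram P.ι).integrable_comp ((Lp.memLp (P.toY w)).integrable one_le_two)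
  have hr := (P.memLp_rieszDeriv w).integrable one_le_two
  have hbdd : ∀ {ψ : ℝ → ℝ}, Continuous ψ → HasCompactSupport ψ → ∀ {g : ℝ → V},
      Integrable g (timeMeasure P.T) → Integrable (fun t => ψ t • g t) (timeMeasure P.T) := by
    intro ψ hψ hc g hg
    obtain ⟨C, hC⟩ := hc.exists_bound_of_continuous hψ
    exact hg.bdd_smul C hψ.aestronglyMeasurable (Filter.Eventually.of_forall hC)
  refine exists_ae_eq_const_add_primitive P.T_pos hi hr fun φ hφ hc hs => ?_
  refine ext_inner_left ℝ fun v => ?_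
  rw [inner_neg_right, ← integral_inner (hbdd (hφ.continuous_deriv (by simp)) hc.deriv hi),
    ← integral_inner (hbdd hφ.continuous hc hr)]
  have := w.2 φ hφ hc hs v
  simp only [real_inner_smul_right, inner_gram_right]
  simp_rw [real_inner_comm (P.rieszDeriv w _) v, inner_rieszDeriv]
  rw [← this]
  simp_rw [real_inner_comm (P.ι v)]
  rfl

end ParabolicProblem
end SpaceTime

/-! ### The continuous representative in `H` -/

namespace SpaceTime
namespace ParabolicProblem

variable {V : Type u} {H : Type v} [NormedAddCommGroup V] [InnerProductSpace ℝ V] [CompleteSpace V]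
  [NormedAddCommGroup H] [InnerProductSpace ℝ H] [CompleteSpace H] (P : ParabolicProblem V H)

/-- The duality pairing of the derivative of `w` with `z`, smoothed in space, is the derivative
of the inner product of the smoothed functions. -/
theorem integral_smoothed {S : V →L[ℝ] V} (hS : ∀ x y, inner ℝ (S x) y = inner ℝ x (S y))
    (w z : P.X) {ξ χ : V}
    (hw : ∀ᵐ t ∂(timeMeasure P.T),
      gram P.ι (P.toY w t) = ξ + ∫ s in (0 : ℝ)..t, P.rieszDeriv w s)
    (hz : ∀ᵐ t ∂(timeMeasure P.T),
      gram P.ι (P.toY z t) = χ + ∫ s in (0 : ℝ)..t, P.rieszDeriv z s)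
    {t : ℝ} (ht : t ∈ Icc 0 P.T) :
    inner ℝ (P.ι (S (ξ + ∫ s in (0 : ℝ)..t, P.rieszDeriv w s)))
        (P.ι (S (χ + ∫ s in (0 : ℝ)..t, P.rieszDeriv z s)))
      - inner ℝ (P.ι (S ξ)) (P.ι (S χ))
      = ∫ s in (0 : ℝ)..t,
        (inner ℝ (P.rieszDeriv w s) (S (gram P.ι (S (gram P.ι (P.toY z s)))))
          + inner ℝ (P.rieszDeriv z s) (S (gram P.ι (S (gram P.ι (P.toY w s)))))) := by
  have hti : uIcc 0 t ⊆ uIcc 0 P.T := by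
    rw [uIcc_of_le ht.1, uIcc_of_le P.T_pos.le]; exact Icc_subset_Icc_right ht.2
  have iw := (P.intervalIntegrable_rieszDeriv w).mono_set hti
  have iz := (P.intervalIntegrable_rieszDeriv z).mono_set hti
  set L : V →L[ℝ] H := P.ι.comp S with hL
  have comm : ∀ {f : ℝ → V}, IntervalIntegrable f volume 0 P.T → ∀ ξ : V, ∀ τ ∈ Icc 0 t,
      L ξ + ∫ s in (0 : ℝ)..τ, L (f s) = L (ξ + ∫ s in (0 : ℝ)..τ, f s) := by
    intro f hf ξ τ hτ
    rw [map_add, L.intervalIntegral_comp_comm]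
    refine hf.mono_set ?_
    rw [uIcc_of_le hτ.1, uIcc_of_le P.T_pos.le]
    exact Icc_subset_Icc_right (hτ.2.trans ht.2)
  have hLi : ∀ {f : ℝ → V}, IntervalIntegrable f volume 0 t →
      IntervalIntegrable (fun s => L (f s)) volume 0 t := by
    intro f hf
    rw [intervalIntegrable_iff] at hf ⊢
    exact L.integrable_comp hf
  -- The product rule is applied in `H` to the images under `ι ∘ S` of the two primitives. Symmetry
  -- of `S` afterwards moves everything off the derivatives, so that `w` and `z` only meet the
  -- product `S ∘ gram`. For the regularizers this product is bounded uniformly, while `S` itself is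
  -- not.
  have key := integral_inner_primitive (hLi iw) (hLi iz) (L ξ) (L χ)
  have htt : t ∈ Icc 0 t := ⟨ht.1, le_rfl⟩
  rw [comm (P.intervalIntegrable_rieszDeriv w) ξ t htt,
    comm (P.intervalIntegrable_rieszDeriv z) χ t htt] at key
  change inner ℝ (L _) (L _) - inner ℝ (L ξ) (L χ) = _
  rw [← key]
  rw [intervalIntegral.integral_of_le ht.1, intervalIntegral.integral_of_le ht.1,
    integral_Ioc_eq_integral_Ioo, integral_Ioc_eq_integral_Ioo]
  have hsub : Ioo 0 t ⊆ Ioo 0 P.T := Ioo_subset_Ioo_right ht.2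
  refine integral_congr_ae ?_
  filter_upwards [ae_mono (Measure.restrict_mono hsub le_rfl) hw,
    ae_mono (Measure.restrict_mono hsub le_rfl) hz, ae_restrict_mem measurableSet_Ioo]
    with τ h1 h2 hτ
  have hτ' : τ ∈ Icc 0 t := Ioo_subset_Icc_self hτ
  rw [comm (P.intervalIntegrable_rieszDeriv w) ξ τ hτ',
    comm (P.intervalIntegrable_rieszDeriv z) χ τ hτ', ← h1, ← h2]
  simp only [hL, ContinuousLinearMap.comp_apply]
  rw [← inner_gram_right, hS, real_inner_comm (P.ι (S (P.rieszDeriv z τ))), ← inner_gram_right, hS]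

omit [CompleteSpace V] [CompleteSpace H] in
theorem integrable_inner {f g : ℝ → V} (hf : MemLp f 2 (timeMeasure P.T))
    (hg : MemLp g 2 (timeMeasure P.T)) :
    Integrable (fun t => inner ℝ (f t) (g t)) (timeMeasure P.T) :=
  (hf.norm.integrable_mul hg.norm).mono' (hf.1.inner hg.1)
    (Filter.Eventually.of_forall fun _ => norm_inner_le_norm _ _)

variable {P}

theorem tendsto_integral_norm_mul_norm_sub {R : ℕ → V →L[ℝ] V}
    (hb : ∀ n z, ‖R n (gram P.ι z)‖ ≤ 2 * ‖z‖)
    (hR : ∀ z, Filter.Tendsto (fun n => R n (gram P.ι z)) Filter.atTop (nhds z))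
    {f : ℝ → V} (hf : MemLp f 2 (timeMeasure P.T)) (w : P.Y) :
    Filter.Tendsto (fun n => ∫ t, ‖f t‖ * ‖R n (gram P.ι (w t)) - w t‖ ∂(timeMeasure P.T))
      Filter.atTop (nhds 0) := by
  have hw := Lp.memLp w
  rw [← integral_zero ℝ ℝ (μ := timeMeasure P.T)]
  refine tendsto_integral_of_dominated_convergence (fun t => 3 * (‖f t‖ * ‖w t‖)) (fun n => ?_)
    ((hf.norm.integrable_mul hw.norm).const_mul 3) (fun n => ?_) ?_
  · exact hf.1.norm.mul ((((R n).comp (gram P.ι)).continuous.comp_aestronglyMeasurable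
      hw.1).sub hw.1).norm
  · refine Filter.Eventually.of_forall fun t => ?_
    rw [norm_mul, norm_norm, norm_norm]
    have : ‖R n (gram P.ι (w t)) - w t‖ ≤ 3 * ‖w t‖ :=
      (norm_sub_le _ _).trans (by linarith [hb n (w t)])
    calc _ ≤ ‖f t‖ * (3 * ‖w t‖) := by gcongr
      _ = _ := by ring
  · refine Filter.Eventually.of_forall fun t => ?_
    have h1 : Filter.Tendsto (fun n => ‖R n (gram P.ι (w t)) - w t‖) Filter.atTop (nhds 0) := by
      have := ((hR (w t)).sub_const (w t)).norm
      simpa using this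
    simpa using h1.const_mul ‖f t‖

theorem tendsto_integral_norm_sub_sq {R : ℕ → V →L[ℝ] V}
    (hb : ∀ n z, ‖R n (gram P.ι z)‖ ≤ 2 * ‖z‖)
    (hR : ∀ z, Filter.Tendsto (fun n => R n (gram P.ι z)) Filter.atTop (nhds z)) (w : P.Y) :
    Filter.Tendsto (fun n => ∫ t, ‖R n (gram P.ι (w t)) - w t‖ ^ 2 ∂(timeMeasure P.T))
      Filter.atTop (nhds 0) := by
  have hw := Lp.memLp w
  rw [← integral_zero ℝ ℝ (μ := timeMeasure P.T)]
  refine tendsto_integral_of_dominated_convergence (fun t => 9 * (‖w t‖ * ‖w t‖)) (fun n => ?_)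
    ((hw.norm.integrable_mul hw.norm).const_mul 9) (fun n => ?_) ?_
  · exact ((((R n).comp (gram P.ι)).continuous.comp_aestronglyMeasurable
      hw.1).sub hw.1).norm.pow 2
  · refine Filter.Eventually.of_forall fun t => ?_
    rw [norm_pow, norm_norm]
    have : ‖R n (gram P.ι (w t)) - w t‖ ≤ 3 * ‖w t‖ :=
      (norm_sub_le _ _).trans (by linarith [hb n (w t)])
    calc _ ≤ (3 * ‖w t‖) ^ 2 := by gcongr
      _ = _ := by ring
  · refine Filter.Eventually.of_forall fun t => ?_
    have h1 : Filter.Tendsto (fun n => ‖R n (gram P.ι (w t)) - w t‖) Filter.atTop (nhds 0) := by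
      have := ((hR (w t)).sub_const (w t)).norm
      simpa using this
    simpa using h1.pow 2

omit [CompleteSpace V] [CompleteSpace H] in
theorem memLp_comp_toY (L : V →L[ℝ] V) (w : P.Y) :
    MemLp (fun t => L (w t)) 2 (timeMeasure P.T) :=
  L.comp_memLp' (Lp.memLp w)

/-- The spatially smoothed versions of `w ∈ X` converge uniformly in `H` to a continuous
representative of `w`. -/
theorem exists_tendsto_continuous_representative {R : ℕ → V →L[ℝ] V}
    (hs : ∀ n x y, inner ℝ (R n x) y = inner ℝ x (R n y))
    (hb : ∀ n z, ‖R n (gram P.ι z)‖ ≤ 2 * ‖z‖)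
    (hR : ∀ z, Filter.Tendsto (fun n => R n (gram P.ι z)) Filter.atTop (nhds z))
    (w : P.X) {ξ : V} (hw : ∀ᵐ t ∂(timeMeasure P.T),
      gram P.ι (P.toY w t) = ξ + ∫ s in (0 : ℝ)..t, P.rieszDeriv w s) :
    ∃ c : ℝ → H, ContinuousOn c (Icc 0 P.T) ∧
      (fun s => P.ι (P.toY w s)) =ᵐ[timeMeasure P.T] c ∧
      ∀ t ∈ Icc 0 P.T, Filter.Tendsto
        (fun n => P.ι (R n (ξ + ∫ s in (0 : ℝ)..t, P.rieszDeriv w s))) Filter.atTop (nhds (c t)) := by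
  set F : ℕ → ℝ → H := fun n t => P.ι (R n (ξ + ∫ s in (0 : ℝ)..t, P.rieszDeriv w s)) with hF
  set b : ℕ → ℝ := fun n =>
    ∫ t, ‖P.rieszDeriv w t‖ * ‖R n (gram P.ι (P.toY w t)) - P.toY w t‖ ∂(timeMeasure P.T) with hbdef
  set e : ℕ → ℝ := fun n => ∫ t, ‖R n (gram P.ι (P.toY w t)) - P.toY w t‖ ^ 2 ∂(timeMeasure P.T)
    with hedef
  have hbt : Filter.Tendsto b Filter.atTop (nhds 0) :=
    tendsto_integral_norm_mul_norm_sub hb hR (P.memLp_rieszDeriv w) (P.toY w)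
  have het : Filter.Tendsto e Filter.atTop (nhds 0) := tendsto_integral_norm_sub_sq hb hR (P.toY w)
  have hdiff : ∀ n, MemLp (fun t => R n (gram P.ι (P.toY w t)) - P.toY w t) 2 (timeMeasure P.T) :=
    fun n => (memLp_comp_toY ((R n).comp (gram P.ι)) (P.toY w)).sub (Lp.memLp _)
  -- variation of the difference
  have hvar : ∀ n k, ∀ t ∈ Icc 0 P.T,
      |‖F n t - F k t‖ ^ 2 - ‖F n 0 - F k 0‖ ^ 2| ≤ 8 * (b n + b k) := by
    intro n k t ht
    set S : V →L[ℝ] V := R n - R k with hSdef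
    have hS : ∀ x y, inner ℝ (S x) y = inner ℝ x (S y) := fun x y => by
      simp only [hSdef, sub_apply, inner_sub_left, inner_sub_right, hs]
    have key := P.integral_smoothed hS w w hw hw ht
    have eF : ∀ t, F n t - F k t = P.ι (S (ξ + ∫ s in (0 : ℝ)..t, P.rieszDeriv w s)) := fun t => by
      simp only [hF, hSdef, sub_apply, map_sub]
    have hSG : ∀ x, ‖S (gram P.ι x)‖ ≤ 4 * ‖x‖ := fun x => by
      simp only [hSdef, sub_apply]
      exact (norm_sub_le _ _).trans (by linarith [hb n x, hb k x])
    have hSG2 : ∀ x, ‖S (gram P.ι x)‖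
        ≤ ‖R n (gram P.ι x) - x‖ + ‖R k (gram P.ι x) - x‖ := fun x => by
      simp only [hSdef, sub_apply]
      rw [← sub_sub_sub_cancel_right _ _ x]
      exact norm_sub_le _ _
    rw [real_inner_self_eq_norm_sq, real_inner_self_eq_norm_sq] at key
    rw [eF, eF, intervalIntegral.integral_same, add_zero, key, intervalIntegral.integral_of_le ht.1,
      integral_Ioc_eq_integral_Ioo]
    have hi1 := (P.memLp_rieszDeriv w).norm.integrable_mul (hdiff n).norm
    have hi2 := (P.memLp_rieszDeriv w).norm.integrable_mul (hdiff k).norm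
    have hsum : b n + b k = ∫ τ, (‖P.rieszDeriv w τ‖ * ‖R n (gram P.ι (P.toY w τ)) - P.toY w τ‖
        + ‖P.rieszDeriv w τ‖ * ‖R k (gram P.ι (P.toY w τ)) - P.toY w τ‖) ∂(timeMeasure P.T) :=
      (integral_add hi1 hi2).symm
    rw [hsum, ← integral_const_mul]
    -- One of the two factors `S ∘ gram` is bounded by `4`, the other one is small pointwise. The
    -- two equal summands double the constant.
    have hle : ∀ τ, ‖inner ℝ (P.rieszDeriv w τ) (S (gram P.ι (S (gram P.ι (P.toY w τ)))))
        + inner ℝ (P.rieszDeriv w τ) (S (gram P.ι (S (gram P.ι (P.toY w τ)))))‖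
        ≤ 8 * (‖P.rieszDeriv w τ‖ * ‖R n (gram P.ι (P.toY w τ)) - P.toY w τ‖
        + ‖P.rieszDeriv w τ‖ * ‖R k (gram P.ι (P.toY w τ)) - P.toY w τ‖) := by
      intro τ
      refine (norm_add_le _ _).trans ?_
      have h1 := norm_inner_le_norm (𝕜 := ℝ) (P.rieszDeriv w τ)
        (S (gram P.ι (S (gram P.ι (P.toY w τ)))))
      have h2 := (hSG (S (gram P.ι (P.toY w τ)))).trans
        (mul_le_mul_of_nonneg_left (hSG2 (P.toY w τ)) (by norm_num))
      have h3 := mul_le_mul_of_nonneg_left h2 (norm_nonneg (P.rieszDeriv w τ))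
      linarith
    refine (norm_integral_le_of_norm_le (((hi1.add hi2).const_mul 8).mono_measure
      (Measure.restrict_mono (Ioo_subset_Ioo_right ht.2) le_rfl))
      (Filter.Eventually.of_forall hle)).trans ?_
    refine integral_mono_measure (Measure.restrict_mono (Ioo_subset_Ioo_right ht.2) le_rfl)
      (Filter.Eventually.of_forall fun τ => ?_) ((hi1.add hi2).const_mul 8)
    exact (norm_nonneg _).trans (hle τ)
  have hFae : ∀ n, ∀ᵐ t ∂(timeMeasure P.T), F n t = P.ι (R n (gram P.ι (P.toY w t))) := fun n => by
    filter_upwards [hw] with t ht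
    rw [hF, ht]
  -- The value at `t` exceeds that at any other time `s` by at most twice the variation from time
  -- `0`. Averaging over `s` replaces the unknown initial value by an `L₂` norm, which is small
  -- because the smoothed functions converge in `L₂(I; V)`.
  have hbound : ∀ n k, ∀ t ∈ Icc 0 P.T, P.T * ‖F n t - F k t‖ ^ 2
      ≤ 2 * ‖P.ι‖ ^ 2 * (e n + e k) + 16 * P.T * (b n + b k) := by
    intro n k t ht
    have hpt : ∀ᵐ s ∂(timeMeasure P.T), ‖F n t - F k t‖ ^ 2
        ≤ 2 * ‖P.ι‖ ^ 2 * (‖R n (gram P.ι (P.toY w s)) - P.toY w s‖ ^ 2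
          + ‖R k (gram P.ι (P.toY w s)) - P.toY w s‖ ^ 2) + 16 * (b n + b k) := by
      filter_upwards [hFae n, hFae k, ae_restrict_mem measurableSet_Ioo] with s h1 h2 hsI
      have v1 := abs_le.1 (hvar n k t ht)
      have v2 := abs_le.1 (hvar n k s (Ioo_subset_Icc_self hsI))
      have v3 : ‖F n s - F k s‖ ^ 2 ≤ 2 * ‖P.ι‖ ^ 2 *
          (‖R n (gram P.ι (P.toY w s)) - P.toY w s‖ ^ 2
          + ‖R k (gram P.ι (P.toY w s)) - P.toY w s‖ ^ 2) := by
        rw [h1, h2, ← map_sub, ← sub_sub_sub_cancel_right _ _ (P.toY w s)]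
        set p := R n (gram P.ι (P.toY w s)) - P.toY w s
        set q := R k (gram P.ι (P.toY w s)) - P.toY w s
        have i1 : ‖P.ι (p - q)‖ ≤ ‖P.ι‖ * (‖p‖ + ‖q‖) :=
          (P.ι.le_opNorm _).trans (mul_le_mul_of_nonneg_left (norm_sub_le _ _) (norm_nonneg _))
        calc ‖P.ι (p - q)‖ ^ 2 ≤ (‖P.ι‖ * (‖p‖ + ‖q‖)) ^ 2 := by gcongr
          _ = ‖P.ι‖ ^ 2 * (‖p‖ + ‖q‖) ^ 2 := by ring
          _ ≤ ‖P.ι‖ ^ 2 * (2 * (‖p‖ ^ 2 + ‖q‖ ^ 2)) := by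
            gcongr; nlinarith [sq_nonneg (‖p‖ - ‖q‖)]
          _ = _ := by ring
      linarith
    have hi : ∀ n, Integrable (fun s => ‖R n (gram P.ι (P.toY w s)) - P.toY w s‖ ^ 2)
        (timeMeasure P.T) := fun n => (hdiff n).integrable_norm_pow two_ne_zero
    have h := integral_mono_ae (integrable_const _)
      ((((hi n).add (hi k)).const_mul (2 * ‖P.ι‖ ^ 2)).add
        (integrable_const (16 * (b n + b k)))) hpt
    have hmeas : (timeMeasure P.T).real univ = P.T := by
      simp [Measure.real, P.T_pos.le]
    simp only [Pi.add_apply] at h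
    rw [integral_add (((hi n).fun_add (hi k)).const_mul _) (integrable_const _), integral_const,
      integral_const, integral_const_mul, integral_add (hi n) (hi k), hmeas] at h
    simp only [smul_eq_mul] at h
    linarith
  have hunif : UniformCauchySeqOn F Filter.atTop (Icc 0 P.T) := by
    rw [Metric.uniformCauchySeqOn_iff]
    intro ε hε
    have hd : Filter.Tendsto (fun n => 2 * ‖P.ι‖ ^ 2 * e n + 16 * P.T * b n) Filter.atTop
        (nhds 0) := by
      simpa using (het.const_mul (2 * ‖P.ι‖ ^ 2)).add (hbt.const_mul (16 * P.T))
    have hpos : 0 < P.T * ε ^ 2 / 2 := by have := P.T_pos; positivity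
    obtain ⟨N, hN⟩ := Filter.eventually_atTop.1 (hd.eventually (gt_mem_nhds hpos))
    refine ⟨N, fun n hn k hk t ht => ?_⟩
    have h1 := hN n hn
    have h2 := hN k hk
    have h3 := hbound n k t ht
    rw [dist_eq_norm]
    refine lt_of_pow_lt_pow_left₀ 2 hε.le ?_
    refine lt_of_mul_lt_mul_left ?_ P.T_pos.le
    linarith
  have hlim : ∀ t, ∃ y, t ∈ Icc 0 P.T → Filter.Tendsto (fun n => F n t) Filter.atTop (nhds y) := by
    intro t
    by_cases ht : t ∈ Icc 0 P.T
    · obtain ⟨y, hy⟩ := cauchySeq_tendsto_of_complete (hunif.cauchySeq ht)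
      exact ⟨y, fun _ => hy⟩
    · exact ⟨0, fun h => absurd h ht⟩
  choose c hc using hlim
  have hFc : ∀ n, ContinuousOn (F n) (Icc 0 P.T) := fun n => by
    have := continuousOn_primitive_const_add (P.intervalIntegrable_rieszDeriv w) ξ
    rw [uIcc_of_le P.T_pos.le] at this
    exact (P.ι.comp (R n)).continuous.comp_continuousOn this
  refine ⟨c, ?_, ?_, hc⟩
  · exact (hunif.tendstoUniformlyOn_of_tendsto hc).continuousOn
      (Filter.Frequently.of_forall hFc)
  · filter_upwards [ae_all_iff.2 hFae, ae_restrict_mem measurableSet_Ioo] with t h1 ht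
    refine tendsto_nhds_unique ?_ (hc t (Ioo_subset_Icc_self ht))
    simp_rw [h1]
    exact (P.ι.continuous.tendsto _).comp (hR (P.toY w t))

end ParabolicProblem
end SpaceTime

/-! ### Traces and integration by parts -/

namespace SpaceTime
namespace ParabolicProblem

variable {V : Type u} {H : Type v} [NormedAddCommGroup V] [InnerProductSpace ℝ V]
  [NormedAddCommGroup H] [InnerProductSpace ℝ H] (P : ParabolicProblem V H)

variable {P} in
-- The trace is defined by a choice of a representative. Continuous functions that agree almost
-- everywhere on `(0, T)` agree on `[0, T]`, so any continuous representative may be used to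
-- evaluate it.
theorem trace_eq {w : P.X} {c : ℝ → H} (hc : ContinuousOn c (Icc 0 P.T))
    (hw : (fun s => P.ι (P.toY w s)) =ᵐ[timeMeasure P.T] c) {t : ℝ} (ht : t ∈ Icc 0 P.T) :
    P.trace t w = c t := by
  have h : ∃ c : ℝ → H, ContinuousOn c (Icc 0 P.T) ∧
      (fun s => P.ι (P.toY w s)) =ᵐ[timeMeasure P.T] c := ⟨c, hc, hw⟩
  rw [trace, dif_pos h]
  have h2 := h.choose_spec
  refine Measure.eqOn_Icc_of_ae_eq volume P.T_pos.ne ?_ h2.1 hc ht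
  have e : (volume : Measure ℝ).restrict (Icc 0 P.T) = timeMeasure P.T :=
    (restrict_Ioo_eq_restrict_Icc (μ := volume)).symm
  rw [e]
  exact h2.2.symm.trans hw

variable [CompleteSpace V] [CompleteSpace H]

theorem exists_continuous_representative (w : P.X) :
    ContinuousOn (fun t => P.trace t w) (Icc 0 P.T) ∧
      (fun s => P.ι (P.toY w s)) =ᵐ[timeMeasure P.T] fun t => P.trace t w := by
  obtain ⟨R, hs, hb, hR⟩ := exists_regularization P.ι_injective
  obtain ⟨ξ, hξ⟩ := P.exists_gram_eq_primitive w
  obtain ⟨c, hc, hae, -⟩ := exists_tendsto_continuous_representative hs hb hR w hξ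
  constructor
  · exact hc.congr fun t ht => trace_eq hc hae ht
  · filter_upwards [hae, ae_restrict_mem measurableSet_Ioo] with t h1 ht
    rw [h1, trace_eq hc hae (Ioo_subset_Icc_self ht)]

omit [CompleteSpace H] in
theorem integrable_pairing (w : P.X) (v : P.Y) :
    Integrable (fun t => w.1.snd t (v t)) (timeMeasure P.T) := by
  simp_rw [← P.inner_rieszDeriv]
  exact P.integrable_inner (P.memLp_rieszDeriv w) (Lp.memLp v)

/-- Integration by parts in `X`. -/
theorem inner_trace_sub_inner_trace (w z : P.X) {t : ℝ} (ht : t ∈ Icc 0 P.T) :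
    inner ℝ (P.trace t w) (P.trace t z) - inner ℝ (P.trace 0 w) (P.trace 0 z)
      = ∫ s in (0 : ℝ)..t, (w.1.snd s (P.toY z s) + z.1.snd s (P.toY w s)) := by
  obtain ⟨R, hs, hb, hR⟩ := exists_regularization P.ι_injective
  obtain ⟨ξ, hξ⟩ := P.exists_gram_eq_primitive w
  obtain ⟨χ, hχ⟩ := P.exists_gram_eq_primitive z
  obtain ⟨c, hc, hae, hlim⟩ := exists_tendsto_continuous_representative hs hb hR w hξ
  obtain ⟨d, hd, hae', hlim'⟩ := exists_tendsto_continuous_representative hs hb hR z hχ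
  have h0 : (0 : ℝ) ∈ Icc 0 P.T := ⟨le_rfl, P.T_pos.le⟩
  rw [trace_eq hc hae ht, trace_eq hc hae h0, trace_eq hd hae' ht, trace_eq hd hae' h0]
  have l1 := (hlim t ht).inner (𝕜 := ℝ) (hlim' t ht)
  have l0 := (hlim 0 h0).inner (𝕜 := ℝ) (hlim' 0 h0)
  simp only [intervalIntegral.integral_same, add_zero] at l0
  have l := l1.sub l0
  simp_rw [fun n => P.integral_smoothed (hs n) w z hξ hχ ht] at l
  refine tendsto_nhds_unique l ?_
  simp_rw [intervalIntegral.integral_of_le ht.1, integral_Ioc_eq_integral_Ioo,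
    ← P.inner_rieszDeriv]
  have hle : (volume : Measure ℝ).restrict (Ioo 0 t) ≤ timeMeasure P.T :=
    Measure.restrict_mono (Ioo_subset_Ioo_right ht.2) le_rfl
  have hm : ∀ (x y : P.X) n, AEStronglyMeasurable (fun s => inner ℝ (P.rieszDeriv x s)
      (R n (gram P.ι (R n (gram P.ι (P.toY y s)))))) (timeMeasure P.T) := fun x y n =>
    (P.integrable_inner (P.memLp_rieszDeriv x) (memLp_comp_toY
      (((R n).comp (gram P.ι)).comp ((R n).comp (gram P.ι))) (P.toY y))).1
  have hn : ∀ (x y : P.X) n s, ‖inner ℝ (P.rieszDeriv x s)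
      (R n (gram P.ι (R n (gram P.ι (P.toY y s)))))‖ ≤ 4 * (‖P.rieszDeriv x s‖ * ‖P.toY y s‖) := by
    intro x y n s
    refine (norm_inner_le_norm _ _).trans ?_
    have h1 := hb n (R n (gram P.ι (P.toY y s)))
    have h2 := hb n (P.toY y s)
    have := mul_le_mul_of_nonneg_left (h1.trans (by linarith : _ ≤ 4 * ‖P.toY y s‖))
      (norm_nonneg (P.rieszDeriv x s))
    linarith
  have hi : ∀ x y : P.X, Integrable (fun s => ‖P.rieszDeriv x s‖ * ‖P.toY y s‖)
      (timeMeasure P.T) := fun x y =>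
    (P.memLp_rieszDeriv x).norm.integrable_mul (Lp.memLp (P.toY y)).norm
  -- Strong convergence survives squaring of the operators thanks to their uniform bound.
  have ht2 : ∀ y : V, Filter.Tendsto (fun n => R n (gram P.ι (R n (gram P.ι y)))) Filter.atTop
      (nhds y) := by
    intro y
    have e : ∀ n, R n (gram P.ι (R n (gram P.ι y)))
        = R n (gram P.ι (R n (gram P.ι y) - y)) + R n (gram P.ι y) := fun n => by
      rw [map_sub, map_sub, sub_add_cancel]
    simp_rw [e]
    have h1 : Filter.Tendsto (fun n => R n (gram P.ι (R n (gram P.ι y) - y))) Filter.atTop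
        (nhds 0) := by
      refine squeeze_zero_norm (fun n => hb n _) ?_
      have := (((hR y).sub_const y).norm).const_mul 2
      simpa using this
    simpa using h1.add (hR y)
  refine tendsto_integral_of_dominated_convergence
    (fun s => 4 * (‖P.rieszDeriv w s‖ * ‖P.toY z s‖) + 4 * (‖P.rieszDeriv z s‖ * ‖P.toY w s‖))
    (fun n => ((hm w z n).add (hm z w n)).mono_measure hle)
    ((((hi w z).const_mul 4).add ((hi z w).const_mul 4)).mono_measure hle)
    (fun n => Filter.Eventually.of_forall fun s =>
      (norm_add_le _ _).trans (add_le_add (hn w z n s) (hn z w n s)))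
    (Filter.Eventually.of_forall fun s => ?_)
  exact (tendsto_const_nhds.inner (ht2 _)).add (tendsto_const_nhds.inner (ht2 _))

theorem inner_trace_T_sub (w z : P.X) :
    inner ℝ (P.trace P.T w) (P.trace P.T z) - inner ℝ (P.trace 0 w) (P.trace 0 z)
      = P.dt w (P.toY z) + P.dt z (P.toY w) := by
  rw [P.inner_trace_sub_inner_trace w z ⟨P.T_pos.le, le_rfl⟩,
    intervalIntegral.integral_of_le P.T_pos.le, integral_Ioc_eq_integral_Ioo,
    integral_add (P.integrable_pairing _ _) (P.integrable_pairing _ _), dt_apply, dt_apply]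

omit [CompleteSpace V] [CompleteSpace H] in
theorem toY_add (w z : P.X) : P.toY (w + z) = P.toY w + P.toY z := rfl

omit [CompleteSpace V] [CompleteSpace H] in
theorem toY_smul (r : ℝ) (w : P.X) : P.toY (r • w) = r • P.toY w := rfl

theorem trace_add {t : ℝ} (ht : t ∈ Icc 0 P.T) (w z : P.X) :
    P.trace t (w + z) = P.trace t w + P.trace t z := by
  obtain ⟨h1, h2⟩ := P.exists_continuous_representative w
  obtain ⟨h3, h4⟩ := P.exists_continuous_representative z
  refine trace_eq (h1.add h3) ?_ ht
  filter_upwards [h2, h4, Lp.coeFn_add (P.toY w) (P.toY z)] with s e1 e2 e3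
  rw [toY_add, e3, Pi.add_apply, map_add, e1, e2]
  rfl

theorem trace_smul {t : ℝ} (ht : t ∈ Icc 0 P.T) (r : ℝ) (w : P.X) :
    P.trace t (r • w) = r • P.trace t w := by
  obtain ⟨h1, h2⟩ := P.exists_continuous_representative w
  refine trace_eq (continuousOn_const.smul h1 : ContinuousOn (fun t => r • P.trace t w) _) ?_ ht
  filter_upwards [h2, Lp.coeFn_smul r (P.toY w)] with s e1 e3
  rw [toY_smul, e3, Pi.smul_apply, map_smul, e1]
  rfl

omit [CompleteSpace V] [CompleteSpace H] in
theorem norm_toY_le (w : P.X) : ‖P.toY w‖ ≤ ‖w‖ := by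
  have h := WithLp.prod_norm_sq_eq_of_L2 w.1
  have h2 : ‖w‖ = ‖w.1‖ := rfl
  change ‖w.1.fst‖ ≤ _
  rw [h2]
  exact le_of_sq_le_sq (by nlinarith [sq_nonneg ‖w.1.snd‖]) (norm_nonneg _)

omit [CompleteSpace V] [CompleteSpace H] in
theorem norm_snd_le (w : P.X) : ‖w.1.snd‖ ≤ ‖w‖ := by
  have h := WithLp.prod_norm_sq_eq_of_L2 w.1
  have h2 : ‖w‖ = ‖w.1‖ := rfl
  rw [h2]
  exact le_of_sq_le_sq (by nlinarith [sq_nonneg ‖w.1.fst‖]) (norm_nonneg _)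

theorem integral_norm_mul_norm_le {T : ℝ} {E F : Type*} [NormedAddCommGroup E]
    [NormedAddCommGroup F] (f : L2 T E) (g : L2 T F) :
    ∫ t, ‖f t‖ * ‖g t‖ ∂(timeMeasure T) ≤ ‖f‖ * ‖g‖ := by
  have hf := (Lp.memLp f).norm
  have hg := (Lp.memLp g).norm
  have h := real_inner_le_norm (hf.toLp (fun t => ‖f t‖)) (hg.toLp (fun t => ‖g t‖))
  rw [L2.inner_def, Lp.norm_toLp, Lp.norm_toLp, eLpNorm_norm, eLpNorm_norm] at h
  refine le_trans (le_of_eq (integral_congr_ae ?_)) h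
  filter_upwards [hf.coeFn_toLp, hg.coeFn_toLp] with t h1 h2
  rw [h1, h2]
  simp [mul_comm]

/-- By integration by parts `‖w(t)‖²` differs from `‖w(s)‖²` by at most `4 ‖w‖²`, twice the
variation from time `0`. Averaging over `s` then bounds the trace by the `L₂` norm of `ι w` and the
norm of `X`. -/
theorem exists_norm_trace_le : ∃ C : ℝ, ∀ t ∈ Icc 0 P.T, ∀ w : P.X, ‖P.trace t w‖ ≤ C * ‖w‖ := by
  have hT := P.T_pos
  refine ⟨Real.sqrt ((‖P.ι‖ ^ 2 + 4 * P.T) / P.T), fun t ht w => ?_⟩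
  have hi : Integrable (fun s => ‖w.1.snd s‖ * ‖P.toY w s‖) (timeMeasure P.T) :=
    (Lp.memLp w.1.snd).norm.integrable_mul (Lp.memLp (P.toY w)).norm
  have hβ : ∫ s, ‖w.1.snd s‖ * ‖P.toY w s‖ ∂(timeMeasure P.T) ≤ ‖w‖ ^ 2 := by
    refine (integral_norm_mul_norm_le _ _).trans ?_
    rw [sq]
    exact mul_le_mul (P.norm_snd_le w) (P.norm_toY_le w) (norm_nonneg _) (norm_nonneg _)
  have hv : ∀ s ∈ Icc 0 P.T, |‖P.trace s w‖ ^ 2 - ‖P.trace 0 w‖ ^ 2| ≤ 2 * ‖w‖ ^ 2 := by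
    intro s hs
    have key := P.inner_trace_sub_inner_trace w w hs
    rw [real_inner_self_eq_norm_sq, real_inner_self_eq_norm_sq] at key
    rw [key, intervalIntegral.integral_of_le hs.1, integral_Ioc_eq_integral_Ioo]
    have hle : ∀ τ, ‖w.1.snd τ (P.toY w τ) + w.1.snd τ (P.toY w τ)‖
        ≤ 2 * (‖w.1.snd τ‖ * ‖P.toY w τ‖) := fun τ =>
      (norm_add_le _ _).trans (by linarith [(w.1.snd τ).le_opNorm (P.toY w τ)])
    refine (norm_integral_le_of_norm_le ((hi.const_mul 2).mono_measure
      (Measure.restrict_mono (Ioo_subset_Ioo_right hs.2) le_rfl))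
      (Filter.Eventually.of_forall hle)).trans ?_
    refine (integral_mono_measure (Measure.restrict_mono (Ioo_subset_Ioo_right hs.2) le_rfl)
      (Filter.Eventually.of_forall fun τ => (norm_nonneg _).trans (hle τ)) (hi.const_mul 2)).trans ?_
    rw [integral_const_mul]
    linarith
  have hpt : ∀ᵐ s ∂(timeMeasure P.T), ‖P.trace t w‖ ^ 2
      ≤ ‖P.ι‖ ^ 2 * (‖P.toY w s‖ * ‖P.toY w s‖) + 4 * ‖w‖ ^ 2 := by
    filter_upwards [(P.exists_continuous_representative w).2, ae_restrict_mem measurableSet_Ioo]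
      with s h1 hs
    have v1 := abs_le.1 (hv t ht)
    have v2 := abs_le.1 (hv s (Ioo_subset_Icc_self hs))
    have v3 : ‖P.trace s w‖ ^ 2 ≤ ‖P.ι‖ ^ 2 * (‖P.toY w s‖ * ‖P.toY w s‖) := by
      rw [← h1, ← sq, ← mul_pow]
      gcongr
      exact P.ι.le_opNorm _
    linarith
  have h := integral_mono_ae (integrable_const _)
    (((P.integrable_norm_mul (P.toY w) (P.toY w)).const_mul (‖P.ι‖ ^ 2)).add
      (integrable_const (4 * ‖w‖ ^ 2))) hpt
  have hmeas : (timeMeasure P.T).real univ = P.T := by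
    simp [Measure.real, P.T_pos.le]
  simp only [Pi.add_apply] at h
  rw [integral_add ((P.integrable_norm_mul (P.toY w) (P.toY w)).const_mul (‖P.ι‖ ^ 2))
    (integrable_const _), integral_const, integral_const, integral_const_mul, hmeas] at h
  simp only [smul_eq_mul] at h
  have h2 := P.integral_norm_mul_le (P.toY w) (P.toY w)
  have h3 : ‖P.toY w‖ * ‖P.toY w‖ ≤ ‖w‖ ^ 2 := by
    rw [sq]; exact mul_self_le_mul_self (norm_nonneg _) (P.norm_toY_le w)
  have h4 := mul_le_mul_of_nonneg_left (h2.trans h3) (sq_nonneg ‖P.ι‖)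
  have h5 : P.T * ‖P.trace t w‖ ^ 2 ≤ (‖P.ι‖ ^ 2 + 4 * P.T) * ‖w‖ ^ 2 := by linarith
  refine le_of_sq_le_sq ?_ (by positivity)
  rw [mul_pow, Real.sq_sqrt (by positivity), div_mul_eq_mul_div, le_div_iff₀ hT]
  linarith

end ParabolicProblem
end SpaceTime

namespace SpaceTime

/-! ### Energy inner products -/

section EnergySpace

/-- A copy of a normed space that carries the inner product given by a bilinear form. -/
def EnergySpace (F : Type u) : Type u := F

/-- A bounded symmetric coercive form is the inner product of an equivalent Hilbert space norm. -/
theorem exists_energySpace {F : Type u} [NormedAddCommGroup F] [NormedSpace ℝ F] [CompleteSpace F]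
    (b : F →L[ℝ] F →L[ℝ] ℝ) (hs : ∀ x y, b x y = b y x) {α : ℝ} (hα : 0 < α)
    (hc : ∀ x, α * ‖x‖ ^ 2 ≤ b x x) :
    ∃ (E : Type u) (_ : NormedAddCommGroup E) (_ : InnerProductSpace ℝ E) (_ : CompleteSpace E)
      (J : F ≃L[ℝ] E), ∀ x y, inner ℝ (J x) (J y) = b x y := by
  let i1 : AddCommGroup (EnergySpace F) := inferInstanceAs (AddCommGroup F)
  let i2 : Module ℝ (EnergySpace F) := inferInstanceAs (Module ℝ F)
  let e : F ≃ₗ[ℝ] EnergySpace F := LinearEquiv.refl ℝ F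
  let core : InnerProductSpace.Core ℝ (EnergySpace F) :=
    { inner := fun x y => b (e.symm x) (e.symm y)
      conj_inner_symm := fun x y => hs _ _
      re_inner_nonneg := fun x => (by positivity : (0 : ℝ) ≤ α * ‖e.symm x‖ ^ 2).trans (hc _)
      add_left := fun x y z => by rw [map_add, map_add]; rfl
      smul_left := fun x y r => by rw [map_smul, map_smul]; rfl
      definite := fun x hx => by
        have h1 := hc (e.symm x)
        have h2 : b (e.symm x) (e.symm x) = 0 := hx
        have h3 : ‖e.symm x‖ ^ 2 ≤ 0 := by
          by_contra h
          have := mul_pos hα (not_le.1 h)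
          linarith
        have h4 : ‖e.symm x‖ = 0 := by
          have := sq_nonneg ‖e.symm x‖
          exact pow_eq_zero_iff two_ne_zero |>.1 (le_antisymm h3 this)
        exact (LinearEquiv.map_eq_zero_iff e.symm).1 (norm_eq_zero.1 h4) }
  let i3 : NormedAddCommGroup (EnergySpace F) := core.toNormedAddCommGroup
  let i4 : InnerProductSpace ℝ (EnergySpace F) := InnerProductSpace.ofCore core.toCore
  have hin : ∀ x y : F, inner ℝ (e x) (e y) = b x y := fun x y => rfl
  have hsq : ∀ x, ‖e x‖ ^ 2 = b x x := fun x => by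
    rw [← hin, real_inner_self_eq_norm_sq]
  have hup : ∀ x, ‖e x‖ ≤ Real.sqrt ‖b‖ * ‖x‖ := fun x => by
    refine le_of_sq_le_sq ?_ (by positivity)
    have hb : 0 ≤ ‖b‖ := norm_nonneg b
    rw [hsq, mul_pow, Real.sq_sqrt hb]
    refine (le_abs_self _).trans ((b.le_opNorm₂ x x).trans (le_of_eq (by ring)))
  have hlo : ∀ x, ‖e.symm x‖ ≤ Real.sqrt α⁻¹ * ‖x‖ := fun x => by
    refine le_of_sq_le_sq ?_ (by positivity)
    have h1 := hsq (e.symm x)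
    rw [e.apply_symm_apply] at h1
    rw [mul_pow, Real.sq_sqrt (by positivity), h1, inv_mul_eq_div, le_div_iff₀ hα]
    linarith [hc (e.symm x)]
  let J : F ≃L[ℝ] EnergySpace F :=
    { e with
      continuous_toFun := AddMonoidHomClass.continuous_of_bound e _ hup
      continuous_invFun := AddMonoidHomClass.continuous_of_bound e.symm _ hlo }
  have hcomp : CompleteSpace (EnergySpace F) :=
    (completeSpace_congr (e := J.toEquiv) J.isUniformEmbedding).1 inferInstance
  exact ⟨EnergySpace F, i3, i4, hcomp, J, hin⟩

end EnergySpace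

theorem memLp_of_continuous {E : Type*} [NormedAddCommGroup E] {T : ℝ} {f : ℝ → E}
    (hf : Continuous f) : MemLp f 2 (timeMeasure T) := by
  obtain ⟨C, hC⟩ := (isCompact_Icc (a := 0) (b := T)).exists_bound_of_continuousOn hf.continuousOn
  refine MemLp.of_bound hf.aestronglyMeasurable C ?_
  filter_upwards [ae_restrict_mem measurableSet_Ioo] with t ht
  exact hC t (Ioo_subset_Icc_self ht)

/-! ### The spaces `X` and `Y` -/

namespace ParabolicProblem

variable {V : Type u} {H : Type v} [NormedAddCommGroup V] [InnerProductSpace ℝ V]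
  [NormedAddCommGroup H] [InnerProductSpace ℝ H] (P : ParabolicProblem V H)

theorem A_symm (w v : P.Y) : P.A w v = P.A v w := by
  rw [A_apply, A_apply]
  refine integral_congr_ae ?_
  filter_upwards [P.a_symm] with t ht
  exact ht _ _

theorem exists_A_coercive : ∃ α : ℝ, 0 < α ∧ ∀ v : P.Y, α * ‖v‖ ^ 2 ≤ P.A v v := by
  obtain ⟨α, hα, h⟩ := P.a_coercive
  refine ⟨α, hα, fun v => ?_⟩
  have e : ‖v‖ ^ 2 = ∫ t, ‖v t‖ ^ 2 ∂(timeMeasure P.T) := by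
    rw [← real_inner_self_eq_norm_sq, L2.inner_def]
    simp
  rw [e, ← integral_const_mul, A_apply]
  refine integral_mono_ae (((Lp.memLp v).integrable_norm_pow two_ne_zero).const_mul α)
    (P.integrable_form v v) ?_
  filter_upwards [h] with t ht
  exact ht _

/-- For fixed `φ` and `v` both sides of the defining identity are bounded functionals of the pair
`(w, w')`, so `X` is an intersection of closed sets. This makes `X` complete. -/
theorem isClosed_XSpace : IsClosed (P.XSpace : Set (WithLp 2 (P.Y × L2 P.T (StrongDual ℝ V)))) := by
  have e : (P.XSpace : Set (WithLp 2 (P.Y × L2 P.T (StrongDual ℝ V))))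
      = {p | P.IsWeakDeriv p.fst p.snd} := rfl
  rw [e]
  simp only [IsWeakDeriv, ofPred_forall]
  refine isClosed_iInter fun φ => isClosed_iInter fun hφ => isClosed_iInter fun hc =>
    isClosed_iInter fun hs => isClosed_iInter fun v => ?_
  have hφ' : Continuous (deriv φ) := hφ.continuous_deriv (by simp)
  have m1 : MemLp (fun t => deriv φ t • (innerSL ℝ (P.ι v)).comp P.ι) 2 (timeMeasure P.T) :=
    memLp_of_continuous (hφ'.smul continuous_const)
  have m2 : MemLp (fun t => φ t • v) 2 (timeMeasure P.T) :=
    memLp_of_continuous (hφ.continuous.smul continuous_const)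
  let f : P.Y → ℝ := fun w => (ContinuousLinearMap.id ℝ (StrongDual ℝ V)).lpPairing
    (timeMeasure P.T) 2 2 (m1.toLp _) w
  let g : L2 P.T (StrongDual ℝ V) → ℝ := fun w' =>
    (ContinuousLinearMap.id ℝ (StrongDual ℝ V)).lpPairing (timeMeasure P.T) 2 2 w' (m2.toLp _)
  have hf : ∀ w : P.Y, ∫ t, deriv φ t * inner ℝ (P.ι (w t)) (P.ι v) ∂(timeMeasure P.T) = f w := by
    intro w
    change _ = ContinuousLinearMap.lpPairing _ _ _ _ _ _
    rw [ContinuousLinearMap.lpPairing_eq_integral]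
    refine integral_congr_ae ?_
    filter_upwards [m1.coeFn_toLp] with t ht
    rw [ht]
    simp [real_inner_comm]
  have hg : ∀ w' : L2 P.T (StrongDual ℝ V), ∫ t, φ t * w' t v ∂(timeMeasure P.T) = g w' := by
    intro w'
    change _ = ContinuousLinearMap.lpPairing _ _ _ _ _ _
    rw [ContinuousLinearMap.lpPairing_eq_integral]
    refine integral_congr_ae ?_
    filter_upwards [m2.coeFn_toLp] with t ht
    rw [ht]
    simp
  simp only [hf, hg]
  refine isClosed_eq ?_ ?_
  · exact (ContinuousLinearMap.continuous _).comp (WithLp.prod_continuous_ofLp 2 _ _).fst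
  · refine Continuous.neg ?_
    exact (((ContinuousLinearMap.id ℝ (StrongDual ℝ V)).lpPairing
      (timeMeasure P.T) 2 2).flip (m2.toLp _)).continuous.comp
      (WithLp.prod_continuous_ofLp 2 _ _).snd

/-- The function `t ↦ φ(t) z` for smooth `φ` and `z ∈ V`. -/
theorem exists_tensor {φ : ℝ → ℝ} (hφ : ContDiff ℝ (⊤ : ℕ∞) φ) (z : V) :
    ∃ w : P.X, (∀ᵐ t ∂(timeMeasure P.T), P.toY w t = φ t • z) ∧
      (∀ᵐ t ∂(timeMeasure P.T), ∀ v, w.1.snd t v = deriv φ t * inner ℝ (P.ι z) (P.ι v)) ∧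
      ∀ t ∈ Icc 0 P.T, P.trace t w = φ t • P.ι z := by
  have hφ' : Continuous (deriv φ) := hφ.continuous_deriv (by simp)
  have m1 : MemLp (fun t => φ t • z) 2 (timeMeasure P.T) :=
    memLp_of_continuous (hφ.continuous.smul continuous_const)
  have m2 : MemLp (fun t => deriv φ t • (innerSL ℝ (P.ι z)).comp P.ι) 2 (timeMeasure P.T) :=
    memLp_of_continuous (hφ'.smul continuous_const)
  have hw : P.IsWeakDeriv (m1.toLp _) (m2.toLp _) := by
    intro ψ hψ hc hs v
    have hψ' : Continuous (deriv ψ) := hψ.continuous_deriv (by simp)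
    have hψ0 : ψ 0 = 0 := image_eq_zero_of_notMem_tsupport fun h => lt_irrefl _ (hs h).1
    have hψT : ψ P.T = 0 := image_eq_zero_of_notMem_tsupport fun h => lt_irrefl _ (hs h).2
    have e1 : ∫ t, deriv ψ t * inner ℝ (P.ι ((m1.toLp _ : P.Y) t)) (P.ι v) ∂(timeMeasure P.T)
        = ∫ t, deriv ψ t * φ t * inner ℝ (P.ι z) (P.ι v) ∂(timeMeasure P.T) := by
      refine integral_congr_ae ?_
      filter_upwards [m1.coeFn_toLp] with t ht
      rw [ht, map_smul, real_inner_smul_left]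
      ring
    have e2 : ∫ t, ψ t * (m2.toLp _ : L2 P.T (StrongDual ℝ V)) t v ∂(timeMeasure P.T)
        = ∫ t, ψ t * deriv φ t * inner ℝ (P.ι z) (P.ι v) ∂(timeMeasure P.T) := by
      refine integral_congr_ae ?_
      filter_upwards [m2.coeFn_toLp] with t ht
      rw [ht]
      simp
      ring
    rw [e1, e2, integral_mul_const, integral_mul_const, ← neg_mul]
    congr 1
    have key := intervalIntegral.integral_deriv_mul_eq_sub (a := 0) (b := P.T) (u := ψ) (v := φ)
      (fun x _ => ((hψ.differentiable (by simp)) x).hasDerivAt)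
      (fun x _ => ((hφ.differentiable (by simp)) x).hasDerivAt)
      (hψ'.intervalIntegrable _ _) (hφ'.intervalIntegrable _ _)
    rw [hψ0, hψT, zero_mul, zero_mul, sub_zero, intervalIntegral.integral_add
      ((hψ'.fun_mul hφ.continuous).intervalIntegrable _ _)
      ((hψ.continuous.fun_mul hφ').intervalIntegrable _ _)] at key
    rw [intervalIntegral.integral_of_le P.T_pos.le, intervalIntegral.integral_of_le P.T_pos.le,
      integral_Ioc_eq_integral_Ioo, integral_Ioc_eq_integral_Ioo] at key
    linarith
  refine ⟨⟨WithLp.toLp 2 (m1.toLp _, m2.toLp _), hw⟩, m1.coeFn_toLp, ?_, fun t ht => ?_⟩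
  · filter_upwards [m2.coeFn_toLp] with t ht v
    change (m2.toLp _ : L2 P.T (StrongDual ℝ V)) t v = _
    rw [ht]
    simp
  · refine trace_eq (c := fun t => φ t • P.ι z)
      (hφ.continuous.smul continuous_const).continuousOn ?_ ht
    filter_upwards [m1.coeFn_toLp] with s hs
    change P.ι ((m1.toLp _ : P.Y) s) = _
    rw [hs, map_smul]

variable [CompleteSpace V]

instance : CompleteSpace P.X := P.isClosed_XSpace.completeSpace_coe

/-- Any `v ∈ Y` whose weak derivative belongs to `Y'` is in `X`. -/
theorem exists_toY_eq (v : P.Y) (f : StrongDual ℝ P.Y)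
    (h : ∀ φ : ℝ → ℝ, ContDiff ℝ (⊤ : ℕ∞) φ → HasCompactSupport φ → tsupport φ ⊆ Ioo 0 P.T →
      ∀ (z : V) (y : P.Y), (∀ᵐ t ∂(timeMeasure P.T), y t = φ t • z) →
      ∫ t, deriv φ t * inner ℝ (P.ι (v t)) (P.ι z) ∂(timeMeasure P.T) = -f y) :
    ∃ w : P.X, P.toY w = v ∧ P.dt w = f := by
  -- The Riesz representative of `f` in `L₂(I; V)`, mapped pointwise to `V'`, is the candidate for
  -- the weak derivative.
  let ρ : P.Y := (InnerProductSpace.toDual ℝ P.Y).symm f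
  have hρ : ∀ y, f y = ∫ t, inner ℝ (ρ t) (y t) ∂(timeMeasure P.T) := fun y => by
    rw [← L2.inner_def]
    exact InnerProductSpace.toDual_symm_apply.symm
  have mρ : MemLp (fun t => InnerProductSpace.toDual ℝ V (ρ t)) 2 (timeMeasure P.T) :=
    (Lp.memLp ρ).of_le
      ((InnerProductSpace.toDual ℝ V).continuous.comp_aestronglyMeasurable
        (Lp.aestronglyMeasurable _))
      (Filter.Eventually.of_forall fun t => ((InnerProductSpace.toDual ℝ V).norm_map _).le)
  refine ⟨⟨WithLp.toLp 2 (v, mρ.toLp _), fun φ hφ hc hs z => ?_⟩, rfl, ?_⟩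
  · have m1 : MemLp (fun t => φ t • z) 2 (timeMeasure P.T) :=
      memLp_of_continuous (hφ.continuous.smul continuous_const)
    have h1 := h φ hφ hc hs z (m1.toLp _) m1.coeFn_toLp
    refine h1.trans ?_
    rw [hρ]
    congr 1
    refine integral_congr_ae ?_
    filter_upwards [m1.coeFn_toLp, mρ.coeFn_toLp] with t e1 e2
    change _ = φ t * (mρ.toLp _ : L2 P.T (StrongDual ℝ V)) t z
    rw [e1, e2, real_inner_smul_right]
    rfl
  · ext y
    rw [dt_apply, hρ]
    refine integral_congr_ae ?_
    filter_upwards [mρ.coeFn_toLp] with t e2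
    change (mρ.toLp _ : L2 P.T (StrongDual ℝ V)) t _ = _
    rw [e2]
    rfl

end ParabolicProblem
end SpaceTime

namespace SpaceTime

/-! ### Riesz representatives and preconditioners -/

section RieszRepresentation

variable {F : Type*} {E : Type*} [NormedAddCommGroup F] [NormedSpace ℝ F]
  [NormedAddCommGroup E] [InnerProductSpace ℝ E] [CompleteSpace E]

/-- The Riesz representative of a functional on `F` in a Hilbert space `E` isomorphic to `F`. -/
noncomputable def rieszRep (J : F ≃L[ℝ] E) (f : StrongDual ℝ F) : E :=
  (InnerProductSpace.toDual ℝ E).symm (f.comp (J.symm : E →L[ℝ] F))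

theorem inner_rieszRep (J : F ≃L[ℝ] E) (f : StrongDual ℝ F) (v : F) :
    inner ℝ (rieszRep J f) (J v) = f v := by
  rw [rieszRep, InnerProductSpace.toDual_symm_apply]
  simp

theorem inner_rieszRep' (J : F ≃L[ℝ] E) (f : StrongDual ℝ F) (e : E) :
    inner ℝ (rieszRep J f) e = f (J.symm e) := by
  rw [← inner_rieszRep J, J.apply_symm_apply]

theorem rieszRep_unique (J : F ≃L[ℝ] E) {f : StrongDual ℝ F} {e : E}
    (h : ∀ v, inner ℝ e (J v) = f v) : rieszRep J f = e := by
  refine ext_inner_right ℝ fun x => ?_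
  rw [inner_rieszRep', ← h, J.apply_symm_apply]

theorem rieszRep_injective (J : F ≃L[ℝ] E) : Function.Injective (rieszRep J) := by
  intro f g h
  ext v
  rw [← inner_rieszRep J, h, inner_rieszRep]

/-- `rieszRep` as a bounded linear map. -/
noncomputable def rieszRepL (J : F ≃L[ℝ] E) : StrongDual ℝ F →L[ℝ] E :=
  LinearMap.mkContinuous
    { toFun := rieszRep J
      map_add' := fun f g => rieszRep_unique J fun v => by
        rw [inner_add_left, inner_rieszRep, inner_rieszRep]; rfl
      map_smul' := fun r f => rieszRep_unique J fun v => by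
        rw [RingHom.id_apply, real_inner_smul_left, inner_rieszRep]; rfl }
    ‖(J.symm : E →L[ℝ] F)‖ (fun f => by
      change ‖rieszRep J f‖ ≤ _
      rw [rieszRep, LinearIsometryEquiv.norm_map, mul_comm]
      exact ContinuousLinearMap.opNorm_comp_le _ _)

theorem rieszRepL_apply (J : F ≃L[ℝ] E) (f : StrongDual ℝ F) : rieszRepL J f = rieszRep J f := rfl

theorem exists_orthogonal_projection (J : F ≃L[ℝ] E) (Z : Submodule ℝ F)
    (hZ : IsClosed (Z : Set F)) (b : E) : ∃ v ∈ Z, ∀ z ∈ Z, inner ℝ (b - J v) (J z) = 0 := by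
  set K : Submodule ℝ E := Z.map (J : F →ₗ[ℝ] E) with hK
  have hcl : IsClosed (K : Set E) := by
    have : (K : Set E) = J '' (Z : Set F) := by rw [hK, Submodule.map_coe]; rfl
    rw [this]
    exact J.toHomeomorph.isClosedMap _ hZ
  obtain ⟨y, hy, hmin⟩ := K.exists_norm_eq_iInf_of_complete_subspace hcl.isComplete b
  obtain ⟨v, hv, rfl⟩ := hy
  refine ⟨v, hv, fun z hz => ?_⟩
  exact (K.norm_eq_iInf_iff_real_inner_eq_zero ⟨v, hv, rfl⟩).1 hmin _ ⟨z, hz, rfl⟩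

end RieszRepresentation

namespace Preconditioner

variable {E : Type*} [NormedAddCommGroup E] [NormedSpace ℝ E] (K : Preconditioner E)

theorem invForm_symm (x y : E) : K.invForm x y = K.invForm y x := by
  have := K.symm (K.toEquiv.symm x) (K.toEquiv.symm y)
  simpa [invForm] using this

theorem invForm_toEquiv (f : StrongDual ℝ E) (x : E) : K.invForm (K.toEquiv f) x = f x := by
  simp [invForm]

/-- Cauchy–Schwarz for a semidefinite form: the quadratic polynomial `r ↦ K⁻¹ (x + r y) (x + r y)`
is nonnegative, so its discriminant is not positive. -/
theorem invForm_mul_self_le (h : ∀ x, 0 ≤ K.invForm x x) (x y : E) :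
    K.invForm x y ^ 2 ≤ K.invForm x x * K.invForm y y := by
  have e : ∀ r : ℝ, K.invForm (x + r • y) (x + r • y)
      = K.invForm y y * (r * r) + 2 * K.invForm x y * r + K.invForm x x := by
    intro r
    have hs := K.invForm_symm y x
    simp only [invForm, map_add, map_smul, add_apply, smul_apply, smul_eq_mul] at hs ⊢
    rw [hs]; ring
  have := discrim_le_zero fun r => (e r) ▸ h (x + r • y)
  rw [discrim] at this
  nlinarith

end Preconditioner

/-! ### Dual norms, the inf-sup constant and discrete test spaces -/

namespace ParabolicProblem

variable {V : Type u} {H : Type v} [NormedAddCommGroup V] [InnerProductSpace ℝ V]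
  [NormedAddCommGroup H] [InnerProductSpace ℝ H] {P : ParabolicProblem V H}

section EnergyNorms

variable {EY : Type*} [NormedAddCommGroup EY] [InnerProductSpace ℝ EY]
  {J : P.Y ≃L[ℝ] EY} (hJ : ∀ x y, inner ℝ (J x) (J y) = P.A x y)

include hJ

theorem normY_eq (v : P.Y) : P.normY v = ‖J v‖ := by
  rw [normY, ← hJ, real_inner_self_eq_norm_sq, Real.sqrt_sq (norm_nonneg _)]

variable [CompleteSpace EY]

omit [CompleteSpace EY] in
theorem dualNorm_le_norm {Z : Submodule ℝ P.Y} {f : StrongDual ℝ P.Y} {p : EY}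
    (hp : ∀ v ∈ Z, inner ℝ p (J v) = f v) : P.dualNorm Z f ≤ ‖p‖ := by
  refine csSup_le ⟨_, 0, Z.zero_mem, rfl⟩ ?_
  rintro _ ⟨v, hv, rfl⟩
  change f v / P.normY v ≤ _
  rw [normY_eq hJ, ← hp v hv]
  exact div_le_of_le_mul₀ (norm_nonneg _) (norm_nonneg _) (real_inner_le_norm _ _)

/-- The supremum is attained at the Riesz representative itself. If that is zero, the quotient `0 /
0 = 0` still has the right value. -/
theorem normYDual_eq (f : StrongDual ℝ P.Y) : P.normYDual f = ‖rieszRep J f‖ := by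
  refine le_antisymm (dualNorm_le_norm hJ fun v _ => inner_rieszRep J f v) ?_
  refine le_csSup ⟨‖rieszRep J f‖, ?_⟩ ⟨J.symm (rieszRep J f), Submodule.mem_top, ?_⟩
  · rintro _ ⟨v, -, rfl⟩
    change f v / P.normY v ≤ _
    rw [normY_eq hJ, ← inner_rieszRep J]
    exact div_le_of_le_mul₀ (norm_nonneg _) (norm_nonneg _) (real_inner_le_norm _ _)
  · change f _ / P.normY _ = _
    rw [normY_eq hJ, J.apply_symm_apply, ← inner_rieszRep' J, real_inner_self_eq_norm_sq]
    rcases eq_or_ne ‖rieszRep J f‖ 0 with h | h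
    · simp [h]
    · field_simp

theorem rieszRep_B (w : P.X) :
    rieszRep J (P.B w) = rieszRep J (P.dt w) + J (P.toY w) :=
  rieszRep_unique J fun v => by
    rw [inner_add_left, inner_rieszRep, hJ]; rfl

end EnergyNorms

theorem exists_energyY (P : ParabolicProblem V H) [CompleteSpace V] :
    ∃ (E : Type u) (_ : NormedAddCommGroup E) (_ : InnerProductSpace ℝ E) (_ : CompleteSpace E)
      (J : P.Y ≃L[ℝ] E), ∀ x y, inner ℝ (J x) (J y) = P.A x y := by
  obtain ⟨α, hα, h⟩ := P.exists_A_coercive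
  exact exists_energySpace P.A P.A_symm hα h

theorem dualNorm_nonneg (Z : Submodule ℝ P.Y) (f : StrongDual ℝ P.Y) : 0 ≤ P.dualNorm Z f := by
  by_cases h : BddAbove ((fun v : P.Y => f v / P.normY v) '' (Z : Set P.Y))
  · exact le_csSup h ⟨0, Z.zero_mem, by simp⟩
  · rw [dualNorm, Real.sSup_of_not_bddAbove h]

namespace Discretization

variable (D : P.Discretization)

theorem bddBelow_infSup : BddBelow (insert (1 : ℝ) {r | ∃ δ, ∃ z ∈ D.X δ, P.dt z ≠ 0 ∧
    r = P.dualNorm (D.Y δ) (P.dt z) / P.normYDual (P.dt z)}) := by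
  refine ⟨0, ?_⟩
  rintro r (rfl | ⟨δ, z, -, -, rfl⟩)
  · exact zero_le_one
  · exact div_nonneg (dualNorm_nonneg _ _) (dualNorm_nonneg _ _)

theorem infSup_le_one : D.infSup ≤ 1 := csInf_le D.bddBelow_infSup (mem_insert _ _)

variable {D}

theorem infSup_mul_le {EY : Type*} [NormedAddCommGroup EY] [InnerProductSpace ℝ EY]
    [CompleteSpace EY] {J : P.Y ≃L[ℝ] EY} (hJ : ∀ x y, inner ℝ (J x) (J y) = P.A x y)
    {δ : D.Δ} {z : P.X} (hz : z ∈ D.X δ) :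
    D.infSup * ‖rieszRep J (P.dt z)‖ ≤ P.dualNorm (D.Y δ) (P.dt z) := by
  by_cases h : P.dt z = 0
  · have e : rieszRep J (P.dt z) = 0 := by rw [h]; exact map_zero (rieszRepL J)
    rw [e, norm_zero, mul_zero]
    exact dualNorm_nonneg _ _
  · have h1 : D.infSup ≤ P.dualNorm (D.Y δ) (P.dt z) / P.normYDual (P.dt z) :=
      csInf_le D.bddBelow_infSup (mem_insert_of_mem _ ⟨δ, z, hz, h, rfl⟩)
    rw [normYDual_eq hJ] at h1
    have hpos : 0 < ‖rieszRep J (P.dt z)‖ := by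
      refine norm_pos_iff.2 fun h0 => h (rieszRep_injective J ?_)
      rw [h0]; exact (map_zero (rieszRepL J)).symm
    exact (le_div_iff₀ hpos).1 h1

/-- The discrete trial-to-test map is a perturbation of the ideal one. -/
theorem norm_discrete_riesz_sub_le {EY : Type*} [NormedAddCommGroup EY] [InnerProductSpace ℝ EY]
    [CompleteSpace EY] {J : P.Y ≃L[ℝ] EY} (hJ : ∀ x y, inner ℝ (J x) (J y) = P.A x y)
    {κ q : ℝ} (hγ : 0 < D.infSup) (hκ : 1 ≤ κ) (hK : D.KYBound κ) (hq : κ / D.infSup - 1 = q)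
    (hq1 : q ≤ 1) {δ : D.Δ} {z : P.X} (hz : z ∈ D.X δ) {N : ℝ}
    (hN1 : ‖rieszRep J (P.dt z)‖ ≤ N) (hN2 : ‖rieszRep J (P.B z)‖ ≤ N) :
    ‖J ((D.KY δ).toEquiv ((P.B z).comp (D.Y δ).subtypeL) : P.Y) - rieszRep J (P.B z)‖
      ≤ 4 * Real.sqrt q * N := by
  have hγ1 := D.infSup_le_one
  set γ := D.infSup with hγdef
  have hN : 0 ≤ N := (norm_nonneg _).trans hN1
  -- Since `γ ≤ 1 ≤ κ`, the single quantity `q` controls both defects: `κ - 1 ≤ q`, and `1 - γ ≤ q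
  -- γ`, whence `1 - γ² ≤ 2 q`.
  have hκγ : κ = (1 + q) * γ := by rw [← hq]; field_simp; ring
  have hκq : κ ≤ 1 + q := by
    rw [hκγ]
    have : 0 ≤ 1 + q := by
      by_contra h
      have := mul_neg_of_neg_of_pos (not_le.1 h) hγ
      linarith
    nlinarith
  have hq0 : 0 ≤ q := by linarith
  have hγq : 1 - γ ^ 2 ≤ 2 * q := by nlinarith
  set k := (D.KY δ).toEquiv ((P.B z).comp (D.Y δ).subtypeL) with hk
  set b := rieszRep J (P.B z) with hb
  set d := rieszRep J (P.dt z) with hd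
  obtain ⟨v, hv, hort⟩ := exists_orthogonal_projection J (D.Y δ) (D.Y_closed δ) b
  have hbv : ∀ y ∈ D.Y δ, inner ℝ (J v) (J y) = P.B z y := fun y hy => by
    have := hort y hy
    rw [inner_sub_left, inner_rieszRep] at this
    linarith
  have hbd : b = d + J (P.toY z) := rieszRep_B hJ z
  have hzY : P.toY z ∈ D.Y δ := D.X_le_Y δ z hz
  -- distance of `b` to the discrete test space
  have h1 : ‖b - J v‖ ^ 2 ≤ 2 * q * N ^ 2 := by
    -- As `z` itself lies in the test space, projecting `b` only affects its part `d`, which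
    -- represents `∂ₜ z`. The projection of `d` is `J (v - z)`, and the inf-sup condition says that
    -- it retains at least the fraction `γ` of the norm. Pythagoras bounds what is lost.
    have e : d = (b - J v) + J (v - P.toY z) := by rw [hbd, map_sub]; abel
    have hpd : D.infSup * ‖d‖ ≤ ‖J (v - P.toY z)‖ := by
      refine (infSup_mul_le hJ hz).trans (dualNorm_le_norm hJ fun y hy => ?_)
      have := hort y hy
      rw [map_sub, inner_sub_left, hbv y hy, hJ]
      change P.dt z y + P.A (P.toY z) y - P.A (P.toY z) y = _
      ring
    have hpy : ‖d‖ ^ 2 = ‖b - J v‖ ^ 2 + ‖J (v - P.toY z)‖ ^ 2 := by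
      conv_lhs => rw [e]
      rw [← real_inner_self_eq_norm_sq, inner_add_left, inner_add_right, inner_add_right,
        real_inner_comm (b - J v) (J (v - P.toY z)),
        hort _ ((D.Y δ).sub_mem hv hzY), real_inner_self_eq_norm_sq, real_inner_self_eq_norm_sq]
      ring
    have h2 : γ ^ 2 * ‖d‖ ^ 2 ≤ ‖J (v - P.toY z)‖ ^ 2 := by
      rw [← mul_pow]
      exact pow_le_pow_left₀ (by positivity) hpd 2
    have h3 : ‖d‖ ^ 2 ≤ N ^ 2 := pow_le_pow_left₀ (norm_nonneg _) hN1 2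
    calc ‖b - J v‖ ^ 2 ≤ (1 - γ ^ 2) * ‖d‖ ^ 2 := by linarith
      _ ≤ 2 * q * ‖d‖ ^ 2 := by gcongr
      _ ≤ 2 * q * N ^ 2 := by gcongr
  have h2 : ‖J v‖ ≤ N := by
    refine le_trans ?_ hN2
    have : ‖J v‖ ^ 2 ≤ ‖b‖ * ‖J v‖ := by
      have h := hort v hv
      rw [inner_sub_left, real_inner_self_eq_norm_sq] at h
      have := real_inner_le_norm b (J v)
      linarith
    by_contra hlt
    nlinarith [norm_nonneg b, norm_nonneg (J v)]
  -- effect of the preconditioner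
  have hform : ∀ y : D.Y δ, (D.KY δ).invForm k y = inner ℝ (J v) (J y) := fun y => by
    rw [hk, Preconditioner.invForm_toEquiv, hbv y y.2]; rfl
  have hA : ∀ y : P.Y, P.A y y = ‖J y‖ ^ 2 := fun y => by
    rw [← hJ, real_inner_self_eq_norm_sq]
  have hκpos : 0 < κ := by linarith
  have hpos : ∀ y : D.Y δ, 0 ≤ (D.KY δ).invForm y y := fun y => by
    refine le_trans ?_ (hK δ y).1
    rw [hA]; positivity
  -- The preconditioned solution `k` satisfies `K⁻¹ k = ⟨J v, J ·⟩`, so `τ = ⟨J v, J k⟩`. Spectral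
  -- equivalence bounds both `‖J k‖²` and `‖J v‖²` by `κ τ`. Expanding the square then gives `‖J k -
  -- J v‖² ≤ 2 (κ - 1) τ`.
  set τ := (D.KY δ).invForm k k with hτ
  have hτ1 : ‖J k‖ ^ 2 ≤ κ * τ := by
    have := (hK δ k).1
    rw [hA, inv_mul_le_iff₀ hκpos] at this
    exact this
  have hτ2 : τ = inner ℝ (J v) (J k) := hform k
  have hτ0 : 0 ≤ τ := hpos k
  have hp : ‖J v‖ ^ 2 ≤ κ * τ := by
    have c1 := (D.KY δ).invForm_mul_self_le hpos k ⟨v, hv⟩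
    have c2 := (hK δ ⟨v, hv⟩).2
    rw [hform] at c1
    change inner ℝ (J v) (J v) ^ 2 ≤ _ at c1
    rw [real_inner_self_eq_norm_sq] at c1
    change _ ≤ κ * P.A v v at c2
    rw [hA] at c2
    have c3 : ‖J v‖ ^ 2 * ‖J v‖ ^ 2 ≤ κ * τ * ‖J v‖ ^ 2 := by
      nlinarith [mul_le_mul_of_nonneg_left c2 hτ0]
    rcases eq_or_ne (‖J v‖ ^ 2) 0 with h0 | h0
    · rw [h0]; positivity
    · exact le_of_mul_le_mul_right c3 (lt_of_le_of_ne (sq_nonneg _) (Ne.symm h0))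
  have hτN : τ ≤ κ * N ^ 2 := by
    have c1 : τ ^ 2 ≤ ‖J v‖ ^ 2 * ‖J k‖ ^ 2 := by
      rw [← mul_pow]
      refine pow_le_pow_left₀ hτ0 ?_ 2
      rw [hτ2]; exact real_inner_le_norm _ _
    have c2 : ‖J v‖ ^ 2 ≤ N ^ 2 := pow_le_pow_left₀ (norm_nonneg _) h2 2
    have c3 : τ * τ ≤ κ * N ^ 2 * τ := by
      have := mul_le_mul c2 hτ1 (sq_nonneg _) (sq_nonneg N)
      nlinarith
    rcases eq_or_ne τ 0 with h0 | h0
    · rw [h0]; positivity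
    · exact le_of_mul_le_mul_right c3 (lt_of_le_of_ne hτ0 (Ne.symm h0))
  have h3 : ‖J k - J v‖ ^ 2 ≤ 4 * q * N ^ 2 := by
    have e : ‖J k - J v‖ ^ 2 = ‖J k‖ ^ 2 - 2 * τ + ‖J v‖ ^ 2 := by
      rw [norm_sub_sq_real, hτ2, real_inner_comm]
    have c1 : ‖J k - J v‖ ^ 2 ≤ 2 * (κ - 1) * τ := by rw [e]; linarith
    have c2 : 2 * (κ - 1) * τ ≤ 2 * (κ - 1) * (κ * N ^ 2) :=
      mul_le_mul_of_nonneg_left hτN (by linarith)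
    have c3 : 2 * (κ - 1) * κ ≤ 4 * q := by nlinarith
    have c4 := mul_le_mul_of_nonneg_right c3 (sq_nonneg N)
    linarith
  have hsq : Real.sqrt q ^ 2 = q := Real.sq_sqrt hq0
  have h4 : ‖J k - J v‖ ≤ 2 * Real.sqrt q * N := by
    refine le_of_sq_le_sq ?_ (by positivity)
    rw [mul_pow, mul_pow, hsq]; linarith
  have h5 : ‖J v - b‖ ≤ 2 * Real.sqrt q * N := by
    rw [norm_sub_rev]
    refine le_of_sq_le_sq ?_ (by positivity)
    rw [mul_pow, mul_pow, hsq]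
    have : 0 ≤ q * N ^ 2 := by positivity
    linarith
  have h6 : J k - b = (J k - J v) + (J v - b) := by abel
  rw [h6]
  exact (norm_add_le _ _).trans (by linarith)

end Discretization

end ParabolicProblem
end SpaceTime

/-! ### The parabolic operator as an isometric isomorphism -/

namespace SpaceTime
namespace ParabolicProblem

variable {V : Type u} {H : Type v} [NormedAddCommGroup V] [InnerProductSpace ℝ V] [CompleteSpace V]
  [NormedAddCommGroup H] [InnerProductSpace ℝ H] [CompleteSpace H] (P : ParabolicProblem V H)

omit [CompleteSpace V] [CompleteSpace H] in
theorem zero_mem_Icc : (0 : ℝ) ∈ Icc 0 P.T := ⟨le_rfl, P.T_pos.le⟩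

/-- The map `w ↦ w` from `X` to `Y`, the time derivative, `B` and the traces as bounded maps. -/
noncomputable def toYL : P.X →L[ℝ] P.Y :=
  LinearMap.mkContinuous ⟨⟨P.toY, P.toY_add⟩, P.toY_smul⟩ 1 fun w => by
    rw [one_mul]; exact P.norm_toY_le w

noncomputable def sndL : P.X →L[ℝ] L2 P.T (StrongDual ℝ V) :=
  LinearMap.mkContinuous ⟨⟨fun w => w.1.snd, fun _ _ => rfl⟩, fun _ _ => rfl⟩ 1 fun w => by
    rw [one_mul]; exact P.norm_snd_le w

noncomputable def dtL : P.X →L[ℝ] StrongDual ℝ P.Y :=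
  ((ContinuousLinearMap.id ℝ (StrongDual ℝ V)).lpPairing (timeMeasure P.T) 2 2).comp P.sndL

noncomputable def BL : P.X →L[ℝ] StrongDual ℝ P.Y := P.dtL + P.A.comp P.toYL

noncomputable def traceL : P.X →L[ℝ] H :=
  LinearMap.mkContinuous ⟨⟨P.trace 0, P.trace_add P.zero_mem_Icc⟩, P.trace_smul P.zero_mem_Icc⟩
    P.exists_norm_trace_le.choose (P.exists_norm_trace_le.choose_spec 0 P.zero_mem_Icc)

section Energy

variable {EY : Type*} [NormedAddCommGroup EY] [InnerProductSpace ℝ EY] [CompleteSpace EY]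

/-- The map `w ↦ (B w, γ₀ w)`, with `Y'` identified with a Hilbert space. -/
noncomputable def operatorMap (J : P.Y ≃L[ℝ] EY) : P.X →L[ℝ] WithLp 2 (EY × H) :=
  ((WithLp.prodContinuousLinearEquiv 2 ℝ EY H).symm : EY × H →L[ℝ] WithLp 2 (EY × H)).comp
    (((rieszRepL J).comp P.BL).prod P.traceL)

theorem operatorMap_apply (J : P.Y ≃L[ℝ] EY) (w : P.X) :
    P.operatorMap J w = WithLp.toLp 2 (rieszRep J (P.B w), P.trace 0 w) := rfl

theorem inner_operatorMap (J : P.Y ≃L[ℝ] EY) (w z : P.X) :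
    inner ℝ (P.operatorMap J w) (P.operatorMap J z)
      = inner ℝ (rieszRep J (P.B w)) (rieszRep J (P.B z))
        + inner ℝ (P.trace 0 w) (P.trace 0 z) := rfl

variable {P} {J : P.Y ≃L[ℝ] EY} (hJ : ∀ x y, inner ℝ (J x) (J y) = P.A x y)

include hJ

/-- Expanding `‖B w‖²` produces the cross term `2 (∂ₜ w)(w)`, which integration by parts evaluates
as `‖γ_T w‖² - ‖γ₀ w‖²`. The initial trace cancels and the terminal one remains; this explains the
energy norm on `X`. -/
theorem norm_operatorMap_sq (w : P.X) : ‖P.operatorMap J w‖ ^ 2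
    = ‖J (P.toY w)‖ ^ 2 + ‖rieszRep J (P.dt w)‖ ^ 2 + ‖P.trace P.T w‖ ^ 2 := by
  rw [← real_inner_self_eq_norm_sq, inner_operatorMap, rieszRep_B hJ, inner_add_left,
    inner_add_right, inner_add_right, real_inner_comm (rieszRep J (P.dt w)) (J (P.toY w)),
    inner_rieszRep, real_inner_self_eq_norm_sq, real_inner_self_eq_norm_sq]
  have := P.inner_trace_T_sub w w
  rw [real_inner_self_eq_norm_sq] at this
  linarith

theorem norm_operatorMap (w : P.X) : ‖P.operatorMap J w‖ = P.normX w := by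
  rw [normX, normY_eq hJ, normYDual_eq hJ, ← norm_operatorMap_sq hJ, Real.sqrt_sq (norm_nonneg _)]

omit hJ [CompleteSpace H] in
-- Testing `∂ₜ w` with its own pointwise Riesz representative in `L₂(I; V)` yields the square of its
-- canonical norm. This compares the canonical norm of the derivative with its energy dual norm.
theorem norm_snd_le_norm_rieszRep (w : P.X) :
    ‖w.1.snd‖ ≤ ‖(J : P.Y →L[ℝ] EY)‖ * ‖rieszRep J (P.dt w)‖ := by
  set r : P.Y := (P.memLp_rieszDeriv w).toLp _ with hr
  have hn : ‖r‖ = ‖w.1.snd‖ := by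
    rw [hr, Lp.norm_toLp, Lp.norm_def]
    congr 1
    exact eLpNorm_congr_norm_ae (Filter.Eventually.of_forall fun t => P.norm_rieszDeriv w t)
  have h1 : P.dt w r = ‖r‖ ^ 2 := by
    rw [dt_apply, ← real_inner_self_eq_norm_sq, L2.inner_def]
    refine integral_congr_ae ?_
    filter_upwards [(P.memLp_rieszDeriv w).coeFn_toLp] with t ht
    rw [← P.inner_rieszDeriv, ht]
  have h2 : P.dt w r ≤ ‖rieszRep J (P.dt w)‖ * (‖(J : P.Y →L[ℝ] EY)‖ * ‖r‖) := by
    rw [← inner_rieszRep J]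
    exact (real_inner_le_norm _ _).trans
      (mul_le_mul_of_nonneg_left ((J : P.Y →L[ℝ] EY).le_opNorm r) (norm_nonneg _))
  rw [← hn]
  rcases eq_or_ne ‖r‖ 0 with h0 | h0
  · rw [h0]; positivity
  · refine le_of_mul_le_mul_right ?_ (lt_of_le_of_ne (norm_nonneg r) (Ne.symm h0))
    rw [h1] at h2
    linarith

/-- The energy norm dominates the canonical norm of `X`, so the operator is injective with closed
range; only density of the range is left for bijectivity. -/
theorem antilipschitz_operatorMap : ∃ c, AntilipschitzWith c (P.operatorMap J) := by
  set C₁ := ‖(J.symm : EY →L[ℝ] P.Y)‖ with hC₁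
  set C₂ := ‖(J : P.Y →L[ℝ] EY)‖ with hC₂
  have h0 : 0 ≤ C₁ + C₂ := by positivity
  refine ⟨⟨C₁ + C₂, h0⟩, ContinuousLinearMap.antilipschitz_of_bound _ fun w => ?_⟩
  have hsq := norm_operatorMap_sq hJ w
  set N := ‖P.operatorMap J w‖
  have hN : 0 ≤ N := norm_nonneg _
  have b1 : ‖J (P.toY w)‖ ≤ N := le_of_sq_le_sq
    (by nlinarith [sq_nonneg ‖rieszRep J (P.dt w)‖, sq_nonneg ‖P.trace P.T w‖]) hN
  have b2 : ‖rieszRep J (P.dt w)‖ ≤ N := le_of_sq_le_sq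
    (by nlinarith [sq_nonneg ‖J (P.toY w)‖, sq_nonneg ‖P.trace P.T w‖]) hN
  have a1 : ‖P.toY w‖ ≤ C₁ * N := by
    have := (J.symm : EY →L[ℝ] P.Y).le_opNorm (J (P.toY w))
    simp only [ContinuousLinearEquiv.coe_coe, ContinuousLinearEquiv.symm_apply_apply] at this
    exact this.trans (mul_le_mul_of_nonneg_left b1 (norm_nonneg _))
  have a2 : ‖w.1.snd‖ ≤ C₂ * N := (norm_snd_le_norm_rieszRep w).trans
    (mul_le_mul_of_nonneg_left b2 (norm_nonneg (J : P.Y →L[ℝ] EY)))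
  have e : ‖w‖ ^ 2 = ‖P.toY w‖ ^ 2 + ‖w.1.snd‖ ^ 2 := WithLp.prod_norm_sq_eq_of_L2 w.1
  change ‖w‖ ≤ (C₁ + C₂) * N
  refine le_trans ?_ ((add_le_add a1 a2).trans (le_of_eq (add_mul _ _ _).symm))
  refine le_of_sq_le_sq ?_ (by positivity)
  rw [e]
  nlinarith [norm_nonneg (P.toY w), norm_nonneg w.1.snd]

omit [CompleteSpace EY] in
/-- The only pair annihilated by the range of `w ↦ (B w, γ₀ w)` is zero. -/
theorem eq_zero_of_forall_B_add (v : P.Y) (h : H)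
    (hv : ∀ w : P.X, P.B w v + inner ℝ (P.trace 0 w) h = 0) : v = 0 ∧ h = 0 := by
  have hT := P.zero_mem_Icc
  have hTT : P.T ∈ Icc 0 P.T := ⟨P.T_pos.le, le_rfl⟩
  -- Testing with `φ ⊗ z` for `φ` compactly supported in `(0, T)` shows that `v` has the weak
  -- derivative `A v`. Hence `v` belongs to `X` and solves a homogeneous backward problem.
  obtain ⟨z, rfl, hdt⟩ := P.exists_toY_eq v (P.A v) fun φ hφ hc hs z y hy => by
    obtain ⟨w, hw1, hw2, hw3⟩ := P.exists_tensor hφ z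
    have hφ0 : φ 0 = 0 := image_eq_zero_of_notMem_tsupport fun h => lt_irrefl _ (hs h).1
    have key := hv w
    have hwy : P.toY w = y := Lp.ext (by
      filter_upwards [hw1, hy] with t h1 h2; rw [h1, h2])
    rw [hw3 0 hT, hφ0, zero_smul, inner_zero_left, add_zero, B, add_apply, hwy, P.A_symm y v,
      dt_apply] at key
    rw [← eq_neg_of_add_eq_zero_left key]
    refine integral_congr_ae ?_
    filter_upwards [hw2] with t ht
    rw [ht, real_inner_comm]
  -- Now that `v` is in `X`, integration by parts leaves only boundary terms. The test functions `t
  -- y` and `1 · y` isolate the terminal and the initial one.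
  have hrel : ∀ w : P.X, inner ℝ (P.trace P.T w) (P.trace P.T z)
      - inner ℝ (P.trace 0 w) (P.trace 0 z) + inner ℝ (P.trace 0 w) h = 0 := by
    intro w
    have h1 := hv w
    have h2 := P.inner_trace_T_sub w z
    rw [hdt, P.A_symm] at h2
    rw [h2]
    exact h1
  have hdense : ∀ x : H, (∀ y : V, inner ℝ (P.ι y) x = 0) → x = 0 := by
    intro x hx
    exact P.ι_dense.eq_zero_of_inner_right ℝ hx
  have htrT : P.trace P.T z = 0 := by
    refine hdense _ fun y => ?_
    obtain ⟨w, -, -, hw3⟩ := P.exists_tensor (φ := fun t => t) contDiff_id y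
    have key := hrel w
    rw [hw3 0 hT, hw3 P.T hTT, zero_smul, inner_zero_left, inner_zero_left, sub_zero, add_zero,
      real_inner_smul_left] at key
    exact (mul_eq_zero.1 key).resolve_left P.T_pos.ne'
  have htr0 : h = P.trace 0 z := by
    rw [← sub_eq_zero]
    refine hdense _ fun y => ?_
    obtain ⟨w, -, -, hw3⟩ := P.exists_tensor (φ := fun _ => 1) contDiff_const y
    have key := hrel w
    rw [htrT, inner_zero_right, hw3 0 hT, one_smul] at key
    rw [inner_sub_right]
    linarith
  -- With vanishing terminal value, integration by parts of `z` against itself reads `2 ‖z‖_Y² =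
  -- -‖γ₀ z‖²`.
  have hzero : ‖J (P.toY z)‖ ^ 2 ≤ 0 := by
    have h2 := P.inner_trace_T_sub z z
    rw [hdt, htrT, inner_zero_right, ← hJ, real_inner_self_eq_norm_sq,
      real_inner_self_eq_norm_sq] at h2
    nlinarith [sq_nonneg ‖P.trace 0 z‖]
  have hz0 : P.toY z = 0 := by
    have h1 : ‖J (P.toY z)‖ = 0 :=
      pow_eq_zero_iff two_ne_zero |>.1 (le_antisymm hzero (sq_nonneg _))
    exact (map_eq_zero_iff J J.injective).1 (norm_eq_zero.1 h1)
  refine ⟨hz0, ?_⟩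
  have h2 := P.inner_trace_T_sub z z
  rw [hz0, map_zero, htrT, inner_zero_right, real_inner_self_eq_norm_sq] at h2
  have h3 : ‖P.trace 0 z‖ = 0 := by
    refine pow_eq_zero_iff two_ne_zero |>.1 ?_
    linarith
  rw [htr0]
  exact norm_eq_zero.1 h3

theorem bijective_operatorMap : Function.Bijective (P.operatorMap J) := by
  rw [ContinuousLinearMap.bijective_iff_dense_range_and_antilipschitz]
  refine ⟨?_, antilipschitz_operatorMap hJ⟩
  rw [Submodule.topologicalClosure_eq_top_iff, Submodule.eq_bot_iff]
  intro e he
  obtain ⟨h1, h2⟩ := eq_zero_of_forall_B_add hJ (J.symm e.fst) e.snd fun w => by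
    have := (Submodule.mem_orthogonal _ _).1 he (P.operatorMap J w) ⟨w, rfl⟩
    rw [← inner_rieszRep' J]
    exact this
  have h3 : e.fst = 0 := (map_eq_zero_iff J.symm J.symm.injective).1 h1
  exact (WithLp.ofLp_injective 2) (Prod.ext h3 h2)

end Energy

/-- The parabolic operator identifies `X`, with its energy norm, with a Hilbert space in which the
forms `S^δ` of the discretizations are small perturbations of the inner product. -/
theorem exists_hilbert_model : ∃ (E : Type (max u v)) (_ : NormedAddCommGroup E)
    (_ : InnerProductSpace ℝ E) (_ : CompleteSpace E) (J : P.X ≃L[ℝ] E),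
    (∀ w, ‖J w‖ = P.normX w) ∧
    (∀ g u₀, ∃ u, P.IsSolution g u₀ u) ∧
    (∀ g u₀ u g' u₀' u', P.IsSolution g u₀ u → P.IsSolution g' u₀' u' →
      ‖J (u - u')‖ ≤ P.normYDual (g - g') + ‖u₀ - u₀'‖) ∧
    ∀ (D : Discretization.{u, v, w} P) (κ q : ℝ), 0 < D.infSup → 1 ≤ κ → D.KYBound κ →
      κ / D.infSup - 1 = q → q ≤ 1 → ∀ δ, ∀ z ∈ D.X δ, ∀ w,
      |D.S δ w z - inner ℝ (J w) (J z)| ≤ 4 * Real.sqrt q * ‖J w‖ * ‖J z‖ := by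
  obtain ⟨EY, _, _, _, J, hJ⟩ := P.exists_energyY
  have hb := bijective_operatorMap hJ
  refine ⟨WithLp 2 (EY × H), inferInstance, inferInstance, inferInstance,
    ContinuousLinearEquiv.ofBijective (P.operatorMap J)
      (LinearMap.ker_eq_bot.2 hb.1) (LinearMap.range_eq_top.2 hb.2), fun w => ?_, fun g u₀ => ?_,
    ?_, ?_⟩
  · exact norm_operatorMap hJ w
  · obtain ⟨u, hu⟩ := hb.2 (WithLp.toLp 2 (rieszRep J g, u₀))
    rw [operatorMap_apply] at hu
    have hu' := Prod.ext_iff.1 ((WithLp.toLp_injective 2) hu)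
    exact ⟨u, rieszRep_injective J hu'.1, hu'.2⟩
  · intro g u₀ u g' u₀' u' h h'
    change ‖P.operatorMap J (u - u')‖ ≤ _
    have e : P.operatorMap J (u - u') = WithLp.toLp 2 (rieszRep J (g - g'), u₀ - u₀') := by
      rw [map_sub, operatorMap_apply, operatorMap_apply, h.1, h.2, h'.1, h'.2,
        ← rieszRepL_apply J (g - g'), map_sub]
      rfl
    have h2 := WithLp.prod_norm_sq_eq_of_L2
      (WithLp.toLp 2 (rieszRep J (g - g'), u₀ - u₀') : WithLp 2 (EY × H))
    rw [e, normYDual_eq hJ]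
    refine le_of_sq_le_sq ?_ (by positivity)
    rw [h2]
    change ‖rieszRep J (g - g')‖ ^ 2 + ‖u₀ - u₀'‖ ^ 2 ≤ _
    nlinarith [norm_nonneg (rieszRep J (g - g')), norm_nonneg (u₀ - u₀')]
  · intro D κ q hγ hκ hK hq hq1 δ z hz w
    change |D.S δ w z - inner ℝ (P.operatorMap J w) (P.operatorMap J z)|
      ≤ 4 * Real.sqrt q * ‖P.operatorMap J w‖ * ‖P.operatorMap J z‖
    have hN1 : ‖rieszRep J (P.dt z)‖ ≤ ‖P.operatorMap J z‖ := by
      refine le_of_sq_le_sq ?_ (norm_nonneg _)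
      rw [norm_operatorMap_sq hJ]
      nlinarith [sq_nonneg ‖J (P.toY z)‖, sq_nonneg ‖P.trace P.T z‖]
    have hN2 : ∀ w, ‖rieszRep J (P.B w)‖ ≤ ‖P.operatorMap J w‖ := by
      intro w
      refine le_of_sq_le_sq ?_ (norm_nonneg _)
      rw [← real_inner_self_eq_norm_sq (P.operatorMap J w), inner_operatorMap,
        real_inner_self_eq_norm_sq, real_inner_self_eq_norm_sq]
      nlinarith [sq_nonneg ‖P.trace 0 w‖]
    have h1 := Discretization.norm_discrete_riesz_sub_le hJ hγ hκ hK hq hq1 hz hN1 (hN2 z)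
    have e : D.S δ w z - inner ℝ (P.operatorMap J w) (P.operatorMap J z)
        = inner ℝ (rieszRep J (P.B w))
          (J ((D.KY δ).toEquiv ((P.B z).comp (D.Y δ).subtypeL) : P.Y) - rieszRep J (P.B z)) := by
      -- Symmetry of the preconditioner moves the discrete trial-to-test map from `w` to `z`. Only
      -- `z` has to be a discrete function; `w` may be any element of `X`.
      have hs : P.B z ((D.KY δ).toEquiv ((P.B w).comp (D.Y δ).subtypeL))
          = P.B w ((D.KY δ).toEquiv ((P.B z).comp (D.Y δ).subtypeL)) :=
        (D.KY δ).symm ((P.B z).comp (D.Y δ).subtypeL) ((P.B w).comp (D.Y δ).subtypeL)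
      rw [Discretization.S, inner_operatorMap, inner_sub_right, inner_rieszRep]
      rw [hs]
      ring
    rw [e]
    refine (abs_real_inner_le_norm _ _).trans ?_
    calc _ ≤ ‖P.operatorMap J w‖ * (4 * Real.sqrt q * ‖P.operatorMap J z‖) :=
          mul_le_mul (hN2 w) h1 (norm_nonneg _) (norm_nonneg _)
      _ = _ := by ring

end ParabolicProblem
end SpaceTime

namespace SpaceTime

/-! ### Galerkin approximation with a perturbed inner product -/

section PerturbedGalerkin

variable {X : Type*} {E : Type*} [NormedAddCommGroup X] [NormedSpace ℝ X]
  [NormedAddCommGroup E] [InnerProductSpace ℝ E] [CompleteSpace E]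
  {J : X ≃L[ℝ] E} {s : X →ₗ[ℝ] X →ₗ[ℝ] ℝ} {Z : Submodule ℝ X} {σ : ℝ}
  (hs : ∀ w, ∀ z ∈ Z, |s w z - inner ℝ (J w) (J z)| ≤ σ * ‖J w‖ * ‖J z‖)

theorem exists_bestApprox (J : X ≃L[ℝ] E) (hZ : IsClosed (Z : Set X)) (e : X) :
    ∃ p ∈ Z, (∀ z ∈ Z, inner ℝ (J (e - p)) (J z) = 0) ∧
      ∀ x ∈ Z, ‖J (e - x)‖ ^ 2 = ‖J (e - p)‖ ^ 2 + ‖J (p - x)‖ ^ 2 := by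
  obtain ⟨p, hp, h⟩ := exists_orthogonal_projection J Z hZ (J e)
  have h' : ∀ z ∈ Z, inner ℝ (J (e - p)) (J z) = 0 := fun z hz => by rw [map_sub]; exact h z hz
  refine ⟨p, hp, h', fun x hx => ?_⟩
  have e1 : J (e - x) = J (e - p) + J (p - x) := by rw [← map_add, sub_add_sub_cancel]
  rw [e1, norm_add_sq_real, h' _ (Z.sub_mem hp hx)]
  ring

include hs

omit [CompleteSpace E] in
theorem abs_form_le (w z : X) (hz : z ∈ Z) : |s w z| ≤ (1 + σ) * ‖J w‖ * ‖J z‖ := by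
  have h1 := abs_le.1 (hs w z hz)
  have h2 := abs_le.1 (abs_real_inner_le_norm (J w) (J z))
  rw [abs_le]
  constructor <;> linarith [h1.1, h1.2, h2.1, h2.2]

omit [CompleteSpace E] in
theorem le_form_self (z : X) (hz : z ∈ Z) : (1 - σ) * ‖J z‖ ^ 2 ≤ s z z := by
  have h1 := abs_le.1 (hs z z hz)
  rw [real_inner_self_eq_norm_sq] at h1
  linarith [h1.1]

omit [CompleteSpace E] in
-- For `σ < 1` the perturbed form is symmetric, bounded and coercive on `Z`, so it is an inner
-- product there and the Riesz theorem applies to `s e`.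
theorem exists_galerkin [CompleteSpace X] (hsym : ∀ w z, s w z = s z w) (hσ0 : 0 ≤ σ) (hσ : σ < 1)
    (hZ : IsClosed (Z : Set X)) (e : X) : ∃ p ∈ Z, ∀ z ∈ Z, s (e - p) z = 0 := by
  have hnJ : ∀ x : X, ‖J x‖ ≤ ‖(J : X →L[ℝ] E)‖ * ‖x‖ := (J : X →L[ℝ] E).le_opNorm
  have hnJ' : ∀ x : X, ‖x‖ ≤ (‖(J.symm : E →L[ℝ] X)‖ + 1) * ‖J x‖ := fun x => by
    have := (J.symm : E →L[ℝ] X).le_opNorm (J x)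
    simp only [ContinuousLinearEquiv.coe_coe, ContinuousLinearEquiv.symm_apply_apply] at this
    linarith [norm_nonneg (J x)]
  set c := ‖(J.symm : E →L[ℝ] X)‖ + 1 with hc
  have hcpos : 0 < c := by positivity
  have : CompleteSpace Z := hZ.completeSpace_coe
  let b : Z →L[ℝ] Z →L[ℝ] ℝ := LinearMap.mkContinuousOfExistsBound₂
    (s.compl₁₂ Z.subtype Z.subtype) ⟨(1 + σ) * ‖(J : X →L[ℝ] E)‖ ^ 2, fun w z => by
      change |s w z| ≤ _
      refine (abs_form_le hs _ _ z.2).trans ?_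
      calc (1 + σ) * ‖J w‖ * ‖J z‖
          ≤ (1 + σ) * (‖(J : X →L[ℝ] E)‖ * ‖w‖) * (‖(J : X →L[ℝ] E)‖ * ‖z‖) := by
            gcongr
            · exact hnJ w
            · exact hnJ z
        _ = _ := by ring⟩
  obtain ⟨E', _, _, _, J', hJ'⟩ := exists_energySpace b (fun w z => hsym w z)
    (α := (1 - σ) / c ^ 2) (by have := sub_pos.2 hσ; positivity) (fun z => by
      refine le_trans ?_ (le_form_self hs z z.2)
      rw [div_mul_eq_mul_div, div_le_iff₀ (by positivity)]
      have h1 : ‖z‖ ^ 2 ≤ (c * ‖J z‖) ^ 2 := pow_le_pow_left₀ (norm_nonneg _) (hnJ' z) 2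
      nlinarith [mul_le_mul_of_nonneg_left h1 (sub_pos.2 hσ).le])
  let f : StrongDual ℝ Z := LinearMap.mkContinuous ((s e).comp Z.subtype)
    ((1 + σ) * ‖J e‖ * ‖(J : X →L[ℝ] E)‖) fun z => by
      change |s e z| ≤ _
      refine (abs_form_le hs _ _ z.2).trans ?_
      rw [mul_assoc _ ‖(J : X →L[ℝ] E)‖]
      gcongr
      exact hnJ z
  refine ⟨(J'.symm (rieszRep J' f) : Z), SetLike.coe_mem _, fun z hz => ?_⟩
  have h1 := inner_rieszRep J' f ⟨z, hz⟩
  have h2 := hJ' (J'.symm (rieszRep J' f)) ⟨z, hz⟩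
  rw [J'.apply_symm_apply] at h2
  rw [map_sub, LinearMap.sub_apply, sub_eq_zero]
  exact h1.symm.trans h2

/-- The Galerkin solution is a best approximation up to second order in the perturbation. -/
theorem norm_sub_galerkin_le (hσ0 : 0 ≤ σ) (hσ : σ ≤ 1 / 2) (hZ : IsClosed (Z : Set X)) {e p : X}
    (hp : p ∈ Z) (hgal : ∀ z ∈ Z, s (e - p) z = 0) {x : X} (hx : x ∈ Z) :
    ‖J (e - p)‖ ≤ (1 + 2 * σ ^ 2) * ‖J (e - x)‖ := by
  obtain ⟨v, hv, hort, hpyth⟩ := exists_bestApprox J hZ e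
  have hd : v - p ∈ Z := Z.sub_mem hv hp
  have h1 : s (e - v) (v - p) + s (v - p) (v - p) = 0 := by
    rw [← LinearMap.add_apply, ← map_add, sub_add_sub_cancel]
    exact hgal _ hd
  have h2 := abs_le.1 (hs (e - v) _ hd)
  rw [hort _ hd, sub_zero] at h2
  have h3 := le_form_self hs _ hd
  -- The error `e - v` is orthogonal to `Z`, so the form sees it only through the perturbation; the
  -- coercivity constant is at least `1 / 2`. As `v - p` is orthogonal to `e - v`, this first-order
  -- quantity enters the error squared, and `√(1 + 4σ²) ≤ 1 + 2σ²`.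
  have h4 : ‖J (v - p)‖ ≤ 2 * σ * ‖J (e - v)‖ := by
    by_contra hlt
    have hlt := not_le.1 hlt
    have hpos : 0 < ‖J (v - p)‖ := lt_of_le_of_lt (by positivity) hlt
    nlinarith [norm_nonneg (J (e - v))]
  have h5 := hpyth p hp
  have h6 := hpyth x hx
  have h7 : ‖J (e - p)‖ ≤ (1 + 2 * σ ^ 2) * ‖J (e - v)‖ := by
    refine le_of_sq_le_sq ?_ (by positivity)
    have : ‖J (v - p)‖ ^ 2 ≤ (2 * σ * ‖J (e - v)‖) ^ 2 := pow_le_pow_left₀ (norm_nonneg _) h4 2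
    nlinarith [mul_nonneg (sq_nonneg (σ ^ 2)) (sq_nonneg ‖J (e - v)‖)]
  refine h7.trans (mul_le_mul_of_nonneg_left ?_ (by positivity))
  exact le_of_sq_le_sq (by nlinarith [sq_nonneg ‖J (v - x)‖]) (norm_nonneg _)

omit [CompleteSpace E] in
theorem norm_galerkin_sub_le (hσ : σ ≤ 1 / 2) {e p x : X} (hp : p ∈ Z)
    (hgal : ∀ z ∈ Z, s (e - p) z = 0) (hx : x ∈ Z) {τ : ℝ} (hτ0 : 0 ≤ τ)
    (hτ : ∀ z ∈ Z, |s (e - x) z| ≤ τ * ‖J z‖) : ‖J (p - x)‖ ≤ 2 * τ := by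
  have hd : p - x ∈ Z := Z.sub_mem hp hx
  have h1 : s (e - x) (p - x) = s (p - x) (p - x) := by
    have := hgal _ hd
    have e1 : e - x = (e - p) + (p - x) := by abel
    rw [e1, map_add, LinearMap.add_apply, this, zero_add]
  have h2 := abs_le.1 (hτ _ hd)
  have h3 := le_form_self hs _ hd
  by_contra hlt
  have hlt := not_le.1 hlt
  have hpos : 0 < ‖J (p - x)‖ := lt_of_le_of_lt (by positivity) hlt
  nlinarith [h2.2]

omit [CompleteSpace E] in
-- An upper bound for the distance to the best approximation by a residual. The residual is measured
-- with the computable form instead of the inner product, which adds the `σ` term.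
theorem norm_bestApprox_sub_le (hσ0 : 0 ≤ σ) {e p x : X} (hp : p ∈ Z)
    (hort : ∀ z ∈ Z, inner ℝ (J (e - p)) (J z) = 0) (hx : x ∈ Z) {τ : ℝ}
    (hτ0 : 0 ≤ τ) (hτ : ∀ z ∈ Z, |s (e - x) z| ≤ τ * ‖J z‖) : ‖J (p - x)‖ ≤ τ + σ * ‖J (e - x)‖ := by
  have hd : p - x ∈ Z := Z.sub_mem hp hx
  have h1 : inner ℝ (J (e - x)) (J (p - x)) = ‖J (p - x)‖ ^ 2 := by
    have := hort _ hd
    have e1 : e - x = (e - p) + (p - x) := by abel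
    rw [e1, map_add, inner_add_left, this, zero_add, real_inner_self_eq_norm_sq]
  have h2 := abs_le.1 (hτ _ hd)
  have h3 := abs_le.1 (hs (e - x) _ hd)
  rw [h1] at h3
  rcases eq_or_ne ‖J (p - x)‖ 0 with h0 | h0
  · rw [h0]; positivity
  · have hpos := lt_of_le_of_ne (norm_nonneg (J (p - x))) (Ne.symm h0)
    refine le_of_mul_le_mul_right ?_ hpos
    nlinarith [h2.2, h3.1]

omit [CompleteSpace E] in
-- The converse bound: a large residual on `Z` forces the best approximation from `Z` to lie far
-- from `x`. Bulk chasing rests on this.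
theorem abs_form_le_bestApprox {e p x : X}
    (hort : ∀ z ∈ Z, inner ℝ (J (e - p)) (J z) = 0) {z : X} (hz : z ∈ Z) :
    |s (e - x) z| ≤ (‖J (p - x)‖ + σ * ‖J (e - x)‖) * ‖J z‖ := by
  have h1 : inner ℝ (J (e - x)) (J z) = inner ℝ (J (p - x)) (J z) := by
    have e1 : e - x = (e - p) + (p - x) := by abel
    rw [e1, map_add, inner_add_left, hort z hz, zero_add]
  have h3 := abs_le.1 (hs (e - x) z hz)
  have h4 := abs_le.1 (abs_real_inner_le_norm (J (p - x)) (J z))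
  rw [h1] at h3
  rw [abs_le]
  constructor <;> linarith [h3.1, h3.2, h4.1, h4.2]

end PerturbedGalerkin

end SpaceTime

/-! ### Reliability and efficiency of the error estimator -/

namespace SpaceTime

theorem boundedFunctional_eq {E : Type*} [NormedAddCommGroup E] [NormedSpace ℝ E] {f : E → ℝ}
    {F : StrongDual ℝ E} (h : ∀ x, F x = f x) : boundedFunctional f = F := by
  have h' : ∃ F : StrongDual ℝ E, ∀ x, F x = f x := ⟨F, h⟩
  rw [boundedFunctional, dif_pos h']
  ext x
  rw [h'.choose_spec x, h x]

/-- This is Cauchy–Schwarz for `K⁻¹` at `K F` and `x`: the root of `f (K f)` bounds `f` in the norm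
dual to that of `K⁻¹`. -/
theorem Preconditioner.abs_apply_le_sqrt_quad {E : Type*} [NormedAddCommGroup E] [NormedSpace ℝ E]
    (K : Preconditioner E) (h : ∀ x, 0 ≤ K.invForm x x) {f : E → ℝ} {F : StrongDual ℝ E}
    (hF : ∀ x, F x = f x) (x : E) :
    |f x| ≤ Real.sqrt (K.quad f) * Real.sqrt (K.invForm x x) := by
  have h1 := K.invForm_mul_self_le h (K.toEquiv F) x
  have e : K.quad f = K.invForm (K.toEquiv F) (K.toEquiv F) := by
    rw [quad, boundedFunctional_eq hF, invForm_toEquiv]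
  rw [← e, invForm_toEquiv, hF] at h1
  rw [← Real.sqrt_mul (by rw [e]; exact h _)]
  exact Real.abs_le_sqrt h1

theorem Preconditioner.quad_eq_zero {E : Type*} [NormedAddCommGroup E] [NormedSpace ℝ E]
    (K : Preconditioner E) {f : E → ℝ} (h : ∀ x, f x = 0) : K.quad f = 0 := by
  rw [quad, boundedFunctional_eq (F := 0) fun x => (h x).symm]
  rfl

/-- Used with `r` a residual norm and `x` the norm of a direction on which the residual equals `r²`.
The conclusion divides by `r`, so `r = 0` is treated separately. -/
theorem le_of_mul_sq_le_mul {m r x y b : ℝ} (hr : 0 ≤ r) (hb : 0 ≤ b) (hm : 0 ≤ m)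
    (h : r ^ 2 ≤ b * x) (hx : m * x ≤ r) (hy : b ≤ y) : m * r ≤ y := by
  rcases hr.eq_or_lt with rfl | hpos
  · linarith
  refine le_of_mul_le_mul_right ?_ hpos
  have h4 := mul_le_mul_of_nonneg_left hx hb
  have h5 := mul_le_mul_of_nonneg_left h hm
  have h6 := mul_le_mul_of_nonneg_right hy hr
  linarith

theorem add_mul_le_of_sq_add_le {M a b c r x N : ℝ} (hM : 0 ≤ M) (hN : 0 ≤ N)
    (hc : 0 ≤ c) (ha : 0 ≤ a) (hr : 0 ≤ r) (h : x ^ 2 + c ≤ M ^ 2 * N ^ 2) (hb : b ^ 2 ≤ c * r ^ 2) :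
    a * x + |b| ≤ M * (a + r) * N := by
  have hMN := mul_nonneg hM hN
  have h1 : x ≤ M * N := le_of_sq_le_sq (by rw [mul_pow]; linarith) hMN
  have h2 : |b| ≤ M * N * r := by
    refine abs_le_of_sq_le_sq ?_ (mul_nonneg hMN hr)
    have := mul_le_mul_of_nonneg_right (show c ≤ M ^ 2 * N ^ 2 by linarith [sq_nonneg x])
      (sq_nonneg r)
    linarith
  have := mul_le_mul_of_nonneg_left h1 ha
  linarith

namespace ParabolicProblem

variable {V : Type u} {H : Type v} [NormedAddCommGroup V] [InnerProductSpace ℝ V] [CompleteSpace V]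
  [NormedAddCommGroup H] [InnerProductSpace ℝ H] [CompleteSpace H] {P : ParabolicProblem V H}

omit [CompleteSpace V] [CompleteSpace H] in
theorem B_add (w z : P.X) : P.B (w + z) = P.B w + P.B z := map_add P.BL w z

omit [CompleteSpace V] [CompleteSpace H] in
theorem B_smul (r : ℝ) (w : P.X) : P.B (r • w) = r • P.B w := map_smul P.BL r w

omit [CompleteSpace V] [CompleteSpace H] in
theorem B_sub (w z : P.X) : P.B (w - z) = P.B w - P.B z := map_sub P.BL w z

theorem trace_sub (w z : P.X) : P.trace 0 (w - z) = P.trace 0 w - P.trace 0 z :=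
  map_sub P.traceL w z

namespace Discretization

variable (D : P.Discretization)

omit [CompleteSpace V] [CompleteSpace H] in
theorem S_symm (δ : D.Δ) (w z : P.X) : D.S δ w z = D.S δ z w := by
  have hs : P.B z ((D.KY δ).toEquiv ((P.B w).comp (D.Y δ).subtypeL))
      = P.B w ((D.KY δ).toEquiv ((P.B z).comp (D.Y δ).subtypeL)) :=
    (D.KY δ).symm ((P.B z).comp (D.Y δ).subtypeL) ((P.B w).comp (D.Y δ).subtypeL)
  rw [S, S, hs, real_inner_comm]

/-- The form `S` as a bilinear map. -/
noncomputable def SForm (δ : D.Δ) : P.X →ₗ[ℝ] P.X →ₗ[ℝ] ℝ :=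
  have hadd : ∀ w z z', D.S δ w (z + z') = D.S δ w z + D.S δ w z' := fun w z z' => by
    rw [S, S, S, B_add, P.trace_add P.zero_mem_Icc, inner_add_right, add_apply]
    ring
  have hsmul : ∀ r w z, D.S δ w (r • z) = r • D.S δ w z := fun r w z => by
    rw [S, S, B_smul, P.trace_smul P.zero_mem_Icc, real_inner_smul_right, smul_apply,
      smul_eq_mul, smul_eq_mul]
    ring
  LinearMap.mk₂ ℝ (D.S δ)
    (fun w w' z => by rw [D.S_symm, hadd, D.S_symm δ z, D.S_symm δ z])
    (fun r w z => by rw [D.S_symm, hsmul, D.S_symm δ z]) hadd hsmul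

theorem SForm_apply (δ : D.Δ) (w z : P.X) : D.SForm δ w z = D.S δ w z := rfl

variable {D}

/-- The data of the discrete problem are those of `uh`, so residuals, which are computable without
knowing `uh`, measure the error `uh - w` in the form `S`. -/
theorem residual_eq {δ : D.Δ} {g : StrongDual ℝ P.Y} {u₀ : H} {uh : P.X}
    (h : P.IsSolution g u₀ uh) (w z : P.X) : D.residual δ g u₀ w z = D.SForm δ (uh - w) z := by
  rw [SForm_apply, S, residual, B_sub, trace_sub, h.1, h.2]

theorem load_sub_S_eq {δ : D.Δ} {g : StrongDual ℝ P.Y} {u₀ : H} {uh : P.X}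
    (h : P.IsSolution g u₀ uh) (w z : P.X) :
    D.load δ g u₀ z - D.S δ w z = D.SForm δ (uh - w) z := by
  have : D.load δ g u₀ z = D.S δ uh z := by rw [load, S, h.1, h.2]
  rw [this, map_sub, LinearMap.sub_apply]
  rfl

section Estimates

variable {E : Type*} [NormedAddCommGroup E] [InnerProductSpace ℝ E] [CompleteSpace E]
  {J : P.X ≃L[ℝ] E} (hN : ∀ w, ‖J w‖ = P.normX w) {σ : ℝ}
  (hS : ∀ δ, ∀ z ∈ D.X δ, ∀ w, |D.SForm δ w z - inner ℝ (J w) (J z)| ≤ σ * ‖J w‖ * ‖J z‖)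
  {g : StrongDual ℝ P.Y} {u₀ : H} (R : D.DataApprox g u₀) {δ : D.Δ} {uh : P.X}
  (hu : P.IsSolution (R.gd δ) (R.u₀d δ) uh)

include hS in
omit [CompleteSpace E] in
theorem form_enl (w z : P.X) (hz : z ∈ D.X δ) :
    |D.SForm (D.enl δ) w z - inner ℝ (J w) (J z)| ≤ σ * ‖J w‖ * ‖J z‖ :=
  hS _ z (D.le_enl δ hz) w

include hS hu in
omit [CompleteSpace E] in
-- Ensures that `boundedFunctional` in the definition of the algebraic error is the residual itself
-- and not its default value.
theorem exists_functional (ut : P.X) : ∃ F : StrongDual ℝ (D.X δ), ∀ z : D.X δ,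
    F z = D.load (D.enl δ) (R.gd δ) (R.u₀d δ) z - D.S (D.enl δ) ut z := by
  have hσ : ∀ z ∈ D.X δ, |D.SForm (D.enl δ) (uh - ut) z|
      ≤ |(1 + σ) * ‖J (uh - ut)‖| * ‖J z‖ := fun z hz =>
    (abs_form_le (form_enl hS) _ z hz).trans
      (mul_le_mul_of_nonneg_right (le_abs_self _) (norm_nonneg _))
  refine ⟨LinearMap.mkContinuous ((D.SForm (D.enl δ) (uh - ut)).comp (D.X δ).subtype)
    (|(1 + σ) * ‖J (uh - ut)‖| * ‖(J : P.X →L[ℝ] E)‖) fun z => ?_, fun z => ?_⟩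
  · refine (hσ z z.2).trans ?_
    rw [mul_assoc]
    exact mul_le_mul_of_nonneg_left ((J : P.X →L[ℝ] E).le_opNorm z) (abs_nonneg _)
  · exact (load_sub_S_eq hu ut z).symm

include hN hS hu in
omit [CompleteSpace E] in
theorem abs_form_le_algError {k₁ k₂ : ℝ} (hk₁ : 0 < k₁) (hK : D.KXBound k₁ k₂) (ut : P.X)
    {z : P.X} (hz : z ∈ D.X δ) :
    |D.SForm (D.enl δ) (uh - ut) z| ≤ Real.sqrt k₂ * R.algError δ ut * ‖J z‖ := by
  obtain ⟨F, hF⟩ := exists_functional hS R hu ut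
  have hpos : ∀ x : D.X δ, 0 ≤ (D.KX δ).invForm x x := fun x =>
    le_trans (by positivity) (hK δ x).1
  have h := (D.KX δ).abs_apply_le_sqrt_quad hpos hF ⟨z, hz⟩
  rw [load_sub_S_eq hu ut z] at h
  refine h.trans ?_
  have h2 : Real.sqrt ((D.KX δ).invForm ⟨z, hz⟩ ⟨z, hz⟩) ≤ Real.sqrt k₂ * ‖J z‖ := by
    rw [hN]
    have hnn : 0 ≤ P.normX z := Real.sqrt_nonneg _
    calc _ ≤ Real.sqrt (k₂ * P.normX z ^ 2) := Real.sqrt_le_sqrt (hK δ ⟨z, hz⟩).2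
      _ = Real.sqrt k₂ * Real.sqrt (P.normX z ^ 2) := Real.sqrt_mul' _ (sq_nonneg _)
      _ = _ := by rw [Real.sqrt_sq hnn]
  refine (mul_le_mul_of_nonneg_left h2 (Real.sqrt_nonneg _)).trans (le_of_eq ?_)
  rw [DataApprox.algError]
  ring

include hu in
theorem algError_eq_zero {ut : P.X} (h : ∀ z ∈ D.X δ, D.SForm (D.enl δ) (uh - ut) z = 0) :
    R.algError δ ut = 0 := by
  rw [DataApprox.algError, Preconditioner.quad_eq_zero, Real.sqrt_zero]
  intro z
  rw [load_sub_S_eq hu ut z, h z z.2]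

omit [CompleteSpace V] [CompleteSpace H] in
theorem algError_nonneg (ut : P.X) : 0 ≤ R.algError δ ut := Real.sqrt_nonneg _

include hu in
theorem resVec_eq (ut : P.X) (i : D.J δ) :
    R.resVec δ ut i = D.SForm (D.enl δ) (uh - ut) (D.θ δ i) := residual_eq hu ut _

omit [CompleteSpace V] [CompleteSpace H] in
theorem resNorm_sq (ut : P.X) (s : Finset (D.J δ)) :
    R.resNorm δ ut s ^ 2 = ∑ i ∈ s, R.resVec δ ut i ^ 2 :=
  Real.sq_sqrt (Finset.sum_nonneg fun _ _ => sq_nonneg _)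

omit [CompleteSpace V] [CompleteSpace H] in
theorem resNorm_nonneg (ut : P.X) (s : Finset (D.J δ)) : 0 ≤ R.resNorm δ ut s := Real.sqrt_nonneg _

include hN hS hu in
omit [CompleteSpace E] in
/-- The residual on the enlarged space is controlled by the residual vector and the algebraic
error. -/
theorem abs_form_le_estimator {k₁ k₂ m M : ℝ} (hk₁ : 0 < k₁) (hK : D.KXBound k₁ k₂) (hM : 0 ≤ M)
    (hΘ : D.StableComplement m M) (ut : P.X) {z : P.X} (hz : z ∈ D.X (D.enl δ)) :
    |D.SForm (D.enl δ) (uh - ut) z|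
      ≤ M * (Real.sqrt k₂ * R.algError δ ut + R.resNorm δ ut Finset.univ) * ‖J z‖ := by
  rw [← D.span_θ δ, Submodule.mem_sup] at hz
  obtain ⟨y, hy, t, ht, rfl⟩ := hz
  obtain ⟨c, rfl⟩ := (Submodule.mem_span_range_iff_exists_fun ℝ).1 ht
  have hst := (hΘ δ y hy c).2
  rw [← hN, ← hN] at hst
  have h3 := abs_form_le_algError hN hS R hu hk₁ hK ut hy
  have h4 : (∑ i, c i * R.resVec δ ut i) ^ 2
      ≤ (∑ i, c i ^ 2) * R.resNorm δ ut Finset.univ ^ 2 := by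
    rw [resNorm_sq]
    exact Finset.sum_mul_sq_le_sq_mul_sq _ _ _
  have e : D.SForm (D.enl δ) (uh - ut) (y + ∑ i, c i • D.θ δ i)
      = D.SForm (D.enl δ) (uh - ut) y + ∑ i, c i * R.resVec δ ut i := by
    rw [map_add, map_sum]
    congr 1
    refine Finset.sum_congr rfl fun i _ => ?_
    rw [map_smul, smul_eq_mul, resVec_eq R hu]
  rw [e]
  have ha : 0 ≤ Real.sqrt k₂ * R.algError δ ut :=
    mul_nonneg (Real.sqrt_nonneg _) (algError_nonneg R ut)
  have hr := resNorm_nonneg R ut (Finset.univ : Finset (D.J δ))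
  exact ((abs_add_le _ _).trans (add_le_add_left h3 _)).trans
    (add_mul_le_of_sq_add_le hM (norm_nonneg _)
      (Finset.sum_nonneg fun _ _ => sq_nonneg _) ha hr hst h4)

include hN hu in
omit [CompleteSpace E] in
/-- A combination of the `θ_i` on which the residual attains the norm of the residual vector. -/
theorem exists_residual_direction {m M : ℝ} (hΘ : D.StableComplement m M) (ut : P.X)
    (s : Finset (D.J δ)) : ∃ z ∈ Submodule.span ℝ (D.θ δ '' s),
      D.SForm (D.enl δ) (uh - ut) z = R.resNorm δ ut s ^ 2 ∧ m * ‖J z‖ ≤ R.resNorm δ ut s := by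
  classical
  refine ⟨∑ i ∈ s, R.resVec δ ut i • D.θ δ i, ?_, ?_, ?_⟩
  · exact Submodule.sum_mem _ fun i hi =>
      Submodule.smul_mem _ _ (Submodule.subset_span ⟨i, hi, rfl⟩)
  · rw [map_sum, resNorm_sq]
    refine Finset.sum_congr rfl fun i _ => ?_
    rw [map_smul, smul_eq_mul, resVec_eq R hu, sq]
  -- The splitting estimate is taken with no component in `X^δ` and with the coefficients extended
  -- by zero outside `s`.
  · have h := (hΘ δ 0 (D.X δ).zero_mem fun i => if i ∈ s then R.resVec δ ut i else 0).1
    rw [← hN, ← hN, map_zero, norm_zero, zero_add] at h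
    simp only [ite_smul, zero_smul, ite_pow, ne_eq, OfNat.ofNat_ne_zero, not_false_eq_true,
      zero_pow, Finset.sum_ite_mem, Finset.univ_inter, zero_add] at h
    rw [← resNorm_sq] at h
    refine le_of_sq_le_sq ?_ (resNorm_nonneg R ut s)
    rw [mul_pow]
    exact h

include hN hS hu in
omit [CompleteSpace E] in
-- Efficiency: the residual is tested with the combination on which it attains its norm, and the
-- form is bounded by `1 + σ ≤ 2`.
theorem resNorm_le {m M : ℝ} (hm : 0 < m) (hσ0 : 0 ≤ σ) (hσ : σ ≤ 1 / 2)
    (hΘ : D.StableComplement m M) (ut : P.X) :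
    R.resNorm δ ut Finset.univ ≤ 2 / m * ‖J (uh - ut)‖ := by
  obtain ⟨z, hz, h1, h2⟩ := exists_residual_direction hN R hu hΘ ut Finset.univ
  have hz' : z ∈ D.X (D.enl δ) := by
    rw [← D.span_θ δ]
    refine Submodule.mem_sup_right (Submodule.span_mono ?_ hz)
    exact image_subset_range _ _
  have h3 := (le_abs_self _).trans (abs_form_le (fun w z hz => hS _ z hz w) (uh - ut) z hz')
  rw [h1] at h3
  rw [div_mul_eq_mul_div, le_div_iff₀ hm, mul_comm]
  have hσ1 : 1 + σ ≤ 2 := by linarith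
  exact le_of_mul_sq_le_mul (resNorm_nonneg R ut _)
    (mul_nonneg (by linarith) (norm_nonneg _)) hm.le h3 h2
    (mul_le_mul_of_nonneg_right hσ1 (norm_nonneg _))

include hN hS hu in
/-- Reliability of the residual estimator under saturation. -/
theorem norm_sub_le_estimator {k₁ k₂ m M ζ : ℝ} (hk₁ : 0 < k₁) (hK : D.KXBound k₁ k₂) (hM : 0 ≤ M)
    (hΘ : D.StableComplement m M) (hsat : D.Saturation ζ) (hσ0 : 0 ≤ σ)
    (hσ : σ ≤ (1 - max ζ 0) / 2) {ut : P.X} (hut : ut ∈ D.X δ) :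
    (1 - max ζ 0) / 2 * ‖J (uh - ut)‖
      ≤ M * (Real.sqrt k₂ * R.algError δ ut + R.resNorm δ ut Finset.univ) := by
  obtain ⟨p, hp, hort, hpyth⟩ := exists_bestApprox J (D.X_closed (D.enl δ)) uh
  have hut' := D.le_enl δ hut
  have ha : 0 ≤ Real.sqrt k₂ * R.algError δ ut :=
    mul_nonneg (Real.sqrt_nonneg _) (algError_nonneg R ut)
  have hr := resNorm_nonneg R ut (Finset.univ : Finset (D.J δ))
  have h1 := norm_bestApprox_sub_le (fun w z hz => hS _ z hz w) hσ0 hp hort hut'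
    (by positivity) (fun z hz => abs_form_le_estimator hN hS R hu hk₁ hK hM hΘ ut hz)
  -- Saturation bounds the best approximation error in the enlarged space by a fraction of the
  -- present error. The remainder `p - ut` is seen by the residual on that space. The admissible
  -- size of `σ` leaves half of `1 - max ζ 0` after absorption.
  have h2 : ‖J (uh - p)‖ ≤ max ζ 0 * ‖J (uh - ut)‖ := by
    have b1 : ‖J (uh - p)‖ ≤ P.bestError (D.X (D.enl δ)) uh := by
      refine le_ciInf fun x => ?_
      rw [← hN]
      refine le_of_sq_le_sq ?_ (norm_nonneg _)
      rw [hpyth x x.2]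
      exact le_add_of_nonneg_right (sq_nonneg _)
    have b2 := hsat δ _ (R.gd_mem δ) _ (R.u₀d_mem δ) uh hu
    have b3 : P.bestError (D.X δ) uh ≤ ‖J (uh - ut)‖ := by
      rw [hN]
      exact ciInf_le (f := fun w : D.X δ => P.normX (uh - w))
        ⟨0, by rintro _ ⟨x, rfl⟩; exact Real.sqrt_nonneg _⟩ ⟨ut, hut⟩
    have b0 : 0 ≤ P.bestError (D.X δ) uh := Real.iInf_nonneg fun _ => Real.sqrt_nonneg _
    calc _ ≤ _ := b1
      _ ≤ _ := b2
      _ ≤ max ζ 0 * P.bestError (D.X δ) uh := by gcongr; exact le_max_left _ _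
      _ ≤ _ := by gcongr
  have h3 : ‖J (uh - ut)‖ ≤ ‖J (uh - p)‖ + ‖J (p - ut)‖ := by
    rw [← sub_add_sub_cancel uh p ut, map_add]
    exact norm_add_le _ _
  have h4 := mul_le_mul_of_nonneg_right hσ (norm_nonneg (J (uh - ut)))
  linarith

include hN hS hu in
-- The error is split at the exact Galerkin solution: its own error is quasi-optimal, and its
-- distance to `ut` is the algebraic error.
theorem norm_sub_le_bestApprox_add {k₁ k₂ : ℝ} (hk₁ : 0 < k₁) (hK : D.KXBound k₁ k₂)
    (hσ0 : 0 ≤ σ) (hσ : σ ≤ 1 / 2) {ut x : P.X} (hut : ut ∈ D.X δ) (hx : x ∈ D.X δ) :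
    ‖J (uh - ut)‖ ≤ (1 + 2 * σ ^ 2) * ‖J (uh - x)‖ + 2 * (Real.sqrt k₂ * R.algError δ ut) := by
  obtain ⟨p, hp, hgal⟩ := exists_galerkin (form_enl (δ := δ) hS) (D.S_symm _) hσ0 (by linarith)
    (D.X_closed δ) uh
  have h1 := norm_sub_galerkin_le (form_enl hS) hσ0 hσ (D.X_closed δ) hp hgal hx
  have h2 := norm_galerkin_sub_le (form_enl hS) hσ hp hgal hut
    (mul_nonneg (Real.sqrt_nonneg _) (algError_nonneg R ut))
    (fun z hz => abs_form_le_algError hN hS R hu hk₁ hK ut hz)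
  have h3 : ‖J (uh - ut)‖ ≤ ‖J (uh - p)‖ + ‖J (p - ut)‖ := by
    rw [← sub_add_sub_cancel uh p ut, map_add]
    exact norm_add_le _ _
  linarith

include hS hu in
omit [CompleteSpace E] in
-- The exact Galerkin solution meets every tolerance, so the computation in the inner loop is always
-- possible.
theorem exists_algError_eq_zero (hσ0 : 0 ≤ σ) (hσ : σ ≤ 1 / 2) :
    ∃ ut ∈ D.X δ, R.algError δ ut = 0 := by
  obtain ⟨p, hp, hgal⟩ := exists_galerkin (form_enl (δ := δ) hS) (D.S_symm _) hσ0 (by linarith)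
    (D.X_closed δ) uh
  exact ⟨p, hp, algError_eq_zero R hu hgal⟩

include hN hS hu in
/-- The error reduction by bulk chasing. -/
theorem exists_bulk_reduction {m M : ℝ} (hm : 0 < m) (hσ0 : 0 ≤ σ) (hΘ : D.StableComplement m M)
    {δ' : D.Δ} (h1 : D.X δ ≤ D.X δ') (h2 : D.X δ' ≤ D.X (D.enl δ)) {s : Finset (D.J δ)}
    (hs : ∀ i ∈ s, D.θ δ i ∈ D.X δ') {ut : P.X} (hut : ut ∈ D.X δ) :
    ∃ p ∈ D.X δ', ‖J (uh - ut)‖ ^ 2 = ‖J (uh - p)‖ ^ 2 + ‖J (p - ut)‖ ^ 2 ∧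
      m * R.resNorm δ ut s ≤ ‖J (p - ut)‖ + σ * ‖J (uh - ut)‖ := by
  obtain ⟨p, hp, hort, hpyth⟩ := exists_bestApprox J (D.X_closed δ') uh
  refine ⟨p, hp, hpyth ut (h1 hut), ?_⟩
  obtain ⟨z, hz, e1, e2⟩ := exists_residual_direction hN R hu hΘ ut s
  have hz' : z ∈ D.X δ' := by
    refine Submodule.span_le.2 ?_ hz
    rintro _ ⟨i, hi, rfl⟩
    exact hs i hi
  have h3 := (le_abs_self _).trans (abs_form_le_bestApprox (Z := D.X δ') (J := J) (σ := σ)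
    (s := D.SForm (D.enl δ)) (fun w z hz => hS _ z (h2 hz) w) (x := ut) hort hz')
  rw [e1] at h3
  exact le_of_mul_sq_le_mul (resNorm_nonneg R ut _)
    (add_nonneg (norm_nonneg _) (mul_nonneg hσ0 (norm_nonneg _))) hm.le h3 e2 le_rfl

end Estimates

end Discretization

end ParabolicProblem
end SpaceTime

namespace SpaceTime

/-! ### The arithmetic of the error reduction -/

section Contraction

theorem algError_le_of_le_mul_estimator {t r η ξ : ℝ} (hr : 0 ≤ r) (hη : 0 ≤ η) (hξ0 : 0 ≤ ξ)
    (hξ : ξ ≤ 1 / 2) (h : t ≤ ξ * (r + η + t)) : t ≤ 2 * ξ * (r + η) := by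
  have h1 : (1 - ξ) * t ≤ ξ * (r + η) := by linarith
  rcases le_total t 0 with ht | ht
  · exact ht.trans (by positivity)
  · nlinarith

/-- Quasi-optimality of an approximation with a small algebraic error. -/
theorem le_of_quasi_optimal {C₂ C₃ ξ q x b t r η : ℝ} (hC₂ : 0 ≤ C₂) (hC₃ : 0 ≤ C₃) (hξ : 0 ≤ ξ)
    (hq : 0 ≤ q) (hq1 : q ≤ 1) (hb : 0 ≤ b) (hη : 0 ≤ η) (hC : 4 * C₃ * (C₂ + 1) * ξ ≤ 1 / 2)
    (hx : x ≤ (1 + 32 * q) * b + C₃ * t) (ht : t ≤ 2 * ξ * (r + η)) (hr : r ≤ C₂ * x) :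
    x ≤ (1 + (33 * (4 * C₃ * (C₂ + 1)) + 32) * (ξ + q)) * b + η := by
  set y := C₃ * ξ with hy
  have hy0 : 0 ≤ y := mul_nonneg hC₃ hξ
  have hyC : 0 ≤ y * C₂ := mul_nonneg hy0 hC₂
  have hyb : y * C₂ + y ≤ 1 / 8 := by nlinarith
  -- The algebraic error is itself bounded by `ξ` times the error and oscillation. Absorbing it
  -- costs the factor `1 / (1 - 2 y C₂) ≤ 1 + 4 y C₂`, so the constant exceeds `1` only linearly in
  -- `ξ` and `q`.
  have h1 : x * (1 - 2 * (y * C₂)) ≤ (1 + 32 * q) * b + 2 * y * η := by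
    have a1 := mul_le_mul_of_nonneg_left ht hC₃
    have a2 := mul_le_mul_of_nonneg_left hr hy0
    linarith
  have hR : 0 ≤ (1 + 32 * q) * b + 2 * y * η := by positivity
  have h2 : x ≤ (1 + 4 * (y * C₂)) * ((1 + 32 * q) * b + 2 * y * η) := by
    rcases le_total x 0 with hx0 | hx0
    · exact hx0.trans (by positivity)
    · have a3 : x ≤ (1 + 4 * (y * C₂)) * (x * (1 - 2 * (y * C₂))) := by
        have : 0 ≤ (2 * (y * C₂)) * (1 - 4 * (y * C₂)) * x := by
          refine mul_nonneg (mul_nonneg (by linarith) (by linarith)) hx0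
        linarith
      exact a3.trans (mul_le_mul_of_nonneg_left h1 (by linarith))
  have h3 : (1 + 4 * (y * C₂)) * (2 * y * η) ≤ η := by
    have : (1 + 4 * (y * C₂)) * (2 * y) ≤ 1 := by nlinarith
    nlinarith
  have h4 : (1 + 4 * (y * C₂)) * (1 + 32 * q) ≤
      1 + (33 * (4 * C₃ * (C₂ + 1)) + 32) * (ξ + q) := by
    have a1 : (y * C₂) * q ≤ y * C₂ := mul_le_of_le_one_right hyC hq1
    have a2 : 0 ≤ C₃ * (C₂ + 1) * q := by positivity
    have e : (33 * (4 * C₃ * (C₂ + 1)) + 32) * (ξ + q)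
      = 132 * (y * C₂) + 132 * y + 132 * (C₃ * (C₂ + 1) * q) + 32 * ξ + 32 * q := by rw [hy]; ring
    rw [e]
    linarith
  have h5 := mul_le_mul_of_nonneg_right h4 hb
  linarith

/-- The reduction when data oscillation dominates. -/
theorem reduction_of_oscillation {C₁ D s ω ϑ ξ q Ei Êi ri ti ηi Ej b ηj : ℝ} (hC₁ : 0 ≤ C₁)
    (hD : 0 ≤ D) (hω : 0 < ω) (hω1 : ω ≤ 1) (hϑ : 0 < ϑ) (hϑ1 : ϑ ≤ 1 / 16) (hξ0 : 0 ≤ ξ)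
    (hξ : ξ ≤ 1 / 2) (hs : 16 * D * (3 * C₁ + 1) * s ≤ 1) (hξs : ξ ≤ s * ω) (hqs : q ≤ s * ω)
    (hd0 : 0 ≤ q) (hd : D * (ξ + q) ≤ 1)
    (hEi0 : 0 ≤ Ei) (hr0 : 0 ≤ ri) (hηj0 : 0 ≤ ηj) (hEi : Ei ≤ Êi + ηi)
    (hÊi : Êi ≤ C₁ * (ri + ti)) (hti : ti ≤ 2 * ξ * (ri + ηi)) (hosc : ω * ri ≤ ηi)
    (hηj : ηj ≤ ηi / 2) (hb : b ≤ Ei + ηj) (hEj : Ej ≤ (1 + D * (ξ + q)) * b + 2 * ηj) :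
    ϑ * Ej + ηj ≤ (1 - 1 / 4 / (1 + ϑ * (3 * C₁ + 1) / ω)) * (ϑ * Ei + ηi) := by
  have hηi0 : 0 ≤ ηi := by linarith
  have h1 : ω * Ei ≤ (3 * C₁ + 1) * ηi := by
    have a1 : ti ≤ ri + ηi := hti.trans (mul_le_of_le_one_left (by linarith) (by linarith))
    have a2 : Ei ≤ C₁ * (2 * ri + ηi) + ηi :=
      hEi.trans (by linarith [mul_le_mul_of_nonneg_left a1 hC₁])
    have a3 : ω * ηi ≤ ηi := mul_le_of_le_one_left hηi0 hω1
    calc ω * Ei ≤ ω * (C₁ * (2 * ri + ηi) + ηi) := by gcongr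
      _ = C₁ * (2 * (ω * ri) + ω * ηi) + ω * ηi := by ring
      _ ≤ C₁ * (2 * ηi + ηi) + ηi := by gcongr
      _ = _ := by ring
  have hd0' : 0 ≤ D * (ξ + q) := by positivity
  have hs0 : 0 ≤ s := nonneg_of_mul_nonneg_left (hξ0.trans hξs) hω
  -- Here `ξ / ω` and `q / ω` have to be small: the error may be as large as `η / ω`, yet its
  -- relative excess has to stay below a fraction of `η`.
  have h2 : D * (ξ + q) * Ei ≤ ηi / 8 := by
    calc D * (ξ + q) * Ei ≤ D * (2 * (s * ω)) * Ei := by gcongr; linarith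
      _ = 2 * D * s * (ω * Ei) := by ring
      _ ≤ 2 * D * s * ((3 * C₁ + 1) * ηi) := by gcongr
      _ = 16 * D * (3 * C₁ + 1) * s * ηi / 8 := by ring
      _ ≤ 1 * ηi / 8 := by gcongr
      _ = _ := by ring
  have h3 : Ej ≤ Ei + 17 / 8 * ηi := by
    have a1 : (1 + D * (ξ + q)) * b ≤ (1 + D * (ξ + q)) * (Ei + ηj) := by gcongr
    have a2 : D * (ξ + q) * ηj ≤ ηj := mul_le_of_le_one_left hηj0 hd
    linarith
  have h4 : ϑ * Ej + ηj ≤ ϑ * Ei + 3 / 4 * ηi := by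
    have a1 := mul_le_mul_of_nonneg_left h3 hϑ.le
    have a2 := mul_le_mul_of_nonneg_right hϑ1 hηi0
    linarith
  have hK : 0 < 1 + ϑ * (3 * C₁ + 1) / ω := by positivity
  -- The gain of `ηi / 4` is a fixed fraction of the whole weighted quantity, because the error is
  -- bounded by `(3 C₁ + 1) ηi / ω`.
  have h5 : 1 / 4 / (1 + ϑ * (3 * C₁ + 1) / ω) * (ϑ * Ei + ηi) ≤ ηi / 4 := by
    rw [div_mul_eq_mul_div, div_le_iff₀ hK]
    have a1 : Ei ≤ (3 * C₁ + 1) * ηi / ω := by rw [le_div_iff₀ hω]; linarith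
    have a2 : ϑ * Ei ≤ ϑ * ((3 * C₁ + 1) * ηi / ω) := by gcongr
    have e : ηi / 4 * (1 + ϑ * (3 * C₁ + 1) / ω)
      = (ηi + ϑ * ((3 * C₁ + 1) * ηi / ω)) / 4 := by ring
    rw [e]
    linarith
  linarith

/-- The reduction by bulk chasing. -/
theorem reduction_of_bulk {C₁ C₂ D m ω ϑ ξ q σ Ei Êi ri rs ti ηi Ej b p N ηj : ℝ} (hC₁ : 0 < C₁)
    (hm : 0 < m) (hmC : m ≤ 4 * C₁) (hC₂ : 0 ≤ C₂)
    (hω : 0 < ω) (hω1 : ω ≤ 1) (hϑ : 0 < ϑ) (hϑ1 : ϑ ≤ 1)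
    (hξ : ξ ≤ 1 / 4) (hσ : σ ≤ m / (4 * C₁) * ϑ) (hd0 : 0 ≤ D * (ξ + q))
    (hd : D * (ξ + q) ≤ (m / (4 * C₁) * ϑ) ^ 2 / 8) (hωC : 16 * C₂ * ω ≤ (m / (4 * C₁) * ϑ) ^ 2 / 16)
    (hωϑ : 8 * C₂ * ω ≤ ϑ)
    (hEi0 : 0 ≤ Ei) (hÊi0 : 0 ≤ Êi) (hr0 : 0 ≤ ri) (hηi0 : 0 ≤ ηi)
    (hEÊ : Êi ≤ Ei + ηi)
    (hÊi : Êi ≤ C₁ * (ri + ti)) (hti : ti ≤ 2 * ξ * (ri + ηi)) (hosc : ηi ≤ ω * ri)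
    (hri : ri ≤ C₂ * Êi) (hbulk : ϑ * ri ≤ rs) (hpyth : Êi ^ 2 = p ^ 2 + N ^ 2)
    (hN : m * rs ≤ N + σ * Êi) (hηj : ηj ≤ ηi) (hb : b ≤ p + 2 * ηi)
    (hEj : Ej ≤ (1 + D * (ξ + q)) * b + 2 * ηj) :
    ϑ * Ej + ηj ≤ (1 - (m / (4 * C₁) * ϑ) ^ 2 / 4) * (ϑ * Ei + ηi) := by
  set c := m / (4 * C₁) with hc
  have hc0 : 0 < c := by positivity
  have hc1 : c ≤ 1 := by rw [hc, div_le_one (by positivity)]; exact hmC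
  have hmc : m = 4 * C₁ * c := by rw [hc]; field_simp
  set x := c * ϑ with hx
  have hx0 : 0 < x := by positivity
  have hx1 : x ≤ 1 := mul_le_one₀ hc1 hϑ.le hϑ1
  have hx2 : x ^ 2 ≤ 1 := pow_le_one₀ hx0.le hx1
  have h1 : Êi ≤ 2 * C₁ * ri := by
    have a1 : ηi ≤ ri := hosc.trans (mul_le_of_le_one_left hr0 hω1)
    have a2 : ti ≤ ri := by
      refine hti.trans ?_
      calc 2 * ξ * (ri + ηi) ≤ 2 * (1 / 4) * (ri + ri) := by gcongr
        _ = ri := by ring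
    have := mul_le_mul_of_nonneg_left a2 hC₁.le
    linarith
  -- Reliability and the bulk criterion bound `m rs` from below by `2 x Êi`; the perturbation
  -- consumes at most half of this. Pythagoras then reduces the square of the error by the factor `1
  -- - x²`.
  have h2 : x * Êi ≤ N := by
    have a1 := mul_le_mul_of_nonneg_left h1 (show 0 ≤ 2 * x by positivity)
    have a2 := mul_le_mul_of_nonneg_left hbulk hm.le
    have a3 := mul_le_mul_of_nonneg_right hσ hÊi0
    have e : 2 * x * (2 * C₁ * ri) = m * (ϑ * ri) := by rw [hmc, hx]; ring
    linarith
  have h3 : p ≤ (1 - x ^ 2 / 2) * Êi := by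
    refine le_of_sq_le_sq ?_ (mul_nonneg (by linarith) hÊi0)
    have a1 : (x * Êi) ^ 2 ≤ N ^ 2 := by gcongr
    nlinarith [sq_nonneg (x ^ 2 * Êi)]
  have h4 : ηi ≤ 2 * C₂ * ω * Ei := by
    have a1 : ηi ≤ ω * (C₂ * (Ei + ηi)) := by
      refine hosc.trans ?_
      gcongr
      exact hri.trans (by gcongr)
    have a2 : C₂ * ω * ηi ≤ 1 / 8 * ηi := by gcongr; linarith
    have a3 : 0 ≤ C₂ * ω * Ei := by positivity
    linarith
  have hd1 : D * (ξ + q) ≤ 1 := by linarith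
  have h5 : b ≤ (1 - x ^ 2 / 2) * Ei + 3 * ηi := by
    have a1 : (1 - x ^ 2 / 2) * Êi ≤ (1 - x ^ 2 / 2) * (Ei + ηi) :=
      mul_le_mul_of_nonneg_left hEÊ (by linarith)
    have a2 : 0 ≤ x ^ 2 / 2 * ηi := by positivity
    linarith
  have h6 : Ej ≤ (1 - x ^ 2 / 2 + D * (ξ + q)) * Ei + 8 * ηi := by
    have a1 := mul_le_mul_of_nonneg_left h5 (show 0 ≤ 1 + D * (ξ + q) by linarith)
    have a2 : D * (ξ + q) * ηi ≤ 1 * ηi := by gcongr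
    have a3 : 0 ≤ D * (ξ + q) * (x ^ 2 / 2) * Ei := by positivity
    linarith
  -- The reduction `1 / 2` loses `1 / 8` to inexactness and `1 / 16` to oscillation, both in units
  -- of `x²`. The surplus of `1 / 16` over the claimed `1 / 4` finally pays for the oscillation
  -- term, using `h8`.
  have h7 : Ej ≤ (1 - 5 / 16 * x ^ 2) * Ei := by
    have a1 := mul_le_mul_of_nonneg_right hd hEi0
    have a2 := mul_le_mul_of_nonneg_right hωC hEi0
    linarith
  have h8 : ηi ≤ ϑ / 4 * Ei := h4.trans (by gcongr; linarith)
  have a1 := mul_le_mul_of_nonneg_left h7 hϑ.le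
  have a2 := mul_le_mul_of_nonneg_left h8 (sq_nonneg x)
  linarith

/-- The gain from bulk chasing is of order `ϑ²` and `√q` has to be of order `ϑ`. So `ω`, `q` and,
because of `ξ ≤ s ω ≤ ω`, also `ξ` are kept below `h(ϑ) = a ϑ²` with `a` small. The constant `s` is
the one demanded by the oscillation case. -/
theorem exists_thresholds {C₁ C₂ D m z : ℝ} (hC₁ : 0 < C₁) (hC₂ : 0 < C₂) (hD : 1 ≤ D)
    (hm : 0 < m) (hmC : m ≤ 4 * C₁) (hz : z < 1) :
    ∃ s : ℝ, ∃ h : ℝ → ℝ, 0 < s ∧ (∀ ϑ : ℝ, 0 < ϑ → 0 < h ϑ) ∧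
      16 * D * (3 * C₁ + 1) * s ≤ 1 ∧
      ∀ ϑ ω ξ q : ℝ, 0 < ϑ → ϑ ≤ 1 → 0 < ω → ω ≤ h ϑ → 0 ≤ ξ → ξ ≤ s * ω →
        0 ≤ q → q ≤ h ϑ →
        ω ≤ 1 ∧ ξ ≤ 1 / 4 ∧ D * ξ ≤ 1 / 2 ∧ q ≤ 1 / 64 ∧ 4 * Real.sqrt q ≤ 1 / 2 ∧
        4 * Real.sqrt q ≤ (1 - z) / 2 ∧ 4 * Real.sqrt q ≤ m / (4 * C₁) * ϑ ∧
        D * (ξ + q) ≤ (m / (4 * C₁) * ϑ) ^ 2 / 8 ∧ D * (ξ + q) ≤ 1 ∧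
        16 * C₂ * ω ≤ (m / (4 * C₁) * ϑ) ^ 2 / 16 ∧ 8 * C₂ * ω ≤ ϑ := by
  set c := m / (4 * C₁) with hc
  have hc0 : 0 < c := by positivity
  have hc1 : c ≤ 1 := by rw [hc, div_le_one (by positivity)]; exact hmC
  have hz' : 0 < 1 - z := by linarith
  obtain ⟨a, ha0, a1, a2, a3, a4, a5⟩ : ∃ a : ℝ, 0 < a ∧ a ≤ 1 / 64 ∧ 64 * a ≤ (1 - z) ^ 2 ∧
      16 * D * a ≤ c ^ 2 ∧ 256 * C₂ * a ≤ c ^ 2 ∧ 8 * C₂ * a ≤ 1 := by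
    have hD0 : 0 < D := by linarith
    have key : ∀ b₁ b₂ b₃ b₄ b₅ : ℝ, 0 < b₁ → 0 < b₂ → 0 < b₃ → 0 < b₄ → 0 < b₅ →
        ∃ a : ℝ, 0 < a ∧ a ≤ b₁ ∧ a ≤ b₂ ∧ a ≤ b₃ ∧ a ≤ b₄ ∧ a ≤ b₅ :=
      fun b₁ b₂ b₃ b₄ b₅ h₁ h₂ h₃ h₄ h₅ => ⟨min b₁ (min b₂ (min b₃ (min b₄ b₅))), by simp [*],
        by simp, by simp, by simp, by simp, by simp⟩
    obtain ⟨a, ha, h₁, h₂, h₃, h₄, h₅⟩ := key (1 / 64) ((1 - z) ^ 2 / 64) (c ^ 2 / (16 * D))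
      (c ^ 2 / (256 * C₂)) (1 / (8 * C₂)) (by norm_num) (by positivity) (by positivity)
      (by positivity) (by positivity)
    rw [le_div_iff₀ (by positivity)] at h₂ h₃ h₄ h₅
    exact ⟨a, ha, h₁, by linarith, by linarith, by linarith, by linarith⟩
  have hs0 : 0 < 1 / (16 * D * (3 * C₁ + 1)) := by positivity
  have hs1 : 1 / (16 * D * (3 * C₁ + 1)) ≤ 1 := by
    rw [div_le_one (by positivity)]
    nlinarith
  refine ⟨1 / (16 * D * (3 * C₁ + 1)), fun ϑ => a * ϑ ^ 2, hs0, fun ϑ h => by positivity,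
    le_of_eq (by field_simp), fun ϑ ω ξ q hϑ hϑ1 hω hωh hξ0 hξ hq hqh => ?_⟩
  have t1 : ϑ ^ 2 ≤ ϑ := by nlinarith
  have t2 : a * ϑ ^ 2 ≤ a := mul_le_of_le_one_right ha0.le (t1.trans hϑ1)
  have hξω : ξ ≤ a * ϑ ^ 2 := (hξ.trans (mul_le_of_le_one_left hω.le hs1)).trans hωh
  have hsq : ∀ b : ℝ, 0 ≤ b → 16 * q ≤ b ^ 2 → 4 * Real.sqrt q ≤ b := fun b hb h => by
    refine le_of_sq_le_sq ?_ hb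
    rw [mul_pow, Real.sq_sqrt hq]
    linarith
  have b1 := mul_le_mul_of_nonneg_right a3 (sq_nonneg ϑ)
  have b2 := mul_le_mul_of_nonneg_right a4 (sq_nonneg ϑ)
  have b3 := mul_le_mul_of_nonneg_right a5 (sq_nonneg ϑ)
  have b4 := mul_le_mul_of_nonneg_left hξω (show 0 ≤ D by linarith)
  have b5 := mul_le_mul_of_nonneg_left hqh (show 0 ≤ D by linarith)
  have b6 := mul_le_mul_of_nonneg_left hωh hC₂.le
  have b7 : q ≤ D * q := le_mul_of_one_le_left hq hD
  have hx2 : (c * ϑ) ^ 2 ≤ 1 := pow_le_one₀ (by positivity) (mul_le_one₀ hc1 hϑ.le hϑ1)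
  have ex : (c * ϑ) ^ 2 = c ^ 2 * ϑ ^ 2 := mul_pow _ _ _
  refine ⟨by linarith, by linarith, by linarith, by linarith, hsq _ (by norm_num) (by linarith),
    hsq _ (by linarith) (by linarith), hsq _ (by positivity) (by linarith), by linarith, by linarith,
    by linarith, by linarith⟩

end Contraction
end SpaceTime

namespace SpaceTime

/-! ### Iterated reduction along the passings -/

section Sequences

/-- Strong induction on `j`, splitting off the last passing before `j`. The exponent counts passings
in `[i, j)`, which is the number of reductions between `i` and `j`. -/
theorem le_pow_ncard_mul {pass : ℕ → Prop} {f : ℕ → ℝ} {ρ : ℝ} {N : ℕ} (hρ : 0 ≤ ρ)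
    (h : ∀ i j, i < j → j ≤ N → pass i → pass j → (∀ n, i < n → n < j → ¬ pass n) →
      f j ≤ ρ * f i) {i : ℕ} (hi : pass i) :
    ∀ j, i ≤ j → j ≤ N → pass j → f j ≤ ρ ^ {n | i ≤ n ∧ n < j ∧ pass n}.ncard * f i := by
  intro j
  induction j using Nat.strong_induction_on with
  | _ j ih =>
    intro hij hj hpj
    rcases hij.eq_or_lt with rfl | hlt
    · have : {n | i ≤ n ∧ n < i ∧ pass n} = ∅ := by
        ext n
        simp only [mem_ofPred_eq, mem_empty_iff_false, iff_false]
        omega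
      rw [this, ncard_empty, pow_zero, one_mul]
    · classical
      obtain ⟨k, ⟨hik, hkj, hpk⟩, hk⟩ : ∃ k, (i ≤ k ∧ k < j ∧ pass k) ∧
          ∀ n, k < n → n < j → ¬ pass n := by
        have hfin : {n | i ≤ n ∧ n < j ∧ pass n}.Finite :=
          (finite_lt_nat j).subset fun n hn => hn.2.1
        obtain ⟨k, hk, hmax⟩ := hfin.exists_maximal ⟨i, le_rfl, hlt, hi⟩
        refine ⟨k, hk, fun n hkn hnj hn => ?_⟩
        have := hmax ⟨hk.1.trans hkn.le, hnj, hn⟩ hkn.le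
        omega
      have e : {n | i ≤ n ∧ n < j ∧ pass n} = insert k {n | i ≤ n ∧ n < k ∧ pass n} := by
        ext n
        simp only [mem_ofPred_eq, mem_insert_iff]
        constructor
        · rintro ⟨h1, h2, h3⟩
          rcases lt_trichotomy n k with h4 | h4 | h4
          · exact Or.inr ⟨h1, h4, h3⟩
          · exact Or.inl h4
          · exact absurd h3 (hk n h4 h2)
        · rintro (rfl | ⟨h1, h2, h3⟩)
          · exact ⟨hik, hkj, hpk⟩
          · exact ⟨h1, h2.trans hkj, h3⟩
      have hfin : {n | i ≤ n ∧ n < k ∧ pass n}.Finite :=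
        (finite_lt_nat k).subset fun n hn => hn.2.1
      rw [e, ncard_insert_of_notMem (by simp) hfin, pow_succ', mul_assoc]
      exact (h k j hkj hj hpk hpj hk).trans
        (mul_le_mul_of_nonneg_left (ih k hkj hik (hkj.le.trans hj) hpk) hρ)

/-- Without a further passing `t` would be halved forever while staying above `a`. This bounds the
inner loop. -/
theorem exists_pass_of_halving {pass : ℕ → Prop} {t : ℕ → ℝ} {a : ℝ} (ha : 0 < a)
    (h : ∀ n, ¬ pass n → a ≤ t n ∧ t (n + 1) ≤ t n / 2) (n : ℕ) : ∃ j, n ≤ j ∧ pass j := by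
  by_contra! hc
  have hk : ∀ k, t (n + k) ≤ t n * (1 / 2) ^ k := fun k => by
    induction k with
    | zero => simp
    | succ k ih =>
      have := (h (n + k) (hc _ (Nat.le_add_right _ _))).2
      rw [pow_succ, ← add_assoc]
      linarith
  have ht : 0 < t n := ha.trans_le (h n (hc n le_rfl)).1
  obtain ⟨k, hk'⟩ := exists_pow_lt_of_lt_one (div_pos ha ht) (show (1 / 2 : ℝ) < 1 by norm_num)
  rw [lt_div_iff₀ ht] at hk'
  have := (h (n + k) (hc _ (Nat.le_add_right _ _))).1
  linarith [hk k]

theorem exists_lt_of_reduction {pass : ℕ → Prop} {f : ℕ → ℝ} {ρ : ℝ} (hρ : 0 ≤ ρ) (hρ1 : ρ < 1)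
    (hpass : ∀ n, ∃ j, n ≤ j ∧ pass j)
    (h : ∀ i j, i < j → pass i → pass j → (∀ n, i < n → n < j → ¬ pass n) → f j ≤ ρ * f i)
    {a : ℝ} (ha : 0 < a) : ∃ n, pass n ∧ f n < a := by
  classical
  obtain ⟨i, -, hi⟩ := hpass 0
  have key : ∀ k, ∃ j, pass j ∧ f j ≤ ρ ^ k * f i := fun k => by
    induction k with
    | zero => exact ⟨i, hi, by simp⟩
    | succ k ih =>
      obtain ⟨j, hj, hjk⟩ := ih
      have hex := hpass (j + 1)
      have hs := Nat.find_spec hex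
      refine ⟨Nat.find hex, hs.2, ?_⟩
      refine (h j _ hs.1 hj hs.2 fun n h1 h2 h3 => Nat.find_min hex h2 ⟨h1, h3⟩).trans ?_
      rw [pow_succ', mul_assoc]
      exact mul_le_mul_of_nonneg_left hjk hρ
  rcases le_or_gt (f i) 0 with h0 | h0
  · exact ⟨i, hi, h0.trans_lt ha⟩
  · obtain ⟨k, hk⟩ := exists_pow_lt_of_lt_one (div_pos ha h0) hρ1
    obtain ⟨j, hj, hjk⟩ := key k
    rw [lt_div_iff₀ h0] at hk
    exact ⟨j, hj, hjk.trans_lt hk⟩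

end Sequences

/-! ### Executions of the algorithm -/

namespace ParabolicProblem
namespace Discretization

variable {V : Type u} {H : Type v} [NormedAddCommGroup V] [InnerProductSpace ℝ V]
  [NormedAddCommGroup H] [InnerProductSpace ℝ H] {P : ParabolicProblem V H}
  {D : P.Discretization}

namespace DataApprox

variable {g : StrongDual ℝ P.Y} {u₀ : H} {R : D.DataApprox g u₀} {p : Params} {δ₀ : D.Δ} {t₀ : ℝ}
  {c : ℕ → D.Config} {N : ℕ}

theorem Computed.mem {δ : D.Δ} {t : ℝ} {c : D.Config} (h : R.Computed δ t c) :
    c.u ∈ D.X c.δ ∧ c.t = R.algError c.δ c.u := by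
  obtain ⟨rfl, h1, h2, -⟩ := h
  exact ⟨h1, h2⟩

theorem IsRun.mem (h : R.IsRun p δ₀ t₀ c N) {n : ℕ} (hn : n ≤ N) :
    (c n).u ∈ D.X (c n).δ ∧ (c n).t = R.algError (c n).δ (c n).u := by
  cases n with
  | zero => exact h.1.mem
  | succ n =>
    obtain ⟨-, ⟨-, h1⟩ | ⟨-, δ', -, h1⟩⟩ := h.2 n hn
    · exact h1.mem
    · exact h1.mem

/-- The index changes only at a passing, so at the next passing it is still the one selected at the
previous passing. -/
theorem IsRun.refines (h : R.IsRun p δ₀ t₀ c N) {i j : ℕ} (hij : i < j) (hj : j ≤ N)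
    (hi : R.Passes p (c i)) (hn : ∀ n, i < n → n < j → ¬ R.Passes p (c n)) :
    R.Refines p (c i) (c j).δ := by
  obtain ⟨k, rfl⟩ := Nat.exists_eq_add_of_lt hij
  induction k with
  | zero =>
    obtain ⟨-, ⟨h1, -⟩ | ⟨-, δ', h1, h2, -⟩⟩ := h.2 i hj
    · exact absurd hi h1
    · rw [add_zero, h2]
      exact h1
  | succ k ih =>
    have h1 := ih (by omega) (by omega) fun n h1 h2 => hn n h1 (by omega)
    obtain ⟨-, ⟨-, h2, -⟩ | ⟨h2, -⟩⟩ := h.2 (i + k + 1) hj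
    · rw [← add_assoc i k 1, h2]
      exact h1
    · exact absurd h2 (hn _ (by omega) (by omega))

end DataApprox

end Discretization
end ParabolicProblem
end SpaceTime

/-! ### Error bounds, reduction and termination for the algorithm -/

namespace SpaceTime
namespace ParabolicProblem
namespace Discretization

variable {V : Type u} {H : Type v} [NormedAddCommGroup V] [InnerProductSpace ℝ V]
  [NormedAddCommGroup H] [InnerProductSpace ℝ H] {P : ParabolicProblem V H}
  {D : P.Discretization} {E : Type*} [NormedAddCommGroup E] [InnerProductSpace ℝ E]

theorem norm_sub_le_add (J : P.X ≃L[ℝ] E) (x y z : P.X) :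
    ‖J (x - z)‖ ≤ ‖J (x - y)‖ + ‖J (y - z)‖ := by
  rw [← sub_add_sub_cancel x y z, map_add]
  exact norm_add_le _ _

theorem norm_map_sub_rev (J : P.X ≃L[ℝ] E) (x y : P.X) : ‖J (x - y)‖ = ‖J (y - x)‖ := by
  rw [← neg_sub, map_neg, norm_neg]

theorem DataApprox.η_nonneg {g : StrongDual ℝ P.Y} {u₀ : H} (R : D.DataApprox g u₀) (δ : D.Δ) :
    0 ≤ R.η δ :=
  (add_nonneg (P.dualNorm_nonneg _ _) (norm_nonneg _)).trans (R.osc_le δ)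

variable [CompleteSpace V] [CompleteSpace H] [CompleteSpace E]
  {J : P.X ≃L[ℝ] E} (hN : ∀ w, ‖J w‖ = P.normX w) {q : ℝ}
  (hS : ∀ δ, ∀ z ∈ D.X δ, ∀ w,
    |D.SForm δ w z - inner ℝ (J w) (J z)| ≤ 4 * Real.sqrt q * ‖J w‖ * ‖J z‖)
  {g : StrongDual ℝ P.Y} {u₀ : H} (R : D.DataApprox g u₀) {u : P.X}
  (hsol : ∀ δ, ∃ uh, P.IsSolution (R.gd δ) (R.u₀d δ) uh)
  (hosc : ∀ δ uh, P.IsSolution (R.gd δ) (R.u₀d δ) uh → ‖J (u - uh)‖ ≤ R.η δ)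

include hN hS in
theorem norm_sub_le_mul_estimator {k₁ k₂ m M ζ C₁ : ℝ} (hk₁ : 0 < k₁) (hK : D.KXBound k₁ k₂)
    (hM : 0 ≤ M) (hΘ : D.StableComplement m M) (hsat : D.Saturation ζ) (hζ : max ζ 0 < 1)
    (hσ : 4 * Real.sqrt q ≤ (1 - max ζ 0) / 2)
    (hC₁ : C₁ = 2 * M * (1 + Real.sqrt k₂) / (1 - max ζ 0)) {δ : D.Δ} {uh ut : P.X}
    (hu : P.IsSolution (R.gd δ) (R.u₀d δ) uh) (hut : ut ∈ D.X δ) :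
    ‖J (uh - ut)‖ ≤ C₁ * (R.resNorm δ ut Finset.univ + R.algError δ ut) := by
  have h := norm_sub_le_estimator hN hS R hu hk₁ hK hM hΘ hsat
    (mul_nonneg zero_le_four (Real.sqrt_nonneg q)) hσ hut
  have hr := resNorm_nonneg R ut (Finset.univ : Finset (D.J δ))
  have ht := algError_nonneg R (δ := δ) ut
  have hk := Real.sqrt_nonneg k₂
  have h1 := mul_nonneg hM (mul_nonneg hk hr)
  have h2 := mul_nonneg hM ht
  rw [hC₁, div_mul_eq_mul_div, le_div_iff₀ (sub_pos.2 hζ)]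
  linarith

include hN hS hsol hosc

/-- The error bound at termination. -/
theorem norm_sub_add_le_of_stops {k₁ k₂ m M ζ C₁ : ℝ} {p : Params} (hk₁ : 0 < k₁)
    (hK : D.KXBound k₁ k₂)
    (hM : 0 ≤ M) (hΘ : D.StableComplement m M) (hsat : D.Saturation ζ) (hζ : max ζ 0 < 1)
    (hσ : 4 * Real.sqrt q ≤ (1 - max ζ 0) / 2) (hC₁0 : 0 ≤ C₁)
    (hC₁ : C₁ = 2 * M * (1 + Real.sqrt k₂) / (1 - max ζ 0)) {c : D.Config}
    (hc : c.u ∈ D.X c.δ ∧ c.t = R.algError c.δ c.u) (hst : R.Stops p c) :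
    ‖J (u - c.u)‖ + R.η c.δ ≤ (C₁ + 2) * p.eps := by
  obtain ⟨uh, hu⟩ := hsol c.δ
  have h1 := norm_sub_le_mul_estimator hN hS R hk₁ hK hM hΘ hsat hζ hσ hC₁ hu hc.1
  rw [← hc.2] at h1
  have hE := norm_sub_le_add J u uh c.u
  have ho := hosc c.δ uh hu
  have hη := R.η_nonneg c.δ
  have hr := resNorm_nonneg R c.u (Finset.univ : Finset (D.J c.δ))
  have ht := algError_nonneg R (δ := c.δ) c.u
  rw [← hc.2] at ht
  have h2 := mul_le_mul_of_nonneg_left hst (add_nonneg hC₁0 zero_le_two)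
  rw [DataApprox.estimator] at h2
  have := mul_nonneg hC₁0 hη
  linarith

omit [CompleteSpace E] in
theorem resNorm_le_mul {m M : ℝ} (hm : 0 < m) (hΘ : D.StableComplement m M)
    (hσ : 4 * Real.sqrt q ≤ 1 / 2) {δ : D.Δ} (ut : P.X) :
    R.resNorm δ ut Finset.univ ≤ 2 / m * (‖J (u - ut)‖ + R.η δ) := by
  obtain ⟨uh, hu⟩ := hsol δ
  refine (resNorm_le hN hS R hu hm (mul_nonneg zero_le_four (Real.sqrt_nonneg q)) hσ hΘ ut).trans ?_
  refine mul_le_mul_of_nonneg_left ?_ (div_nonneg zero_le_two hm.le)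
  have := hosc δ uh hu
  rw [norm_map_sub_rev] at this
  linarith [norm_sub_le_add J uh u ut]

omit [CompleteSpace E] in
-- At a passing the algebraic part of the estimator is absorbed, so the estimator is controlled by
-- the very quantities that decay. This yields termination.
theorem estimator_le_of_passes {m M ω ϑ ξ ε : ℝ} (hm : 0 < m) (hΘ : D.StableComplement m M)
    (hσ : 4 * Real.sqrt q ≤ 1 / 2) (hξ0 : 0 ≤ ξ) (hξ : ξ ≤ 1 / 2) {c : D.Config}
    (hp : R.Passes ⟨ω, ϑ, ξ, ε⟩ c) :
    R.estimator c ≤ 2 * (2 / m * (‖J (u - c.u)‖ + R.η c.δ) + R.η c.δ) := by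
  have h1 := resNorm_le_mul hN hS R hsol hosc hm hΘ hσ (δ := c.δ) c.u
  have hr := resNorm_nonneg R c.u (Finset.univ : Finset (D.J c.δ))
  have hη := R.η_nonneg c.δ
  have h2 := algError_le_of_le_mul_estimator hr hη hξ0 hξ hp.2
  have h3 : 2 * ξ * (R.resNorm c.δ c.u Finset.univ + R.η c.δ)
      ≤ R.resNorm c.δ c.u Finset.univ + R.η c.δ :=
    mul_le_of_le_one_left (add_nonneg hr hη) (by linarith)
  rw [DataApprox.estimator]
  linarith

omit hsol in
-- Quasi-optimality holds for the approximation of `uh`. One of the two oscillation terms stems from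
-- the algebraic error, the other one from replacing `uh` by `u`.
theorem norm_sub_le_of_passes {k₁ k₂ m M C C₂ ω ϑ ξ ε : ℝ} (hk₁ : 0 < k₁)
    (hK : D.KXBound k₁ k₂) (hm : 0 < m) (hΘ : D.StableComplement m M) (hC₂ : C₂ = 2 / m)
    (hC : C = 33 * (4 * (2 * Real.sqrt k₂) * (C₂ + 1)) + 32) (hξ0 : 0 ≤ ξ) (hξ : ξ ≤ 1 / 2)
    (hCξ : C * ξ ≤ 1 / 2) (hq : 0 ≤ q) (hq1 : q ≤ 1) (hσ : 4 * Real.sqrt q ≤ 1 / 2)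
    {c : D.Config} (hc : c.u ∈ D.X c.δ ∧ c.t = R.algError c.δ c.u)
    (hp : R.Passes ⟨ω, ϑ, ξ, ε⟩ c) {uh x : P.X} (hu : P.IsSolution (R.gd c.δ) (R.u₀d c.δ) uh)
    (hx : x ∈ D.X c.δ) :
    ‖J (u - c.u)‖ ≤ (1 + C * (ξ + q)) * ‖J (uh - x)‖ + 2 * R.η c.δ := by
  have hσ0 := mul_nonneg zero_le_four (Real.sqrt_nonneg q)
  have hk := Real.sqrt_nonneg k₂
  have hC₂0 : 0 ≤ C₂ := by rw [hC₂]; positivity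
  have hr := resNorm_nonneg R c.u (Finset.univ : Finset (D.J c.δ))
  have hη := R.η_nonneg c.δ
  have h1 := norm_sub_le_bestApprox_add hN hS R hu hk₁ hK hσ0 hσ hc.1 hx
  rw [mul_pow, Real.sq_sqrt hq, ← hc.2] at h1
  have h2 := algError_le_of_le_mul_estimator hr hη hξ0 hξ hp.2
  have h3 := resNorm_le hN hS R hu hm hσ0 hσ hΘ c.u
  rw [← hC₂] at h3
  have hC0 : 0 ≤ 2 * Real.sqrt k₂ * (C₂ + 1) * ξ := by positivity
  have h4 := le_of_quasi_optimal hC₂0 (mul_nonneg zero_le_two hk) hξ0 hq hq1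
    (norm_nonneg (J (uh - x))) hη (by rw [hC] at hCξ; linarith) (by linarith) h2 h3
  rw [← hC] at h4
  linarith [norm_sub_le_add J u uh c.u, hosc c.δ uh hu]

theorem reduction_of_refines {k₁ k₂ m M ζ C₁ C₂ C : ℝ} {ω ϑ ξ ε s : ℝ} (hk₁ : 0 < k₁)
    (hK : D.KXBound k₁ k₂) (hm : 0 < m) (hmM : m ≤ M)
    (hΘ : D.StableComplement m M) (hsat : D.Saturation ζ) (hζ : max ζ 0 < 1)
    (hC₁ : C₁ = 2 * M * (1 + Real.sqrt k₂) / (1 - max ζ 0)) (hC₁0 : 0 < C₁) (hmC : m ≤ 4 * C₁)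
    (hC₂ : C₂ = 2 / m) (hC : C = 33 * (4 * (2 * Real.sqrt k₂) * (C₂ + 1)) + 32)
    (hϑ : 0 < ϑ) (hϑ1 : ϑ ≤ 1 / 16) (hω : 0 < ω) (hω1 : ω ≤ 1) (hξ0 : 0 ≤ ξ) (hξ : ξ ≤ 1 / 4)
    (hCξ : C * ξ ≤ 1 / 2) (hq : 0 ≤ q) (hq1 : q ≤ 1) (hσ1 : 4 * Real.sqrt q ≤ 1 / 2)
    (hσ2 : 4 * Real.sqrt q ≤ (1 - max ζ 0) / 2)
    (hσ3 : 4 * Real.sqrt q ≤ m / (4 * C₁) * ϑ) (hs : 16 * C * (3 * C₁ + 1) * s ≤ 1)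
    (hξs : ξ ≤ s * ω) (hqs : q ≤ s * ω) (hd : C * (ξ + q) ≤ (m / (4 * C₁) * ϑ) ^ 2 / 8)
    (hd1 : C * (ξ + q) ≤ 1)
    (hωC : 16 * C₂ * ω ≤ (m / (4 * C₁) * ϑ) ^ 2 / 16) (hωϑ : 8 * C₂ * ω ≤ ϑ)
    {c c' : D.Config} (hc : c.u ∈ D.X c.δ ∧ c.t = R.algError c.δ c.u)
    (hc' : c'.u ∈ D.X c'.δ ∧ c'.t = R.algError c'.δ c'.u)
    (hp : R.Passes ⟨ω, ϑ, ξ, ε⟩ c) (hp' : R.Passes ⟨ω, ϑ, ξ, ε⟩ c')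
    (href : R.Refines ⟨ω, ϑ, ξ, ε⟩ c c'.δ) :
    ϑ * ‖J (u - c'.u)‖ + R.η c'.δ ≤
      max (1 - 1 / 4 / (1 + ϑ * (3 * C₁ + 1) / ω)) (1 - (m / (4 * C₁) * ϑ) ^ 2 / 4) *
        (ϑ * ‖J (u - c.u)‖ + R.η c.δ) := by
  obtain ⟨uh, hu⟩ := hsol c.δ
  obtain ⟨uh', hu'⟩ := hsol c'.δ
  have hσ0 := mul_nonneg zero_le_four (Real.sqrt_nonneg q)
  have hk := Real.sqrt_nonneg k₂
  have hC₂0 : 0 ≤ C₂ := by rw [hC₂]; positivity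
  have hC0 : 0 ≤ C := by rw [hC]; positivity
  have hr := resNorm_nonneg R c.u (Finset.univ : Finset (D.J c.δ))
  have hη := R.η_nonneg c.δ
  have hη' := R.η_nonneg c'.δ
  have ht := algError_le_of_le_mul_estimator hr hη hξ0 (by linarith) hp.2
  have hE := norm_nonneg (J (u - c.u))
  have hÊ := norm_sub_le_mul_estimator hN hS R hk₁ hK (hm.le.trans hmM) hΘ hsat hζ hσ2 hC₁ hu hc.1
  rw [← hc.2] at hÊ
  have ho := hosc c.δ uh hu
  have ho' := hosc c'.δ uh' hu'
  have hnext : ∀ x ∈ D.X c'.δ,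
      ‖J (u - c'.u)‖ ≤ (1 + C * (ξ + q)) * ‖J (uh' - x)‖ + 2 * R.η c'.δ := fun x hx =>
    norm_sub_le_of_passes hN hS R hosc hk₁ hK hm hΘ hC₂ hC hξ0 (by linarith) hCξ hq hq1 hσ1
      hc' hp' hu' hx
  have hpos : 0 ≤ ϑ * ‖J (u - c.u)‖ + R.η c.δ := add_nonneg (mul_nonneg hϑ.le hE) hη
  -- The next approximation is compared with a suitable element of the new trial space. Under
  -- oscillation this is the old approximation, and under bulk chasing it is the best approximation
  -- of the old `uh`; the switch from `uh` to `uh'` costs oscillation only.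
  rcases href with ⟨h1, h2, h3⟩ | ⟨h1, h2, h3, S, h4, h5⟩
  · refine le_trans ?_ (mul_le_mul_of_nonneg_right (le_max_left _ _) hpos)
    have hb := norm_sub_le_add J uh' u c.u
    rw [norm_map_sub_rev J uh' u] at hb
    have hE' := norm_sub_le_add J u uh c.u
    exact reduction_of_oscillation hC₁0.le hC0 hω hω1 hϑ hϑ1 hξ0 (by linarith) hs hξs hqs hq hd1
      hE hr hη' (by linarith) hÊ ht h1.le h3 (by linarith) (hnext c.u (h2 hc.1))
  · refine le_trans ?_ (mul_le_mul_of_nonneg_right (le_max_right _ _) hpos)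
    obtain ⟨x, hx, hpyth, hx2⟩ := exists_bulk_reduction hN hS R hu hm hσ0 hΘ h2 h3 h5 hc.1
    have hηη := R.η_anti _ _ h2
    have hb1 := norm_sub_le_add J uh' u x
    have hb2 := norm_sub_le_add J u uh x
    rw [norm_map_sub_rev J uh' u] at hb1
    have hEÊ := norm_sub_le_add J uh u c.u
    rw [norm_map_sub_rev J uh u] at hEÊ
    have hres := resNorm_le hN hS R hu hm hσ0 hσ1 hΘ c.u
    rw [← hC₂] at hres
    exact reduction_of_bulk hC₁0 hm hmC hC₂0 hω hω1 hϑ (by linarith) hξ hσ3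
      (mul_nonneg hC0 (add_nonneg hξ0 hq)) hd hωC hωϑ hE (norm_nonneg _) hr hη
      (by linarith) hÊ ht h1 hres h4 hpyth hx2 hηη (by linarith) (hnext x hx)

omit hN hosc [CompleteSpace E] in
theorem exists_computed (hσ : 4 * Real.sqrt q ≤ 1 / 2) (δ : D.Δ) {t : ℝ} (ht : 0 ≤ t) :
    ∃ c, R.Computed δ t c := by
  obtain ⟨uh, hu⟩ := hsol δ
  obtain ⟨ut, hut, h0⟩ :=
    exists_algError_eq_zero hS R hu (mul_nonneg zero_le_four (Real.sqrt_nonneg q)) hσ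
  exact ⟨⟨δ, ut, R.algError δ ut⟩, rfl, hut, rfl, h0.le.trans (div_nonneg ht zero_le_two)⟩

omit hN hS hsol hosc [CompleteSpace V] [CompleteSpace H] [CompleteSpace E] in
-- If oscillation dominates, it is positive and the selection hypothesis applies. Otherwise the full
-- enlargement, with all indices marked, is admissible.
theorem exists_refines {p : Params} (hω : 0 ≤ p.omega) (hϑ : p.theta ≤ 1)
    (hsel : ∀ δ, 0 < R.η δ → ∃ δ', D.X δ ≤ D.X δ' ∧ R.η δ' ≤ R.η δ / 2) (c : D.Config) :
    ∃ δ', R.Refines p c δ' := by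
  have hr := resNorm_nonneg R c.u (Finset.univ : Finset (D.J c.δ))
  rcases lt_or_ge (p.omega * R.resNorm c.δ c.u Finset.univ) (R.η c.δ) with h1 | h1
  · obtain ⟨δ', h2, h3⟩ := hsel c.δ ((mul_nonneg hω hr).trans_lt h1)
    exact ⟨δ', Or.inl ⟨h1, h2, h3⟩⟩
  · refine ⟨D.enl c.δ, Or.inr ⟨h1, D.le_enl _, le_rfl, Finset.univ,
      mul_le_of_le_one_left hr hϑ, fun i _ => ?_⟩⟩
    rw [← D.span_θ]
    exact Submodule.mem_sup_right (Submodule.subset_span ⟨i, rfl⟩)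

omit hN hosc [CompleteSpace E] in
/-- An execution that has not stopped can be continued. -/
theorem exists_step {p : Params} (hσ : 4 * Real.sqrt q ≤ 1 / 2) (hω : 0 ≤ p.omega)
    (hϑ : p.theta ≤ 1) (hε : 0 < p.eps)
    (hsel : ∀ δ, 0 < R.η δ → ∃ δ', D.X δ ≤ D.X δ' ∧ R.η δ' ≤ R.η δ / 2) {c : D.Config}
    (hc : c.t = R.algError c.δ c.u) (hns : ¬ R.Stops p c) : ∃ c', R.Step p c c' := by
  by_cases hp : R.Passes p c
  · obtain ⟨δ', href⟩ := exists_refines R hω hϑ hsel c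
    obtain ⟨c', hc'⟩ := exists_computed hS R hsol hσ δ' (hε.trans (not_le.1 hns)).le
    exact ⟨c', hns, Or.inr ⟨hp, δ', href, hc'⟩⟩
  · have ht : 0 ≤ c.t := by
      rw [hc]
      exact algError_nonneg R _
    obtain ⟨c', hc'⟩ := exists_computed hS R hsol hσ c.δ ht
    exact ⟨c', hns, Or.inl ⟨hp, hc'⟩⟩

omit [CompleteSpace E] in
/-- There is no infinite execution. -/
theorem not_forall_isRun {m M ω ϑ ξ ε ρ t₀ : ℝ} {δ₀ : D.Δ} (hm : 0 < m)
    (hΘ : D.StableComplement m M) (hσ : 4 * Real.sqrt q ≤ 1 / 2) (hϑ : 0 < ϑ) (hξ0 : 0 < ξ)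
    (hξ : ξ ≤ 1 / 2) (hε : 0 < ε) (hρ0 : 0 ≤ ρ) (hρ1 : ρ < 1) {c : ℕ → D.Config}
    (hrun : ∀ N, R.IsRun ⟨ω, ϑ, ξ, ε⟩ δ₀ t₀ c N)
    (hred : ∀ i j, i < j → R.Passes ⟨ω, ϑ, ξ, ε⟩ (c i) → R.Passes ⟨ω, ϑ, ξ, ε⟩ (c j) →
      (∀ n, i < n → n < j → ¬ R.Passes ⟨ω, ϑ, ξ, ε⟩ (c n)) →
      ϑ * ‖J (u - (c j).u)‖ + R.η (c j).δ ≤ ρ * (ϑ * ‖J (u - (c i).u)‖ + R.η (c i).δ)) :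
    False := by
  have hns : ∀ n, ε < R.estimator (c n) := fun n =>
    not_le.1 ((hrun (n + 1)).2 n (Nat.lt_succ_self n)).1
  -- As long as the until-clause fails, `t` exceeds `ξ` times the estimator, which exceeds `ε`.
  have hpass := exists_pass_of_halving (pass := fun n => R.Passes ⟨ω, ϑ, ξ, ε⟩ (c n))
    (t := fun n => (c n).t) (a := ξ * ε) (mul_pos hξ0 hε) fun n hn => by
      obtain ⟨h1, ⟨-, h2⟩ | ⟨h2, -⟩⟩ := (hrun (n + 1)).2 n (Nat.lt_succ_self n)
      · refine ⟨?_, h2.2.2.2⟩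
        have h3 : ξ * R.estimator (c n) < (c n).t := not_le.1 fun h => hn ⟨h1, h⟩
        exact (mul_le_mul_of_nonneg_left (hns n).le hξ0.le).trans h3.le
      · exact absurd h2 hn
  -- The factor by which the estimator at a passing is bounded in terms of the weighted quantity;
  -- `ϑ⁻¹` removes the weight from the error.
  have hK : 0 < 2 * (2 / m * (ϑ⁻¹ + 1) + 1) := by positivity
  obtain ⟨n, hn, hlt⟩ := exists_lt_of_reduction (pass := fun n => R.Passes ⟨ω, ϑ, ξ, ε⟩ (c n))
    (f := fun n => ϑ * ‖J (u - (c n).u)‖ + R.η (c n).δ) hρ0 hρ1 hpass hred (div_pos hε hK)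
  have h1 := estimator_le_of_passes hN hS R hsol hosc hm hΘ hσ hξ0.le hξ hn
  have hη := R.η_nonneg (c n).δ
  have hE := norm_nonneg (J (u - (c n).u))
  obtain ⟨f, hf⟩ : ∃ f, f = ϑ * ‖J (u - (c n).u)‖ + R.η (c n).δ := ⟨_, rfl⟩
  have h2 : ‖J (u - (c n).u)‖ ≤ ϑ⁻¹ * f := by
    rw [inv_mul_eq_div, le_div_iff₀ hϑ]
    linarith
  have h3 : R.η (c n).δ ≤ f := by
    rw [hf]
    exact le_add_of_nonneg_left (mul_nonneg hϑ.le hE)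
  have h4 := mul_le_mul_of_nonneg_left (add_le_add h2 h3) (div_nonneg zero_le_two hm.le)
  have h5 := (lt_div_iff₀ hK).1 hlt
  rw [← hf] at h5
  linarith [hns n]

end Discretization
end ParabolicProblem
end SpaceTime

/-! ### Choice of constants and the main theorem -/

set_option maxHeartbeats 1000000 in
theorem theorem4p8 (ζ m M k₁ k₂ : ℝ) (hζ : ζ < 1) (hm : 0 < m) (hmM : m ≤ M)
    (hk₁ : 0 < k₁) (hk₂ : k₁ ≤ k₂) :
    -- thresholds `ϑ₀`, `s`, `h(ϑ)` and the constant `C` of the final error estimate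
    ∃ ϑ₀ s C : ℝ, ∃ h : ℝ → ℝ, 0 < ϑ₀ ∧ 0 < s ∧ 0 < C ∧ (∀ ϑ : ℝ, 0 < ϑ → 0 < h ϑ) ∧
    ∀ ϑ ω ξ : ℝ, 0 < ϑ → ϑ ≤ 1 → ϑ ≤ ϑ₀ →
      0 < ω → ω / ϑ ≤ s → ω ≤ h ϑ →
      0 < ξ → ξ < 1 → ξ / ϑ ≤ s → ξ / ω ≤ s →
    -- the reduction factor
    ∃ ρ : ℝ, 0 ≤ ρ ∧ ρ < 1 ∧
    ∀ (V : Type u) (H : Type v)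
      [NormedAddCommGroup V] [InnerProductSpace ℝ V] [CompleteSpace V]
      [TopologicalSpace.SeparableSpace V]
      [NormedAddCommGroup H] [InnerProductSpace ℝ H] [CompleteSpace H]
      [TopologicalSpace.SeparableSpace H]
      (P : SpaceTime.ParabolicProblem V H)
      (D : SpaceTime.ParabolicProblem.Discretization.{u, v, w} P) (κ : ℝ),
      0 < D.infSup → 1 ≤ κ → D.KYBound κ →
      (κ / D.infSup - 1) / ω ≤ s → κ / D.infSup - 1 ≤ h ϑ →
      D.KXBound k₁ k₂ → D.StableComplement m M → D.Saturation ζ →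
    ∀ (g : StrongDual ℝ P.Y) (u₀ : H) (R : D.DataApprox g u₀) (ε : ℝ) (δ₀ : D.Δ) (t₀ : ℝ),
      0 < ε → 0 ≤ t₀ →
      let p : SpaceTime.ParabolicProblem.Discretization.Params := ⟨ω, ϑ, ξ, ε⟩
      (∀ u : P.X, P.IsSolution g u₀ u →
        ∀ (c : ℕ → D.Config) (N : ℕ), R.IsRun p δ₀ t₀ c N →
          -- reduction between two successive passings of the until-clause
          (∀ i j, i < j → j ≤ N → R.Passes p (c i) → R.Passes p (c j) →
            (∀ n, i < n → n < j → ¬ R.Passes p (c n)) →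
            ϑ * P.normX (u - (c j).u) + R.η (c j).δ
              ≤ ρ * (ϑ * P.normX (u - (c i).u) + R.η (c i).δ)) ∧
          -- r-linear convergence at the passings of the until-clause
          (∀ i j, i ≤ j → j ≤ N → R.Passes p (c i) → R.Passes p (c j) →
            P.normX (u - (c j).u) + R.η (c j).δ
              ≤ ϑ⁻¹ * ρ ^ {n | i ≤ n ∧ n < j ∧ R.Passes p (c n)}.ncard *
                (P.normX (u - (c i).u) + R.η (c i).δ)) ∧
          -- the error at termination
          (R.Stops p (c N) → P.normX (u - (c N).u) + R.η (c N).δ ≤ C * ε)) ∧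
      -- termination: there is no infinite execution, ...
      (¬ ∃ c : ℕ → D.Config, ∀ N, R.IsRun p δ₀ t₀ c N) ∧
      -- ... and, if the selections with `η(δ') ≤ η(δ) / 2` are possible, no execution gets stuck
      ((∀ δ, 0 < R.η δ → ∃ δ', D.X δ ≤ D.X δ' ∧ R.η δ' ≤ R.η δ / 2) →
        (∃ c, R.Computed δ₀ t₀ c) ∧
        ∀ (c : ℕ → D.Config) (N : ℕ), R.IsRun p δ₀ t₀ c N → ¬ R.Stops p (c N) →
          ∃ c', R.Step p (c N) c') := by
  -- A negative `ζ` is admitted, while the absorption arguments need a factor in `[0, 1)`.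
  set z := max ζ 0 with hz
  have hz0 : 0 ≤ z := le_max_right _ _
  have hz1 : z < 1 := max_lt hζ one_pos
  have hz1' : 0 < 1 - z := sub_pos.2 hz1
  have hk : 0 ≤ Real.sqrt k₂ := Real.sqrt_nonneg _
  have hM : 0 < M := hm.trans_le hmM
  obtain ⟨C₁, hC₁⟩ : ∃ C₁, C₁ = 2 * M * (1 + Real.sqrt k₂) / (1 - z) := ⟨_, rfl⟩
  have hC₁0 : 0 < C₁ := by rw [hC₁]; positivity
  have hmC : m ≤ 4 * C₁ := by
    have h1 : M ≤ C₁ := by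
      rw [hC₁, le_div_iff₀ hz1']
      have := mul_nonneg hM.le hk
      have := mul_nonneg hM.le hz0
      linarith
    linarith
  obtain ⟨C₂, hC₂⟩ : ∃ C₂, C₂ = 2 / m := ⟨_, rfl⟩
  have hC₂0 : 0 < C₂ := by rw [hC₂]; positivity
  obtain ⟨C, hC⟩ : ∃ C, C = 33 * (4 * (2 * Real.sqrt k₂) * (C₂ + 1)) + 32 := ⟨_, rfl⟩
  have hC0 : 1 ≤ C := by
    have : 0 ≤ 33 * (4 * (2 * Real.sqrt k₂) * (C₂ + 1)) := by positivity
    linarith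
  obtain ⟨s, h, hs0, hh0, hs, hth⟩ := SpaceTime.exists_thresholds hC₁0 hC₂0 hC0 hm hmC hz1
  -- The threshold `1 / 16` is the weight allowed in the oscillation case. In `C₁ + 2` the first
  -- part is the reliability constant; the rest covers the oscillation in `u - uh` and the
  -- oscillation term itself.
  refine ⟨1 / 16, s, C₁ + 2, h, by norm_num, hs0, by positivity, hh0, ?_⟩
  intro ϑ ω ξ hϑ hϑ1 hϑ0 hω _ hωh hξ _ _ hξω
  -- The larger of the two reduction factors. It involves only the parameters and the given
  -- constants, so it is uniform over all problems and discretizations.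
  obtain ⟨ρ, hρ⟩ : ∃ ρ, ρ = max (1 - 1 / 4 / (1 + ϑ * (3 * C₁ + 1) / ω))
    (1 - (m / (4 * C₁) * ϑ) ^ 2 / 4) := ⟨_, rfl⟩
  have hρ0 : 0 ≤ ρ := by
    rw [hρ]
    refine le_max_of_le_left (sub_nonneg.2 ?_)
    rw [div_le_one (by positivity)]
    have : 0 ≤ ϑ * (3 * C₁ + 1) / ω := by positivity
    linarith
  have hρ1 : ρ < 1 := by
    rw [hρ]
    refine max_lt (sub_lt_self _ ?_) (sub_lt_self _ ?_) <;> positivity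
  refine ⟨ρ, hρ0, hρ1, ?_⟩
  intro V H _ _ _ _ _ _ _ _ P D κ hγ hκ hKY hqω hqh hKX hΘ hsat g u₀ R ε δ₀ t₀ hε ht₀ p
  obtain ⟨q, hq⟩ : ∃ q, κ / D.infSup - 1 = q := ⟨_, rfl⟩
  rw [hq] at hqω hqh
  have hq0 : 0 ≤ q := by
    rw [← hq, sub_nonneg, le_div_iff₀ hγ, one_mul]
    exact D.infSup_le_one.trans hκ
  have hξs : ξ ≤ s * ω := (div_le_iff₀ hω).1 hξω
  have hqs : q ≤ s * ω := (div_le_iff₀ hω).1 hqω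
  obtain ⟨hω1, hξ4, hCξ, hq1, hσ1, hσ2, hσ3, hd, hd1, hωC, hωϑ⟩ :=
    hth ϑ ω ξ q hϑ hϑ1 hω hωh hξ.le hξs hq0 hqh
  have hq1' : q ≤ 1 := by linarith
  obtain ⟨E, _, _, _, J, hN, hex, hstab, hform⟩ := P.exists_hilbert_model
  have hS : ∀ δ, ∀ z ∈ D.X δ, ∀ w, |D.SForm δ w z - inner ℝ (J w) (J z)|
      ≤ 4 * Real.sqrt q * ‖J w‖ * ‖J z‖ := hform D κ q hγ hκ hKY hq hq1'
  have hsol : ∀ δ, ∃ uh, P.IsSolution (R.gd δ) (R.u₀d δ) uh := fun δ => hex _ _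
  have hosc : ∀ u, P.IsSolution g u₀ u → ∀ δ uh, P.IsSolution (R.gd δ) (R.u₀d δ) uh →
      ‖J (u - uh)‖ ≤ R.η δ := fun u hu δ uh huh =>
    (hstab _ _ _ _ _ _ hu huh).trans (R.osc_le δ)
  have hred : ∀ u, P.IsSolution g u₀ u → ∀ (c : ℕ → D.Config) (N : ℕ), R.IsRun p δ₀ t₀ c N →
      ∀ i j, i < j → j ≤ N → R.Passes p (c i) → R.Passes p (c j) →
        (∀ n, i < n → n < j → ¬ R.Passes p (c n)) →
        ϑ * P.normX (u - (c j).u) + R.η (c j).δ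
          ≤ ρ * (ϑ * P.normX (u - (c i).u) + R.η (c i).δ) := by
    intro u hu c N hrun i j hij hjN hpi hpj hnp
    rw [← hN, ← hN, hρ]
    exact SpaceTime.ParabolicProblem.Discretization.reduction_of_refines hN hS R hsol (hosc u hu)
      hk₁ hKX hm hmM hΘ hsat hz1 hC₁ hC₁0 hmC hC₂ hC hϑ hϑ0 hω hω1 hξ.le hξ4 hCξ hq0 hq1' hσ1 hσ2
      hσ3 hs hξs hqs hd hd1 hωC hωϑ (hrun.mem (hij.le.trans hjN)) (hrun.mem hjN) hpi hpj
      (hrun.refines hij hjN hpi hnp)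
  refine ⟨fun u hu c N hrun => ⟨hred u hu c N hrun, ?_, ?_⟩, ?_, ?_⟩
  · intro i j hij hjN hpi hpj
    have h1 := SpaceTime.le_pow_ncard_mul (pass := fun n => R.Passes p (c n))
      (f := fun n => ϑ * P.normX (u - (c n).u) + R.η (c n).δ) hρ0 (hred u hu c N hrun) hpi j hij
      hjN hpj
    have hη := R.η_nonneg (c i).δ
    have hη' := R.η_nonneg (c j).δ
    have hE : 0 ≤ P.normX (u - (c i).u) := Real.sqrt_nonneg _
    have h2 := mul_le_mul_of_nonneg_left
      (add_le_add_left (mul_le_of_le_one_left hE hϑ1) (R.η (c i).δ))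
      (pow_nonneg hρ0 {n | i ≤ n ∧ n < j ∧ R.Passes p (c n)}.ncard)
    -- The weighted and the unweighted sums are equivalent with ratio `ϑ`. The factor `ϑ⁻¹` is paid
    -- only once, outside of the iteration.
    have h3 : ϑ * (P.normX (u - (c j).u) + R.η (c j).δ)
        ≤ ϑ * P.normX (u - (c j).u) + R.η (c j).δ := by
      rw [mul_add]
      exact add_le_add_right (mul_le_of_le_one_left hη' hϑ1) _
    rw [mul_assoc, inv_mul_eq_div, le_div_iff₀ hϑ, mul_comm]
    exact h3.trans (h1.trans h2)
  · intro hst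
    rw [← hN]
    exact SpaceTime.ParabolicProblem.Discretization.norm_sub_add_le_of_stops hN hS R hsol
      (hosc u hu) hk₁ hKX hM.le hΘ hsat hz1 hσ2 hC₁0.le hC₁ (hrun.mem le_rfl) hst
  · rintro ⟨c, hrun⟩
    -- The statement on termination involves no solution; one is supplied by surjectivity of the
    -- parabolic operator.
    obtain ⟨u, hu⟩ := hex g u₀
    refine SpaceTime.ParabolicProblem.Discretization.not_forall_isRun hN hS R hsol (hosc u hu) hm hΘ
      hσ1 hϑ hξ (by linarith) hε hρ0 hρ1 hrun fun i j hij hpi hpj hn => ?_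
    rw [hN, hN]
    exact hred u hu c j (hrun j) i j hij le_rfl hpi hpj hn
  · intro hsel
    exact ⟨SpaceTime.ParabolicProblem.Discretization.exists_computed hS R hsol hσ1 δ₀ ht₀,
      fun c N hrun hns => SpaceTime.ParabolicProblem.Discretization.exists_step hS R hsol hσ1 hω.le
        hϑ1 hε hsel (hrun.mem le_rfl).2 hns⟩
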